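/- An instance $I$ of discrete Bamboo Garden Trimming (BGT) consists of $n\ge 2$ bamboos with positive real daily growth rates $h_1\ge h_2\ge\dots\ge h_n>0$; put $H=h_1+\dots+h_n$. A schedule $S=(i_1,i_2,\dots)$ is an infinite sequence of indices in $\{1,\dots,n\}$; bamboo $i_k$ is cut to height $0$ at time $k$ (the end of day $k$). The height of bamboo $i$ at time $t\ge 0$ is $(t-t')h_i$, where $t'$ is the last time at which it was cut by time $t$, or $t'=0$ if it has not been cut by then. Let $MH(S)$ be the supremum of the heights of all bamboos over all times $t\ge 0$, and let $OPT(I)$ be the infimum of $MH(S)$ over all schedules $S$. A Pinwheel instance is a sequence of integers $2\le f_1\le\dots\le f_n$; its density is $\sum_i 1/f_i$, and a schedule of it is an infinite sequence of indices in which any $f_i$ consecutive entries contain $i$, for each $i$. A polynomial-time BGT algorithm consists of a preprocessing program, run once, and a program that is then run repeatedly, each run computing the next index of the schedule, on a random access machine with unit-time arithmetic operations ($+,-,\cdot,/$), rounding down, comparisons and memory accesses on real numbers. On every input, the preprocessing takes time polynomial in $n$, and each further index takes time polylogarithmic in $n$. Moreover, if all growth rates are rational, then every number occurring up to the computation of the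 $t$-th index is rational with bit length polynomial in the bit size of the input and in $\log t$. **Lemma.** There is a polynomial-time BGT algorithm that on every instance $I$ of discrete BGT produces a schedule $S$ with $$MH(S)\le\Bigl(\frac43+\frac{h_1}{H}\Bigr)\,OPT(I).$$ More precisely, with $\delta=\frac13+\frac{h_1}{H}$ and $f_i=\lfloor (1+\delta)H/h_i\rfloor$, the sequence $(f_1,\dots,f_n)$ is a Pinwheel instance of density less than $3/4$, and the schedule $S$ produced by the algorithm is a schedule of this Pinwheel instance. -/

import Mathlib

noncomputable section

namespace BGT

/-! ### Discrete Bamboo Garden Trimming -/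

/-- An instance of discrete BGT: `n ≥ 2` bamboos with positive daily growth rates, arranged in
non-increasing order. The bamboos are numbered `0, …, n - 1`, so `rate 0` is `h₁`. -/
structure Instance (n : ℕ) where
  two_le : 2 ≤ n
  rate : Fin n → ℝ
  rate_pos : ∀ i, 0 < rate i
  rate_anti : Antitone rate

namespace Instance

variable {n : ℕ}

/-- The largest growth rate `h₁`. -/
def h₁ (I : Instance n) : ℝ := I.rate ⟨0, lt_of_lt_of_le Nat.zero_lt_two I.two_le⟩

/-- The sum `H = h₁ + ⋯ + hₙ` of the growth rates. -/
def H (I : Instance n) : ℝ := ∑ i, I.rate i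

end Instance

/-- A perpetual schedule: `S k` is the bamboo cut at time `k + 1`, the end of day `k + 1`. -/
abbrev Schedule (n : ℕ) : Type := ℕ → Fin n

/-- The last time `≤ t` at which bamboo `i` was cut, or `0` if it has not been cut by time `t`. -/
def lastCut {n : ℕ} (S : Schedule n) (i : Fin n) (t : ℝ) : ℕ :=
  ((Finset.range ⌊t⌋₊).filter (fun k => S k = i)).sup (fun k => k + 1)

/-- The height of bamboo `i` at time `t`. -/
def height {n : ℕ} (I : Instance n) (S : Schedule n) (i : Fin n) (t : ℝ) : ℝ :=
  (t - lastCut S i t) * I.rate i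

/-- `MH(S)`: the supremum of the heights of the bamboos over all real times `t ≥ 0`
(possibly infinite). -/
def MH {n : ℕ} (I : Instance n) (S : Schedule n) : ENNReal :=
  ⨆ (i : Fin n) (t : ℝ) (_ : 0 ≤ t), ENNReal.ofReal (height I S i t)

/-- `OPT(I)`: the infimum of `MH(S)` over all schedules. -/
def OPT {n : ℕ} (I : Instance n) : ENNReal := ⨅ S : Schedule n, MH I S

/-! ### Pinwheel scheduling -/

/-- Instances of Pinwheel: integers `2 ≤ f₁ ≤ f₂ ≤ ⋯ ≤ fₙ`. -/
def IsPinwheelInstance {n : ℕ} (f : Fin n → ℕ) : Prop :=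
  (∀ i, 2 ≤ f i) ∧ Monotone f

/-- The density `∑ 1 / fᵢ` of a Pinwheel instance. -/
def density {n : ℕ} (f : Fin n → ℕ) : ℝ := ∑ i, 1 / (f i : ℝ)

/-- `S` is a schedule of the Pinwheel instance `f`: any `fᵢ` consecutive entries of `S` contain
`i`. -/
def IsPinwheelSchedule {n : ℕ} (f : Fin n → ℕ) (S : Schedule n) : Prop :=
  ∀ (i : Fin n) (m : ℕ), ∃ k, m ≤ k ∧ k < m + f i ∧ S k = i

/-- The frequencies `fᵢ = ⌊(1 + δ) H / hᵢ⌋`. -/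
def roundedFrequencies {n : ℕ} (I : Instance n) (δ : ℝ) (i : Fin n) : ℕ :=
  ⌊(1 + δ) * I.H / I.rate i⌋₊

/-! ### The machine model

A random access machine over the real numbers, given by structured programs. The memory consists
of arrays, numbered by natural numbers, of cells holding real numbers. Each arithmetic operation,
rounding, comparison and memory access takes unit time. The set of values that may
occur during an execution is controlled by a predicate `ok`; it is used to bound the bit lengths
of all numbers when the input is rational. -/

/-- The memory: `m a j` is the content of cell `j` of array `a`. -/
abbrev Mem : Type := ℕ → ℕ → ℝ

/-- Expressions. `get a e` is the content of cell `⌊e⌋` of array `a`. -/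
inductive Expr : Type
  | const (q : ℚ)
  | get (a : ℕ) (e : Expr)
  | add (e₁ e₂ : Expr)
  | sub (e₁ e₂ : Expr)
  | mul (e₁ e₂ : Expr)
  | div (e₁ e₂ : Expr)
  | floor (e : Expr)

namespace Expr

/-- The value of an expression. -/
def eval (m : Mem) : Expr → ℝ
  | const q => (q : ℝ)
  | get a e => m a ⌊e.eval m⌋₊
  | add e₁ e₂ => e₁.eval m + e₂.eval m
  | sub e₁ e₂ => e₁.eval m - e₂.eval m
  | mul e₁ e₂ => e₁.eval m * e₂.eval m
  | div e₁ e₂ => e₁.eval m / e₂.eval m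
  | floor e => (⌊e.eval m⌋ : ℝ)

/-- The time to evaluate an expression: one unit for each node. -/
def cost : Expr → ℕ
  | const _ => 1
  | get _ e => e.cost + 1
  | add e₁ e₂ => e₁.cost + e₂.cost + 1
  | sub e₁ e₂ => e₁.cost + e₂.cost + 1
  | mul e₁ e₂ => e₁.cost + e₂.cost + 1
  | div e₁ e₂ => e₁.cost + e₂.cost + 1
  | floor e => e.cost + 1

/-- Every value computed during the evaluation of the expression satisfies `ok`. -/
def AllOk (ok : ℝ → Prop) (m : Mem) : Expr → Prop
  | const q => ok ((const q).eval m)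
  | get a e => e.AllOk ok m ∧ ok ((get a e).eval m)
  | add e₁ e₂ => e₁.AllOk ok m ∧ e₂.AllOk ok m ∧ ok ((add e₁ e₂).eval m)
  | sub e₁ e₂ => e₁.AllOk ok m ∧ e₂.AllOk ok m ∧ ok ((sub e₁ e₂).eval m)
  | mul e₁ e₂ => e₁.AllOk ok m ∧ e₂.AllOk ok m ∧ ok ((mul e₁ e₂).eval m)
  | div e₁ e₂ => e₁.AllOk ok m ∧ e₂.AllOk ok m ∧ ok ((div e₁ e₂).eval m)
  | floor e => e.AllOk ok m ∧ ok ((floor e).eval m)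

end Expr

/-- Programs. `assign a j e` writes the value of `e` to cell `⌊j⌋` of array `a`; the tests of
`ifLt e₁ e₂ _ _` and `whileLt e₁ e₂ _` are `e₁ < e₂`. -/
inductive Prog : Type
  | skip
  | assign (a : ℕ) (j e : Expr)
  | seq (p₁ p₂ : Prog)
  | ifLt (e₁ e₂ : Expr) (p₁ p₂ : Prog)
  | whileLt (e₁ e₂ : Expr) (p : Prog)

/-- The memory after writing `x` to cell `j` of array `a`. -/
def Mem.write (m : Mem) (a j : ℕ) (x : ℝ) : Mem :=
  Function.update m a (Function.update (m a) j x)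

/-- `Exec ok p m m' k`: started on memory `m`, the program `p` halts after `k` time units with
memory `m'`, and every value computed on the way satisfies `ok`. -/
inductive Exec (ok : ℝ → Prop) : Prog → Mem → Mem → ℕ → Prop
  | skip (m : Mem) : Exec ok Prog.skip m m 1
  | assign (m : Mem) (a : ℕ) (j e : Expr) (hj : j.AllOk ok m) (he : e.AllOk ok m) :
      Exec ok (Prog.assign a j e) m (m.write a ⌊j.eval m⌋₊ (e.eval m)) (j.cost + e.cost + 1)
  | seq {p₁ p₂ : Prog} {m m' m'' : Mem} {k₁ k₂ : ℕ}
      (h₁ : Exec ok p₁ m m' k₁) (h₂ : Exec ok p₂ m' m'' k₂) :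
      Exec ok (Prog.seq p₁ p₂) m m'' (k₁ + k₂)
  | ifTrue {e₁ e₂ : Expr} {p₁ p₂ : Prog} {m m' : Mem} {k : ℕ}
      (h₁ : e₁.AllOk ok m) (h₂ : e₂.AllOk ok m) (ht : e₁.eval m < e₂.eval m)
      (h : Exec ok p₁ m m' k) :
      Exec ok (Prog.ifLt e₁ e₂ p₁ p₂) m m' (e₁.cost + e₂.cost + 1 + k)
  | ifFalse {e₁ e₂ : Expr} {p₁ p₂ : Prog} {m m' : Mem} {k : ℕ}
      (h₁ : e₁.AllOk ok m) (h₂ : e₂.AllOk ok m) (ht : ¬ e₁.eval m < e₂.eval m)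
      (h : Exec ok p₂ m m' k) :
      Exec ok (Prog.ifLt e₁ e₂ p₁ p₂) m m' (e₁.cost + e₂.cost + 1 + k)
  | whileTrue {e₁ e₂ : Expr} {p : Prog} {m m' m'' : Mem} {k k' : ℕ}
      (h₁ : e₁.AllOk ok m) (h₂ : e₂.AllOk ok m) (ht : e₁.eval m < e₂.eval m)
      (h : Exec ok p m m' k) (hw : Exec ok (Prog.whileLt e₁ e₂ p) m' m'' k') :
      Exec ok (Prog.whileLt e₁ e₂ p) m m'' (e₁.cost + e₂.cost + 1 + k + k')
  | whileFalse {e₁ e₂ : Expr} {p : Prog} {m : Mem}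
      (h₁ : e₁.AllOk ok m) (h₂ : e₂.AllOk ok m) (ht : ¬ e₁.eval m < e₂.eval m) :
      Exec ok (Prog.whileLt e₁ e₂ p) m m (e₁.cost + e₂.cost + 1)

/-- `x` is a rational number whose reduced numerator and denominator have together at most `B`
binary digits. -/
def HasBits (B : ℕ) (x : ℝ) : Prop :=
  ∃ q : ℚ, (q : ℝ) = x ∧ Nat.size q.num.natAbs + Nat.size q.den ≤ B

/-! ### Algorithms for discrete BGT -/

/-- An algorithm for discrete BGT: a preprocessing program, run once, and a program that is then
run again and again, each run computing the next index of the schedule. -/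
structure Algorithm where
  preprocess : Prog
  next : Prog

/-- The initial memory: array `0` holds `n` (in its cell `0`), array `1` holds the growth rates,
and all other cells are `0`. -/
def inputMem {n : ℕ} (I : Instance n) : Mem := fun a j =>
  if a = 0 ∧ j = 0 then (n : ℝ)
  else if hj : a = 1 ∧ j < n then I.rate ⟨j, hj.2⟩
  else 0

/-- On input `I`, the algorithm produces the schedule `S`: after each run of `next`, cell `0` of
array `2` holds the next entry of `S`. The preprocessing takes `k 0` time units and the computation
of the entry `S t` takes `k (t + 1)` time units. Every value computed in these phases satisfies
`ok 0` and `ok (t + 1)` respectively. -/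
def Algorithm.Runs {n : ℕ} (A : Algorithm) (I : Instance n) (S : Schedule n)
    (ok : ℕ → ℝ → Prop) (k : ℕ → ℕ) : Prop :=
  ∃ m : ℕ → Mem,
    Exec (ok 0) A.preprocess (inputMem I) (m 0) (k 0) ∧
    ∀ t, Exec (ok (t + 1)) A.next (m t) (m (t + 1)) (k (t + 1)) ∧
      m (t + 1) 2 0 = ((S t : ℕ) : ℝ)

/-- On input `I`, the algorithm produces the schedule `S`. -/
def Algorithm.Outputs {n : ℕ} (A : Algorithm) (I : Instance n) (S : Schedule n) : Prop :=
  ∃ k : ℕ → ℕ, A.Runs I S (fun _ _ => True) k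

/-- The size of a rational input: the number of binary digits of all numerators and
denominators. -/
def inputSize {n : ℕ} (q : Fin n → ℚ) : ℕ :=
  ∑ i, (Nat.size (q i).num.natAbs + Nat.size (q i).den)

/-- Polynomial-time BGT algorithms: on every input, the algorithm produces a schedule with
preprocessing time polynomial in `n` and time polylogarithmic in `n` for each further index; and if
the growth rates are rational, then all numbers that occur are rational, with bit length polynomial
in the input size and the bit length of the current day. -/
def Algorithm.IsPolynomialTime (A : Algorithm) : Prop :=
  ∃ c : ℕ, ∀ (n : ℕ) (I : Instance n), ∃ (S : Schedule n) (k : ℕ → ℕ),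
    A.Runs I S (fun _ _ => True) k ∧
    k 0 ≤ c * n ^ c ∧
    (∀ t, k (t + 1) ≤ c * (Nat.log 2 n + 1) ^ c) ∧
    ∀ q : Fin n → ℚ, (∀ i, (q i : ℝ) = I.rate i) →
      A.Runs I S (fun t => HasBits (c * (inputSize q + Nat.size t) ^ c)) k

end BGT

end

/-! Put `W = 4H/3 + h₁`, so that `fᵢ = ⌊W / hᵢ⌋`. Density: since `h₁ ≥ hᵢ`, the summand `h₁` of `W`
makes up for the rounding, so `fᵢ > (4/3) H / hᵢ`. Ratio: a Pinwheel schedule of `f` keeps every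
height at most `W` (`MH_le_of_isPinwheelSchedule`), and `OPT ≥ H`, because the total height grows by
`H` each day and one cut removes at most the maximum height (`ofReal_H_le_MH`).

Existence of the schedule. Rates are first raised to at least `W / (1000 n)`, which adds at most `W
/ 1000` to their sum and makes all trees below of logarithmic height. With `r = ⌊W / h₁⌋` and a
suitable `L ≤ r`, the two smallest weights `u ≥ v` are repeatedly replaced by a root of weight `2u`,
as long as `2u < W / L`. A root of weight `w` stands for a binary tree of bamboos: serving it at
intervals `P` with `P w ≤ W`, alternating between the children at each node, serves each leaf often
enough. At the end all root weights are at most `W / L`, and all but the last are at least `W /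
(2L)`. Although each merge increases the sum by `u - v`, the sum without the last root never exceeds
the initial bound `3/4 (W - h₁) + W / 1000` (`Forest.Valid.merge`, `Forest.Valid.sum_le_last`).

The sorted roots are then cut into `p` bins; a bin with first weight `w` receives `⌊W / (p w)⌋`
roots. Bins take turns, and so do the roots of a bin, so every root is served often enough
(`exists_treeSchedule_eq`). The remaining question is whether `p` bins hold all roots
(`le_binStart`). If not, the full bins would weigh more than the sum allows: for `p ≥ 3` by an
amortized bound of about `4/5` per bin against an average of `3/4` (`le_start_of_three_le`), for `p
= 2` by a finite check (`le_start_two`).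

The programs are verified by a Hoare calculus for total correctness with time bounds (`Reaches`). It
carries a predicate on the memory cells that also yields the bit lengths. -/

namespace BGT

/-! ### Lower and upper bounds on the maximum height -/

namespace Instance

variable {n : ℕ} (I : Instance n)

lemma rate_le_h₁ (i : Fin n) : I.rate i ≤ I.h₁ := I.rate_anti (Fin.mk_le_of_le_val (Nat.zero_le _))

lemma h₁_pos : 0 < I.h₁ := I.rate_pos _

lemma rate_le_H (i : Fin n) : I.rate i ≤ I.H :=
  Finset.single_le_sum (fun j _ => (I.rate_pos j).le) (Finset.mem_univ i)

lemma h₁_le_H : I.h₁ ≤ I.H := I.rate_le_H _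

lemma H_pos : 0 < I.H := I.h₁_pos.trans_le I.h₁_le_H

/-- The bound `(1 + δ) H` on the heights, for `δ = 1 / 3 + h₁ / H`. -/
noncomputable def W : ℝ := 4 * I.H / 3 + I.h₁

lemma W_pos : 0 < I.W := by
  have := I.H_pos; have := I.h₁_pos; unfold W; positivity

lemma one_add_mul_H : (1 + (1 / 3 + I.h₁ / I.H)) * I.H = I.W := by
  have := I.H_pos.ne'
  unfold W; field_simp; ring

lemma roundedFrequencies_eq (i : Fin n) :
    roundedFrequencies I (1 / 3 + I.h₁ / I.H) i = ⌊I.W / I.rate i⌋₊ := by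
  unfold roundedFrequencies; rw [I.one_add_mul_H]

end Instance

variable {n : ℕ}

theorem isPinwheelInstance_roundedFrequencies (I : Instance n) :
    IsPinwheelInstance (roundedFrequencies I (1 / 3 + I.h₁ / I.H)) := by
  refine ⟨fun i => ?_, fun i j hij => ?_⟩
  · rw [I.roundedFrequencies_eq]
    refine Nat.le_floor ?_
    rw [le_div_iff₀ (I.rate_pos i)]
    have h1 := I.rate_le_h₁ i
    have h2 := I.rate_le_H i
    have h3 := I.rate_pos i
    unfold Instance.W
    push_cast
    linarith
  · rw [I.roundedFrequencies_eq, I.roundedFrequencies_eq]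
    exact Nat.floor_mono (div_le_div_of_nonneg_left I.W_pos.le (I.rate_pos j) (I.rate_anti hij))

/-- Rounding down loses less than 1, while `W / hᵢ` exceeds `(4/3) H / hᵢ` by `h₁ / hᵢ ≥ 1`. Hence
each term is strictly below `3/4` of the share `hᵢ / H`. -/
theorem density_roundedFrequencies_lt (I : Instance n) :
    density (roundedFrequencies I (1 / 3 + I.h₁ / I.H)) < 3 / 4 := by
  have hn : 0 < n := lt_of_lt_of_le Nat.zero_lt_two I.two_le
  have key : ∀ i ∈ (Finset.univ : Finset (Fin n)),
      1 / (roundedFrequencies I (1 / 3 + I.h₁ / I.H) i : ℝ) < 3 / 4 * (I.rate i / I.H) := by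
    intro i _
    rw [I.roundedFrequencies_eq]
    have hr := I.rate_pos i
    have hH := I.H_pos
    have h1 : 4 / 3 * I.H / I.rate i < (⌊I.W / I.rate i⌋₊ : ℝ) := by
      have h := Nat.lt_floor_add_one (I.W / I.rate i)
      have h2 : 4 / 3 * I.H / I.rate i + 1 ≤ I.W / I.rate i := by
        rw [div_add_one hr.ne', div_le_div_iff_of_pos_right hr]
        have := I.rate_le_h₁ i
        unfold Instance.W
        linarith
      linarith
    have h3 : 3 / 4 * (I.rate i / I.H) = 1 / (4 / 3 * I.H / I.rate i) := by
      field_simp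
    rw [h3]
    exact one_div_lt_one_div_of_lt (by positivity) h1
  have hne : (Finset.univ : Finset (Fin n)).Nonempty := ⟨⟨0, hn⟩, Finset.mem_univ _⟩
  calc density (roundedFrequencies I (1 / 3 + I.h₁ / I.H))
      < ∑ i, 3 / 4 * (I.rate i / I.H) := Finset.sum_lt_sum_of_nonempty hne key
    _ = 3 / 4 := by
      rw [← Finset.mul_sum, ← Finset.sum_div]
      change 3 / 4 * (I.H / I.H) = 3 / 4
      rw [div_self I.H_pos.ne', mul_one]

/-- Entry `k` is a cut at time `k + 1`, so the `f i` entries from index `lastCut` on are the cuts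
strictly after that time; one of them is a cut of `i`. -/
lemma lastCut_le_of_isPinwheelSchedule {f : Fin n → ℕ} {S : Schedule n}
    (hS : IsPinwheelSchedule f S) (i : Fin n) (t : ℝ) :
    t - lastCut S i t ≤ f i := by
  by_contra! h
  obtain ⟨k, h1, h2, h3⟩ := hS i (lastCut S i t)
  have h4 : lastCut S i t + f i ≤ ⌊t⌋₊ := by
    refine Nat.le_floor ?_
    push_cast; linarith
  have h5 : k + 1 ≤ lastCut S i t :=
    Finset.le_sup (f := fun k => k + 1)
      (Finset.mem_filter.mpr ⟨Finset.mem_range.mpr (by omega), h3⟩)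
  omega

theorem MH_le_of_isPinwheelSchedule (I : Instance n) {S : Schedule n}
    (hS : IsPinwheelSchedule (roundedFrequencies I (1 / 3 + I.h₁ / I.H)) S) :
    MH I S ≤ ENNReal.ofReal I.W := by
  refine iSup_le fun i => iSup_le fun t => iSup_le fun _ => ENNReal.ofReal_le_ofReal ?_
  have h := lastCut_le_of_isPinwheelSchedule hS i t
  rw [I.roundedFrequencies_eq] at h
  have h2 := Nat.floor_le (div_nonneg I.W_pos.le (I.rate_pos i).le)
  unfold height
  rw [← le_div_iff₀ (I.rate_pos i)]
  exact h.trans h2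

lemma lastCut_natCast_succ_self (S : Schedule n) (k : ℕ) :
    lastCut S (S k) ((k + 1 : ℕ) : ℝ) = k + 1 := by
  unfold lastCut
  rw [Nat.floor_natCast]
  refine le_antisymm (Finset.sup_le fun j hj => ?_) ?_
  · have := Finset.mem_range.mp (Finset.mem_filter.mp hj).1; omega
  · exact Finset.le_sup (f := fun k => k + 1) (Finset.mem_filter.mpr ⟨by simp, rfl⟩)

lemma lastCut_natCast_succ_of_ne (S : Schedule n) {k : ℕ} {i : Fin n} (h : S k ≠ i) :
    lastCut S i ((k + 1 : ℕ) : ℝ) = lastCut S i (k : ℝ) := by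
  unfold lastCut
  rw [Nat.floor_natCast, Nat.floor_natCast, Finset.range_add_one, Finset.filter_insert, if_neg h]

/-- If all heights were at most `M < H`, the total height would gain at least `H - M` per day,
although it is bounded by `n M`. -/
theorem ofReal_H_le_MH (I : Instance n) (S : Schedule n) : ENNReal.ofReal I.H ≤ MH I S := by
  by_contra! hlt
  have htop : MH I S ≠ ⊤ := (hlt.trans ENNReal.ofReal_lt_top).ne
  set M := (MH I S).toReal with hM
  have hMeq : ENNReal.ofReal M = MH I S := ENNReal.ofReal_toReal htop
  have hM0 : 0 ≤ M := ENNReal.toReal_nonneg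
  have hMH : M < I.H := by
    rw [← hMeq] at hlt
    exact (ENNReal.ofReal_lt_ofReal_iff I.H_pos).mp hlt
  have hle : ∀ i (t : ℝ), 0 ≤ t → height I S i t ≤ M := by
    intro i t ht
    have : ENNReal.ofReal (height I S i t) ≤ ENNReal.ofReal M := by
      rw [hMeq]
      exact le_iSup_of_le i (le_iSup_of_le t (le_iSup_of_le ht le_rfl))
    exact (ENNReal.ofReal_le_ofReal_iff hM0).mp this
  -- At time `k + 1` the bamboo just cut already has height 0. Its height immediately before the cut
  -- is only a limit, of the times `k + 1 - η`.
  have hlim : ∀ i (k : ℕ), height I S i k + I.rate i ≤ M := by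
    intro i k
    refine le_of_forall_pos_le_add fun ε hε => ?_
    have hr := I.rate_pos i
    set η := min (1 / 2) (ε / I.rate i) with hη
    have hη0 : 0 < η := lt_min (by norm_num) (by positivity)
    have hη1 : η ≤ 1 / 2 := min_le_left _ _
    have hη2 : η * I.rate i ≤ ε := by
      rw [← le_div_iff₀ hr]; exact min_le_right _ _
    have hk0 : (0 : ℝ) ≤ k := Nat.cast_nonneg k
    have h := hle i (k + (1 - η)) (by linarith)
    have hfl : ⌊(k : ℝ) + (1 - η)⌋₊ = k := by
      rw [Nat.floor_eq_iff (by linarith)]; constructor <;> linarith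
    have hlc : lastCut S i ((k : ℝ) + (1 - η)) = lastCut S i (k : ℝ) := by
      unfold lastCut; rw [hfl, Nat.floor_natCast]
    unfold height at h ⊢
    rw [hlc] at h
    nlinarith
  have hT : ∀ k : ℕ, k * (I.H - M) ≤ ∑ i, height I S i (k : ℝ) := by
    intro k
    induction k with
    | zero =>
      simp [height, lastCut]
    | succ k ih =>
      have hstep : ∀ i, height I S i ((k + 1 : ℕ) : ℝ) =
          height I S i k + I.rate i - if i = S k then height I S i k + I.rate i else 0 := by
        intro i
        by_cases h : i = S k
        · subst h
          simp only [height, lastCut_natCast_succ_self, if_true]; ring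
        · simp only [height, lastCut_natCast_succ_of_ne S (Ne.symm h), if_neg h]; push_cast; ring
      rw [Finset.sum_congr rfl fun i _ => hstep i, Finset.sum_sub_distrib,
        Finset.sum_add_distrib, Finset.sum_ite_eq']
      simp only [Finset.mem_univ, if_true]
      have h1 := hlim (S k) k
      have h2 : ∑ i, I.rate i = I.H := rfl
      push_cast
      rw [h2]; linarith
  obtain ⟨k, hk⟩ := exists_nat_gt (n * M / (I.H - M))
  have h1 := hT k
  have h2 : ∑ i, height I S i (k : ℝ) ≤ n * M := by
    calc _ ≤ ∑ _i : Fin n, M := Finset.sum_le_sum fun i _ => hle i k (Nat.cast_nonneg k)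
      _ = _ := by simp
  rw [div_lt_iff₀ (by linarith)] at hk
  linarith

theorem ofReal_H_le_OPT (I : Instance n) : ENNReal.ofReal I.H ≤ OPT I :=
  le_iInf fun S => ofReal_H_le_MH I S

theorem MH_le_mul_OPT (I : Instance n) {S : Schedule n}
    (hS : IsPinwheelSchedule (roundedFrequencies I (1 / 3 + I.h₁ / I.H)) S) :
    MH I S ≤ ENNReal.ofReal (4 / 3 + I.h₁ / I.H) * OPT I := by
  have h0 : 0 ≤ 4 / 3 + I.h₁ / I.H := by
    have := I.H_pos; have := I.h₁_pos; positivity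
  have h1 : I.W = (4 / 3 + I.h₁ / I.H) * I.H := by
    rw [← I.one_add_mul_H]; ring
  calc MH I S ≤ ENNReal.ofReal I.W := MH_le_of_isPinwheelSchedule I hS
    _ = ENNReal.ofReal (4 / 3 + I.h₁ / I.H) * ENNReal.ofReal I.H := by
      rw [h1, ENNReal.ofReal_mul h0]
    _ ≤ _ := by gcongr; exact ofReal_H_le_OPT I

end BGT

namespace BGT

/-! ### Executions of programs -/

/-- The machine is deterministic, and the predicates `ok`, `ok'` only observe a run. So any schedule
that the algorithm outputs is the one analysed here. -/
theorem Exec.unique {ok ok' : ℝ → Prop} {p : Prog} {m m₁ m₂ : Mem} {k₁ k₂ : ℕ}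
    (h₁ : Exec ok p m m₁ k₁) (h₂ : Exec ok' p m m₂ k₂) : m₁ = m₂ ∧ k₁ = k₂ := by
  induction h₁ generalizing m₂ k₂ with
  | skip m => cases h₂; exact ⟨rfl, rfl⟩
  | assign m a j e hj he => cases h₂; exact ⟨rfl, rfl⟩
  | seq _ _ ih₁ ih₂ =>
    cases h₂ with
    | seq g₁ g₂ =>
      obtain ⟨rfl, rfl⟩ := ih₁ g₁
      obtain ⟨rfl, rfl⟩ := ih₂ g₂
      exact ⟨rfl, rfl⟩
  | ifTrue _ _ ht _ ih =>
    cases h₂ with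
    | ifTrue _ _ _ g => obtain ⟨rfl, rfl⟩ := ih g; exact ⟨rfl, rfl⟩
    | ifFalse _ _ gt _ => exact absurd ht gt
  | ifFalse _ _ ht _ ih =>
    cases h₂ with
    | ifFalse _ _ _ g => obtain ⟨rfl, rfl⟩ := ih g; exact ⟨rfl, rfl⟩
    | ifTrue _ _ gt _ => exact absurd gt ht
  | whileTrue _ _ ht _ _ ih₁ ih₂ =>
    cases h₂ with
    | whileTrue _ _ _ g₁ g₂ =>
      obtain ⟨rfl, rfl⟩ := ih₁ g₁
      obtain ⟨rfl, rfl⟩ := ih₂ g₂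
      exact ⟨rfl, rfl⟩
    | whileFalse _ _ gt => exact absurd ht gt
  | whileFalse _ _ ht =>
    cases h₂ with
    | whileFalse _ _ _ => exact ⟨rfl, rfl⟩
    | whileTrue _ _ gt _ _ => exact absurd gt ht

theorem Expr.AllOk.mono {ok ok' : ℝ → Prop} (h : ∀ x, ok x → ok' x) {m : Mem} {e : Expr}
    (he : e.AllOk ok m) : e.AllOk ok' m := by
  induction e with
  | const q => exact h _ he
  | get a e ih => exact ⟨ih he.1, h _ he.2⟩
  | floor e ih => exact ⟨ih he.1, h _ he.2⟩
  | add _ _ ih₁ ih₂ => exact ⟨ih₁ he.1, ih₂ he.2.1, h _ he.2.2⟩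
  | sub _ _ ih₁ ih₂ => exact ⟨ih₁ he.1, ih₂ he.2.1, h _ he.2.2⟩
  | mul _ _ ih₁ ih₂ => exact ⟨ih₁ he.1, ih₂ he.2.1, h _ he.2.2⟩
  | div _ _ ih₁ ih₂ => exact ⟨ih₁ he.1, ih₂ he.2.1, h _ he.2.2⟩

/-- This moves the quantifiers "for all rational rates `q` equal to the given ones" into the
predicate, so that one execution serves rational and real inputs alike. -/
theorem Expr.AllOk.forall {ι : Sort*} {ok : ι → ℝ → Prop} {m : Mem} {e : Expr}
    (he : ∀ i, e.AllOk (ok i) m) : e.AllOk (fun x => ∀ i, ok i x) m := by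
  induction e with
  | const q => exact he
  | get a e ih => exact ⟨ih fun i => (he i).1, fun i => (he i).2⟩
  | floor e ih => exact ⟨ih fun i => (he i).1, fun i => (he i).2⟩
  | add _ _ ih₁ ih₂ =>
    exact ⟨ih₁ fun i => (he i).1, ih₂ fun i => (he i).2.1, fun i => (he i).2.2⟩
  | sub _ _ ih₁ ih₂ =>
    exact ⟨ih₁ fun i => (he i).1, ih₂ fun i => (he i).2.1, fun i => (he i).2.2⟩
  | mul _ _ ih₁ ih₂ =>
    exact ⟨ih₁ fun i => (he i).1, ih₂ fun i => (he i).2.1, fun i => (he i).2.2⟩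
  | div _ _ ih₁ ih₂ =>
    exact ⟨ih₁ fun i => (he i).1, ih₂ fun i => (he i).2.1, fun i => (he i).2.2⟩

theorem Exec.mono {ok ok' : ℝ → Prop} (h : ∀ x, ok x → ok' x) {p : Prog} {m m' : Mem} {k : ℕ}
    (hp : Exec ok p m m' k) : Exec ok' p m m' k := by
  induction hp with
  | skip m => exact .skip m
  | assign m a j e hj he => exact .assign m a j e (hj.mono h) (he.mono h)
  | seq _ _ ih₁ ih₂ => exact .seq ih₁ ih₂
  | ifTrue h₁ h₂ ht _ ih => exact .ifTrue (h₁.mono h) (h₂.mono h) ht ih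
  | ifFalse h₁ h₂ ht _ ih => exact .ifFalse (h₁.mono h) (h₂.mono h) ht ih
  | whileTrue h₁ h₂ ht _ _ ih₁ ih₂ => exact .whileTrue (h₁.mono h) (h₂.mono h) ht ih₁ ih₂
  | whileFalse h₁ h₂ ht => exact .whileFalse (h₁.mono h) (h₂.mono h) ht

/-- Started on `m`, the program `p` halts within `k` time units in a memory satisfying `Q`, and
every value computed on the way satisfies `ok`. -/
def Reaches (ok : ℝ → Prop) (p : Prog) (m : Mem) (k : ℕ) (Q : Mem → Prop) : Prop :=
  ∃ m' k', Exec ok p m m' k' ∧ k' ≤ k ∧ Q m'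

namespace Reaches

variable {ok : ℝ → Prop} {m : Mem} {Q R : Mem → Prop} {k k₁ k₂ : ℕ} {p p₁ p₂ : Prog} {e₁ e₂ : Expr}

theorem mono (h : Reaches ok p m k₁ R) (hk : k₁ ≤ k) (hQ : ∀ m', R m' → Q m') :
    Reaches ok p m k Q := by
  obtain ⟨m', k', h1, h2, h3⟩ := h
  exact ⟨m', k', h1, h2.trans hk, hQ m' h3⟩

theorem skip (hk : 1 ≤ k) (hQ : Q m) : Reaches ok .skip m k Q := ⟨m, 1, .skip m, hk, hQ⟩

theorem assign {a : ℕ} {j e : Expr} (hj : j.AllOk ok m) (he : e.AllOk ok m)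
    (hk : j.cost + e.cost + 1 ≤ k) (hQ : Q (m.write a ⌊j.eval m⌋₊ (e.eval m))) :
    Reaches ok (.assign a j e) m k Q := ⟨_, _, .assign m a j e hj he, hk, hQ⟩

theorem seq (k₁ k₂ : ℕ) (hk : k₁ + k₂ ≤ k)
    (h : Reaches ok p₁ m k₁ fun m' => Reaches ok p₂ m' k₂ Q) :
    Reaches ok (.seq p₁ p₂) m k Q := by
  obtain ⟨m', k', h1, h2, m'', k'', h3, h4, h5⟩ := h
  exact ⟨m'', _, .seq h1 h3, by omega, h5⟩

theorem ifLt (k₁ : ℕ) (h₁ : e₁.AllOk ok m) (h₂ : e₂.AllOk ok m)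
    (hk : e₁.cost + e₂.cost + 1 + k₁ ≤ k)
    (ht : e₁.eval m < e₂.eval m → Reaches ok p₁ m k₁ Q)
    (hf : ¬ e₁.eval m < e₂.eval m → Reaches ok p₂ m k₁ Q) :
    Reaches ok (.ifLt e₁ e₂ p₁ p₂) m k Q := by
  by_cases h : e₁.eval m < e₂.eval m
  · obtain ⟨m', k', h1, h2, h3⟩ := ht h
    exact ⟨m', _, .ifTrue h₁ h₂ h h1, by omega, h3⟩
  · obtain ⟨m', k', h1, h2, h3⟩ := hf h
    exact ⟨m', _, .ifFalse h₁ h₂ h h1, by omega, h3⟩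

/-- A loop with invariant `J`, which bounds the number of remaining iterations. -/
theorem whileLt (J : ℕ → Mem → Prop) (b i : ℕ)
    (hok : ∀ i m, J i m → e₁.AllOk ok m ∧ e₂.AllOk ok m)
    (hbody : ∀ i m, J i m → e₁.eval m < e₂.eval m →
      ∃ i', i = i' + 1 ∧ Reaches ok p m b (J i'))
    (hexit : ∀ i m, J i m → ¬ e₁.eval m < e₂.eval m → Q m) (hJ : J i m)
    (hk : (i + 1) * (e₁.cost + e₂.cost + 1 + b) ≤ k) :
    Reaches ok (.whileLt e₁ e₂ p) m k Q := by
  refine mono (R := Q) ?_ hk fun _ h => h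
  clear hk
  induction i generalizing m with
  | zero =>
    have ht : ¬ e₁.eval m < e₂.eval m := fun h => by
      obtain ⟨i', hi, -⟩ := hbody _ _ hJ h; omega
    exact ⟨m, _, .whileFalse (hok _ _ hJ).1 (hok _ _ hJ).2 ht, by omega, hexit _ _ hJ ht⟩
  | succ i ih =>
    by_cases ht : e₁.eval m < e₂.eval m
    · obtain ⟨i', hi, m', k', h1, h2, h3⟩ := hbody _ _ hJ ht
      obtain rfl : i' = i := by omega
      obtain ⟨m'', k'', h4, h5, h6⟩ := ih h3
      refine ⟨m'', _, .whileTrue (hok _ _ hJ).1 (hok _ _ hJ).2 ht h1 h4, ?_, h6⟩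
      rw [Nat.succ_mul (i' + 1)]; omega
    · refine ⟨m, _, .whileFalse (hok _ _ hJ).1 (hok _ _ hJ).2 ht, ?_, hexit _ _ hJ ht⟩
      rw [Nat.succ_mul]; omega

end Reaches

@[simp] lemma Mem.write_same (m : Mem) (a j : ℕ) (x : ℝ) (i : ℕ) :
    m.write a j x a i = if i = j then x else m a i := by
  simp [Mem.write, Function.update_apply]

lemma Mem.write_ne (m : Mem) {a a' : ℕ} (h : a' ≠ a) (j : ℕ) (x : ℝ) :
    m.write a j x a' = m a' := by
  simp [Mem.write, Function.update_of_ne h]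

lemma Mem.forall_write {P : ℝ → Prop} {m : Mem} (h : ∀ a j, P (m a j)) {x : ℝ} (hx : P x)
    (a j : ℕ) : ∀ a' j', P (m.write a j x a' j') := by
  intro a' j'
  by_cases ha : a' = a
  · subst ha; rw [Mem.write_same]; split_ifs
    exacts [hx, h _ _]
  · rw [Mem.write_ne m ha]; exact h _ _

/-! ### Bit lengths -/

lemma HasBits.mono {A B : ℕ} (h : A ≤ B) {x : ℝ} (hx : HasBits A x) : HasBits B x := by
  obtain ⟨q, h1, h2⟩ := hx; exact ⟨q, h1, h2.trans h⟩

lemma HasBits.one_le {A : ℕ} {x : ℝ} (hx : HasBits A x) : 1 ≤ A := by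
  obtain ⟨q, -, h2⟩ := hx
  have := Nat.size_pos.mpr q.den_pos; omega

lemma size_le_self (a : ℕ) : Nat.size a ≤ a := Nat.size_le.mpr a.lt_two_pow_self

lemma size_mul_le (a b : ℕ) : Nat.size (a * b) ≤ Nat.size a + Nat.size b := by
  rw [Nat.size_le, pow_add]
  exact Nat.mul_lt_mul'' (Nat.lt_size_self a) (Nat.lt_size_self b)

lemma size_add_le {a b k : ℕ} (ha : Nat.size a ≤ k) (hb : Nat.size b ≤ k) :
    Nat.size (a + b) ≤ k + 1 := by
  rw [Nat.size_le] at *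
  rw [pow_succ]; omega

/-- Reducing the fraction replaces numerator and denominator by divisors; a zero numerator has no
digits at all. -/
lemma hasBits_div_int {A : ℕ} {a b : ℤ} (hb : b ≠ 0)
    (h : Nat.size a.natAbs + Nat.size b.natAbs ≤ A) : HasBits A ((a : ℝ) / b) := by
  refine ⟨Rat.divInt a b, by rw [Rat.divInt_eq_div]; push_cast; rfl, le_trans ?_ h⟩
  refine Nat.add_le_add ?_ ?_
  · by_cases ha : a = 0
    · subst ha; simp
    · exact Nat.size_le_size (Nat.le_of_dvd (Int.natAbs_pos.mpr ha)
        (Int.natAbs_dvd_natAbs.mpr (Rat.num_dvd a hb)))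
  · refine Nat.size_le_size (Nat.le_of_dvd (Int.natAbs_pos.mpr hb) ?_)
    exact Int.natCast_dvd.mp (Rat.den_dvd a b)

lemma hasBits_natCast {A k : ℕ} (h : Nat.size k + 1 ≤ A) : HasBits A (k : ℝ) := by
  have := hasBits_div_int (A := A) (a := k) (b := 1) one_ne_zero (by simpa using h)
  simpa using this

lemma HasBits.neg {A : ℕ} {x : ℝ} (hx : HasBits A x) : HasBits A (-x) := by
  obtain ⟨q, rfl, h⟩ := hx
  exact ⟨-q, by push_cast; rfl, by simpa using h⟩

lemma HasBits.add {A B : ℕ} {x y : ℝ} (hx : HasBits A x) (hy : HasBits B y) :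
    HasBits (3 * (A + B)) (x + y) := by
  have h1 := hx.one_le
  obtain ⟨q, rfl, hq⟩ := hx
  obtain ⟨r, rfl, hr⟩ := hy
  have hqd : (q.den : ℝ) ≠ 0 := by exact_mod_cast q.den_ne_zero
  have hrd : (r.den : ℝ) ≠ 0 := by exact_mod_cast r.den_ne_zero
  have e : (q : ℝ) + r = ((q.num * r.den + r.num * q.den : ℤ) : ℝ) / ((q.den * r.den : ℤ) : ℝ) := by
    rw [Rat.cast_def q, Rat.cast_def r]; push_cast; field_simp
  rw [e]
  refine hasBits_div_int (by exact_mod_cast mul_ne_zero q.den_ne_zero r.den_ne_zero) ?_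
  have h2 : Nat.size (q.num * r.den + r.num * q.den).natAbs
      ≤ Nat.size (q.num.natAbs * r.den + r.num.natAbs * q.den) :=
    Nat.size_le_size ((Int.natAbs_add_le _ _).trans_eq (by simp [Int.natAbs_mul]))
  have h4 := size_mul_le q.num.natAbs r.den
  have h5 := size_mul_le r.num.natAbs q.den
  have h6 := size_mul_le q.den r.den
  have h3 := size_add_le (a := q.num.natAbs * r.den) (b := r.num.natAbs * q.den) (k := A + B)
    (by omega) (by omega)
  simp only [Int.natAbs_mul, Int.natAbs_natCast]
  omega

lemma HasBits.sub {A B : ℕ} {x y : ℝ} (hx : HasBits A x) (hy : HasBits B y) :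
    HasBits (3 * (A + B)) (x - y) := sub_eq_add_neg x y ▸ hx.add hy.neg

lemma HasBits.mul {A B : ℕ} {x y : ℝ} (hx : HasBits A x) (hy : HasBits B y) :
    HasBits (3 * (A + B)) (x * y) := by
  obtain ⟨q, rfl, hq⟩ := hx
  obtain ⟨r, rfl, hr⟩ := hy
  have hqd : (q.den : ℝ) ≠ 0 := by exact_mod_cast q.den_ne_zero
  have hrd : (r.den : ℝ) ≠ 0 := by exact_mod_cast r.den_ne_zero
  have e : (q : ℝ) * r = ((q.num * r.num : ℤ) : ℝ) / ((q.den * r.den : ℤ) : ℝ) := by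
    rw [Rat.cast_def q, Rat.cast_def r]; push_cast; field_simp
  rw [e]
  refine hasBits_div_int (by exact_mod_cast mul_ne_zero q.den_ne_zero r.den_ne_zero) ?_
  have h4 := size_mul_le q.num.natAbs r.num.natAbs
  have h6 := size_mul_le q.den r.den
  simp only [Int.natAbs_mul, Int.natAbs_natCast]
  omega

lemma HasBits.div {A B : ℕ} {x y : ℝ} (hx : HasBits A x) (hy : HasBits B y) :
    HasBits (3 * (A + B)) (x / y) := by
  have h1 := hx.one_le
  obtain ⟨q, rfl, hq⟩ := hx
  obtain ⟨r, rfl, hr⟩ := hy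
  -- Division by zero yields 0, which is short as well.
  by_cases h0 : r = 0
  · subst h0
    have := hasBits_natCast (A := 3 * (A + B)) (k := 0) (by simp; omega)
    simpa using this
  have hqd : (q.den : ℝ) ≠ 0 := by exact_mod_cast q.den_ne_zero
  have hrd : (r.den : ℝ) ≠ 0 := by exact_mod_cast r.den_ne_zero
  have hn : r.num ≠ 0 := Rat.num_ne_zero.mpr h0
  have hn' : (r.num : ℝ) ≠ 0 := by exact_mod_cast hn
  have e : (q : ℝ) / r = ((q.num * r.den : ℤ) : ℝ) / ((q.den * r.num : ℤ) : ℝ) := by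
    rw [Rat.cast_def q, Rat.cast_def r]; push_cast; field_simp
  rw [e]
  refine hasBits_div_int (mul_ne_zero (by exact_mod_cast q.den_ne_zero) hn) ?_
  have h4 := size_mul_le q.num.natAbs r.den
  have h6 := size_mul_le q.den r.num.natAbs
  simp only [Int.natAbs_mul, Int.natAbs_natCast]
  omega

lemma HasBits.floor {A : ℕ} {x : ℝ} (hx : HasBits A x) : HasBits A (⌊x⌋ : ℝ) := by
  obtain ⟨q, rfl, hq⟩ := hx
  rw [Rat.floor_cast]
  have := hasBits_div_int (A := A) (a := ⌊q⌋) (b := 1) one_ne_zero (le_trans ?_ hq)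
  · simpa using this
  · refine Nat.add_le_add (Nat.size_le_size ?_) (Nat.size_le_size q.den_pos)
    have hd : (0 : ℤ) < q.den := by exact_mod_cast q.den_pos
    change (q.floor).natAbs ≤ _
    rw [Rat.floor_def]
    rcases le_total 0 q.num with h | h
    · have h1 := Int.ediv_le_self (q.den : ℤ) h
      have h2 := Int.ediv_nonneg h hd.le
      omega
    -- For a negative number the floor lies between the numerator and 0, so its absolute value does
    -- not exceed that of the numerator.
    · have h1 : q.num ≤ q.num / q.den := by
        rw [Int.le_ediv_iff_mul_le hd]; nlinarith
      have h2 : q.num / q.den ≤ 0 := Int.ediv_le_of_le_mul hd (by simpa using h)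
      omega

/-- A factor by which the bit length may grow in the evaluation of an expression. -/
def Expr.bits : Expr → ℕ
  | const q => q.num.natAbs + q.den
  | get _ e => e.bits + 1
  | add e₁ e₂ => 3 * (e₁.bits + e₂.bits)
  | sub e₁ e₂ => 3 * (e₁.bits + e₂.bits)
  | mul e₁ e₂ => 3 * (e₁.bits + e₂.bits)
  | div e₁ e₂ => 3 * (e₁.bits + e₂.bits)
  | floor e => e.bits

lemma Expr.hasBits_eval {B : ℕ} {m : Mem} (hm : ∀ a j, HasBits B (m a j)) (e : Expr) :
    HasBits (e.bits * B) (e.eval m) := by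
  have hB := (hm 0 0).one_le
  induction e with
  | const q =>
    refine ⟨q, rfl, ?_⟩
    have h1 := size_le_self q.num.natAbs
    have h2 := size_le_self q.den
    have h3 : (q.num.natAbs + q.den) * 1 ≤ (q.num.natAbs + q.den) * B := Nat.mul_le_mul_left _ hB
    simp only [Expr.bits]; omega
  | get a e _ => exact (hm _ _).mono (by simp only [Expr.bits]; nlinarith [Nat.zero_le (e.bits * B)])
  | add _ _ ih₁ ih₂ => exact (ih₁.add ih₂).mono (by simp only [Expr.bits]; linarith)
  | sub _ _ ih₁ ih₂ => exact (ih₁.sub ih₂).mono (by simp only [Expr.bits]; linarith)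
  | mul _ _ ih₁ ih₂ => exact (ih₁.mul ih₂).mono (by simp only [Expr.bits]; linarith)
  | div _ _ ih₁ ih₂ => exact (ih₁.div ih₂).mono (by simp only [Expr.bits]; linarith)
  | floor _ ih => exact ih.floor

lemma Expr.allOk_hasBits {B K : ℕ} {m : Mem} (hm : ∀ a j, HasBits B (m a j)) {e : Expr}
    (he : e.bits ≤ K) : e.AllOk (HasBits (K * B)) m := by
  have key : ∀ e : Expr, e.bits ≤ K → HasBits (K * B) (e.eval m) := fun e he =>
    (e.hasBits_eval hm).mono (Nat.mul_le_mul_right B he)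
  induction e with
  | const q => exact key _ he
  | get a e ih => exact ⟨ih (by simp only [Expr.bits] at he; omega), key _ he⟩
  | floor e ih => exact ⟨ih (by simp only [Expr.bits] at he; omega), key _ he⟩
  | add _ _ ih₁ ih₂ | sub _ _ ih₁ ih₂ | mul _ _ ih₁ ih₂ | div _ _ ih₁ ih₂ =>
    exact ⟨ih₁ (by simp only [Expr.bits] at he; omega), ih₂ (by simp only [Expr.bits] at he; omega),
      key _ he⟩

/-- `x` is a quotient of natural numbers with at most `A` binary digits each. -/
def IsFrac (A : ℕ) (x : ℝ) : Prop := ∃ a b : ℕ, b ≠ 0 ∧ x = a / b ∧ Nat.size a ≤ A ∧ Nat.size b ≤ A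

lemma IsFrac.mono {A B : ℕ} (h : A ≤ B) {x : ℝ} (hx : IsFrac A x) : IsFrac B x := by
  obtain ⟨a, b, h1, h2, h3, h4⟩ := hx
  exact ⟨a, b, h1, h2, h3.trans h, h4.trans h⟩

lemma IsFrac.hasBits {A : ℕ} {x : ℝ} (hx : IsFrac A x) : HasBits (2 * A) x := by
  obtain ⟨a, b, h1, rfl, h3, h4⟩ := hx
  have := hasBits_div_int (A := 2 * A) (a := a) (b := b) (by exact_mod_cast h1)
    (by simp only [Int.natAbs_natCast]; omega)
  simpa only [Int.cast_natCast] using this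

lemma isFrac_natCast {A k : ℕ} (h : Nat.size k ≤ A) (hA : 1 ≤ A) : IsFrac A (k : ℝ) :=
  ⟨k, 1, one_ne_zero, by simp, h, by simpa using hA⟩

lemma IsFrac.mul {A B : ℕ} {x y : ℝ} (hx : IsFrac A x) (hy : IsFrac B y) :
    IsFrac (A + B) (x * y) := by
  obtain ⟨a, b, h1, rfl, h3, h4⟩ := hx
  obtain ⟨c, d, g1, rfl, g3, g4⟩ := hy
  refine ⟨a * c, b * d, mul_ne_zero h1 g1, by push_cast; rw [div_mul_div_comm], ?_, ?_⟩
  · have := size_mul_le a c; omega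
  · have := size_mul_le b d; omega

lemma IsFrac.div_natCast {A B : ℕ} {x : ℝ} (hx : IsFrac A x) {k : ℕ} (hk : k ≠ 0)
    (hB : Nat.size k ≤ B) : IsFrac (A + B) (x / k) := by
  have hk' : 1 ≤ B := Nat.succ_le_of_lt ((Nat.size_pos.mpr (Nat.pos_of_ne_zero hk)).trans_le hB)
  rw [div_eq_mul_inv]
  exact hx.mul ⟨1, k, hk, by simp, by simpa using hk', hB⟩

/-- Bit lengths add up, with one carry. Unlike the factor 3 in `HasBits.add`, this can be iterated
`n` times with linear growth. -/
lemma IsFrac.add {A B : ℕ} {x y : ℝ} (hx : IsFrac A x) (hy : IsFrac B y) :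
    IsFrac (A + B + 1) (x + y) := by
  obtain ⟨a, b, h1, rfl, h3, h4⟩ := hx
  obtain ⟨c, d, g1, rfl, g3, g4⟩ := hy
  have hb : (b : ℝ) ≠ 0 := by exact_mod_cast h1
  have hd : (d : ℝ) ≠ 0 := by exact_mod_cast g1
  refine ⟨a * d + b * c, b * d, mul_ne_zero h1 g1, by push_cast; field_simp, ?_, ?_⟩
  · have := size_mul_le a d
    have := size_mul_le b c
    exact size_add_le (by omega) (by omega)
  · have := size_mul_le b d; omega

end BGT

namespace BGT

/-! ### Binary trees of bamboos -/

/-- Binary trees whose leaves are bamboos. -/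
inductive Tree : Type
  | leaf (i : ℕ)
  | node (l r : Tree)

namespace Tree

/-- The leaf reached from the root when the binary digits of `c`, lowest first, are followed. -/
def walk : Tree → ℕ → ℕ
  | leaf i, _ => i
  | node l r, c => if c % 2 = 0 then l.walk (c / 2) else r.walk (c / 2)

/-- `i` is a leaf of the tree. -/
def HasLeaf (i : ℕ) : Tree → Prop
  | leaf i' => i' = i
  | node l r => l.HasLeaf i ∨ r.HasLeaf i

/-- The height of a tree. -/
def height : Tree → ℕ
  | leaf _ => 0
  | node l r => max l.height r.height + 1

/-- The tree has room for the weights `g` of its leaves: its root has weight `w`, and weights are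
halved from a node to its children. -/
def Fits (g : ℕ → ℝ) : ℝ → Tree → Prop
  | w, leaf i => g i ≤ w
  | w, node l r => l.Fits g (w / 2) ∧ r.Fits g (w / 2)

lemma hasLeaf_walk (T : Tree) (c : ℕ) : T.HasLeaf (T.walk c) := by
  induction T generalizing c with
  | leaf i => rfl
  | node l r ihl ihr =>
    rw [walk]; split_ifs
    · exact Or.inl (ihl _)
    · exact Or.inr (ihr _)

/-- A path of length `d` to the leaf is followed by all counters whose `d` lowest binary digits
spell it, a residue class modulo `2 ^ d`. After `d` halvings of `w` there is still room for `g i`.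
-/
lemma Fits.exists_residue {g : ℕ → ℝ} {w : ℝ} {T : Tree} (hT : T.Fits g w) {i : ℕ}
    (hi : T.HasLeaf i) :
    ∃ d ρ, ρ < 2 ^ d ∧ 2 ^ d * g i ≤ w ∧ ∀ c, c % 2 ^ d = ρ → T.walk c = i := by
  induction T generalizing w with
  | leaf i' =>
    obtain rfl : i' = i := hi
    exact ⟨0, 0, by simp, by simpa [Fits] using hT, fun c _ => rfl⟩
  | node l r ihl ihr =>
    have key : ∀ c d, c % 2 ^ (d + 1) = c % 2 + 2 * (c / 2 % 2 ^ d) := fun c d => by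
      rw [pow_succ', Nat.mod_mul]
    rcases hi with hi | hi
    · obtain ⟨d, ρ, h1, h2, h3⟩ := ihl hT.1 hi
      refine ⟨d + 1, 2 * ρ, by rw [pow_succ]; omega, by rw [pow_succ]; linarith, fun c hc => ?_⟩
      rw [key] at hc
      rw [walk, if_pos (by omega)]
      exact h3 _ (by omega)
    · obtain ⟨d, ρ, h1, h2, h3⟩ := ihr hT.2 hi
      refine ⟨d + 1, 2 * ρ + 1, by rw [pow_succ]; omega, by rw [pow_succ]; linarith,
        fun c hc => ?_⟩
      rw [key] at hc
      rw [walk, if_neg (by omega)]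
      exact h3 _ (by omega)

/-- A deepest leaf is left with `w / 2 ^ height`. A lower bound on the weights thus makes the height
logarithmic. -/
lemma Fits.two_pow_height_mul_le {g : ℕ → ℝ} {b w : ℝ} {T : Tree} (hT : T.Fits g w)
    (hb : ∀ i, T.HasLeaf i → b ≤ g i) : 2 ^ T.height * b ≤ w := by
  induction T generalizing w with
  | leaf i => simpa [height] using (hb i rfl).trans hT
  | node l r ihl ihr =>
    have h1 := ihl hT.1 fun i hi => hb i (Or.inl hi)
    have h2 := ihr hT.2 fun i hi => hb i (Or.inr hi)
    rw [height, pow_succ]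
    rcases max_choice l.height r.height with h | h <;> rw [h] <;> linarith

end Tree

/-! ### The merging of the smallest weights -/

/-- The memory contents during the merging phase: the number `N` of roots, the number `Z` of nodes,
the roots, the weights of the nodes, and the children of the nodes. -/
structure Forest where
  N : ℕ
  Z : ℕ
  root : ℕ → ℕ
  wt : ℕ → ℝ
  child : ℕ → ℕ

namespace Forest

/-- The weight of the root in position `j`. -/
def rwt (s : Forest) (j : ℕ) : ℝ := s.wt (s.root j)

/-- The roots in the last two positions are made children of a new root. -/
def merge (s : Forest) : Forest where
  N := s.N - 1
  Z := s.Z + 1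
  root := Function.update s.root (s.N - 2) s.Z
  wt := Function.update s.wt s.Z (2 * s.rwt (s.N - 2))
  child := Function.update (Function.update s.child (2 * s.Z) (s.root (s.N - 2))) (2 * s.Z + 1)
    (s.root (s.N - 1))

/-- The roots in positions `j - 1` and `j` are exchanged. -/
def swap (s : Forest) (j : ℕ) : Forest :=
  { s with root := s.root ∘ Equiv.swap (j - 1) j }

/-- The single nodes `0, …, n - 1` with weights `g`. -/
def singletons (n : ℕ) (g : ℕ → ℝ) : Forest where
  N := n
  Z := n
  root := fun j => if j < n then j else 0
  wt := fun j => if j < n then g j else 0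
  child := fun _ => 0

/-- The forest represents trees whose leaves are the bamboos with weights `g`; no weight exceeds
`W / L`, and the sum of the weights of the roots is bounded by `E` and the least of them. -/
structure Valid (n : ℕ) (g : ℕ → ℝ) (W L E : ℝ) (s : Forest) (T : ℕ → Tree) : Prop where
  two_le : 2 ≤ s.N
  add_eq : s.Z + s.N = 2 * n
  root_lt : ∀ j, s.root j < s.Z
  cover : ∀ i < n, ∃ j < s.N, (T (s.root j)).HasLeaf i
  leaf_lt : ∀ z < s.Z, ∀ i, (T z).HasLeaf i → i < n
  fits : ∀ z < s.Z, (T z).Fits g (s.wt z)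
  wt_mul_le : ∀ z < s.Z, s.wt z * L ≤ W
  scaled : ∀ z < s.Z, ∃ i < n, ∃ e : ℕ, s.wt z = 2 ^ e * g i
  top : ∀ z < s.Z, ∃ j < s.N, s.wt z ≤ s.rwt j
  sum_le : ∃ c, ∑ j ∈ Finset.range s.N, s.rwt j ≤ E + c ∧ ∀ j < s.N, c ≤ s.rwt j
  tree_leaf : ∀ z < n, T z = .leaf z
  tree_node : ∀ z, n ≤ z → z < s.Z → s.child (2 * z) < z ∧ s.child (2 * z + 1) < z ∧
    T z = .node (T (s.child (2 * z))) (T (s.child (2 * z + 1)))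

/-- The roots before position `N` are in order of descending weight, except for that in
position `j`, which may have to be moved forward. -/
def SortedExcept (s : Forest) (j : ℕ) : Prop :=
  ∀ a b, a < b → b < s.N → b ≠ j → s.rwt b ≤ s.rwt a

/-- The roots before position `N` are in order of descending weight. -/
def Sorted (s : Forest) : Prop := ∀ a b, a ≤ b → b < s.N → s.rwt b ≤ s.rwt a

variable {n : ℕ} {g : ℕ → ℝ} {W L E : ℝ} {s : Forest} {T : ℕ → Tree}

lemma Valid.le_Z (h : s.Valid n g W L E T) (hN : s.N ≤ n) : n ≤ s.Z := by
  have := h.add_eq; omega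

lemma Valid.wt_pos (h : s.Valid n g W L E T) (hg : ∀ i < n, 0 < g i) {z : ℕ} (hz : z < s.Z) :
    0 < s.wt z := by
  obtain ⟨i, hi, e, he⟩ := h.scaled z hz
  rw [he]; have := hg i hi; positivity

lemma valid_init (hn : 2 ≤ n) (hL : ∀ i < n, g i * L ≤ W)
    (hE : ∑ i ∈ Finset.range n, g i ≤ E) (hg : ∀ i < n, 0 < g i) :
    (singletons n g).Valid n g W L E Tree.leaf where
  two_le := hn
  add_eq := by simp only [singletons]; omega
  root_lt j := by simp only [singletons]; split_ifs <;> omega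
  cover i hi := ⟨i, hi, by simp [singletons, hi, Tree.HasLeaf]⟩
  leaf_lt z hz i hi := by
    obtain rfl : z = i := hi
    exact hz
  fits z hz := by
    have hz' : z < n := hz
    simp [singletons, hz', Tree.Fits]
  wt_mul_le z hz := by
    have hz' : z < n := hz
    simpa [singletons, hz'] using hL z hz
  scaled z hz := by
    have hz' : z < n := hz
    exact ⟨z, hz, 0, by simp [singletons, hz']⟩
  top z hz := by
    have hz' : z < n := hz
    exact ⟨z, hz, by simp [singletons, Forest.rwt, hz']⟩
  sum_le := by
    refine ⟨0, ?_, fun j hj => ?_⟩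
    · rw [add_zero]
      refine le_trans (le_of_eq (Finset.sum_congr rfl fun j hj => ?_)) hE
      have : j < n := Finset.mem_range.mp hj
      simp [singletons, Forest.rwt, this]
    · have hj' : j < n := hj
      simpa [singletons, Forest.rwt, hj'] using (hg j hj).le
  tree_leaf z _ := rfl
  tree_node z h1 h2 := absurd h2 (not_lt.mpr h1)

lemma sorted_init (hg : ∀ a b, a ≤ b → b < n → g b ≤ g a) : (singletons n g).Sorted := by
  intro a b hab hb
  have hb' : b < n := hb
  have ha' : a < n := hab.trans_lt hb'
  simpa [singletons, Forest.rwt, ha', hb'] using hg a b hab hb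

lemma Valid.swap (h : s.Valid n g W L E T) {j : ℕ} (hj : j < s.N) :
    (s.swap j).Valid n g W L E T := by
  have hlt : ∀ i, i < s.N → Equiv.swap (j - 1) j i < s.N := fun i hi => by
    rw [Equiv.swap_apply_def]; split_ifs <;> omega
  have hrw : ∀ i, (s.swap j).rwt (Equiv.swap (j - 1) j i) = s.rwt i := fun i => by
    simp [Forest.swap, Forest.rwt]
  exact
    { two_le := h.two_le
      add_eq := h.add_eq
      root_lt := fun i => h.root_lt _
      cover := fun i hi => by
        obtain ⟨k, hk, hk'⟩ := h.cover i hi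
        exact ⟨_, hlt k hk, by simpa [Forest.swap] using hk'⟩
      leaf_lt := h.leaf_lt
      fits := h.fits
      wt_mul_le := h.wt_mul_le
      scaled := h.scaled
      top := fun z hz => by
        obtain ⟨k, hk, hk'⟩ := h.top z hz
        exact ⟨_, hlt k hk, by rw [hrw]; exact hk'⟩
      sum_le := by
        obtain ⟨c, hc, hc'⟩ := h.sum_le
        refine ⟨c, le_trans (le_of_eq ?_) hc, fun i hi => hc' _ (hlt i hi)⟩
        change ∑ i ∈ Finset.range s.N, s.rwt (Equiv.swap (j - 1) j i) = _
        refine Equiv.Perm.sum_comp _ _ _ fun i hi => ?_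
        simp only [Set.mem_ofPred_eq] at hi
        simp only [Finset.coe_range, Set.mem_Iio]
        by_contra hcon
        exact hi (Equiv.swap_apply_of_ne_of_ne (by omega) (by omega))
      tree_leaf := h.tree_leaf
      tree_node := h.tree_node }

/-- A step of insertion sort: after the exchange only the heavier root, now in position `j - 1`, may
be out of order with the roots before it. -/
lemma SortedExcept.swap {j : ℕ} (h : s.SortedExcept j) (hj : 0 < j) (hjN : j < s.N)
    (hlt : s.rwt (j - 1) < s.rwt j) : (s.swap j).SortedExcept (j - 1) := by
  have hrw : ∀ i, (s.swap j).rwt i = s.rwt (Equiv.swap (j - 1) j i) := fun i => rfl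
  intro a b hab hb hbj
  have hb : b < s.N := hb
  rw [hrw, hrw, Equiv.swap_apply_def, Equiv.swap_apply_def]
  split_ifs with h1 h2 h3 h4 h5 h6 <;> try omega
  · exact hlt.le
  · exact h _ _ (by omega) (by omega) (by omega)
  · exact h _ _ (by omega) (by omega) (by omega)
  · exact h _ _ (by omega) (by omega) (by omega)
  · exact h _ _ (by omega) (by omega) (by omega)

lemma SortedExcept.pred {j : ℕ} (h : s.SortedExcept j) (hj : 0 < j)
    (hle : s.rwt j ≤ s.rwt (j - 1)) : s.SortedExcept (j - 1) := by
  intro a b hab hb _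
  by_cases hbj : b = j
  · subst hbj
    rcases (show a = b - 1 ∨ a < b - 1 by omega) with rfl | ha
    · exact hle
    · exact hle.trans (h a (b - 1) ha (by omega) (by omega))
  · exact h a b hab hb hbj

lemma SortedExcept.sorted (h : s.SortedExcept 0) : s.Sorted := by
  intro a b hab hb
  rcases hab.eq_or_lt with rfl | hab
  · exact le_rfl
  · exact h a b hab hb (by omega)

lemma Valid.rw_le_rw_zero (h : s.Valid n g W L E T) (hs : s.Sorted) {z : ℕ} (hz : z < s.Z) :
    s.wt z ≤ s.rwt 0 := by
  obtain ⟨j, hj, hle⟩ := h.top z hz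
  exact hle.trans (hs 0 j (Nat.zero_le _) hj)

/-- The slack `c` in the invariant is at most the weight of the last root, so omitting this root
absorbs it. -/
lemma Valid.sum_le_last (h : s.Valid n g W L E T) :
    ∑ j ∈ Finset.range (s.N - 1), s.rwt j ≤ E := by
  obtain ⟨c, h1, h2⟩ := h.sum_le
  have hN := h.two_le
  have h3 := h2 (s.N - 1) (by omega)
  obtain ⟨k, hk⟩ : ∃ k, s.N = k + 1 := ⟨s.N - 1, by omega⟩
  rw [hk, Finset.sum_range_succ] at h1
  rw [hk, Nat.add_sub_cancel] at h3 ⊢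
  linarith

lemma merge_rw_of_lt (hroot : ∀ j, s.root j < s.Z) {j : ℕ} (hj : j < s.N - 2) :
    s.merge.rwt j = s.rwt j := by
  simp only [Forest.rwt, merge]
  rw [Function.update_of_ne hj.ne, Function.update_of_ne (hroot j).ne]

lemma merge_rw_last : s.merge.rwt (s.N - 2) = 2 * s.rwt (s.N - 2) := by
  simp [Forest.rwt, merge]

lemma sortedExcept_merge (hs : s.Sorted) (hroot : ∀ j, s.root j < s.Z) :
    s.merge.SortedExcept (s.N - 2) := by
  intro a b hab hb hbj
  have hb : b < s.N - 1 := hb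
  rw [merge_rw_of_lt hroot (by omega), merge_rw_of_lt hroot (by omega)]
  exact hs a b hab.le (by omega)

/-- With only two roots, the weight tested would be the largest one. It dominates the weight of node
0, the fastest bamboo, which is not small. -/
lemma Valid.three_le (h : s.Valid n g W L E T) (hs : s.Sorted)
    (hL : 0 ≤ L) (hg : W ≤ 2 * L * s.wt 0) (hN : s.N ≤ n)
    (hlt : 2 * L * s.rwt (s.N - 2) < W) : 3 ≤ s.N := by
  by_contra hcon
  have h2 := h.two_le
  have hN2 : s.N - 2 = 0 := by omega
  rw [hN2] at hlt
  have h3 := h.rw_le_rw_zero hs (z := 0) (by have := h.le_Z hN; omega)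
  nlinarith

/-- Let `u ≥ v` be the last two root weights. The new root has weight `2u`, whose halves have room
for both trees, and `2 L u < W` preserves the upper bound on the weights. -/
lemma Valid.merge (h : s.Valid n g W L E T) (hs : s.Sorted) (hg : ∀ i < n, 0 < g i)
    (hN3 : 3 ≤ s.N) (hNn : s.N ≤ n) (hlt : 2 * L * s.rwt (s.N - 2) < W) :
    s.merge.Valid n g W L E (Function.update T s.Z
      (.node (T (s.root (s.N - 2))) (T (s.root (s.N - 1))))) := by
  have hroot := h.root_lt
  have hnZ := h.le_Z hNn
  have hu0 : 0 < s.rwt (s.N - 2) := h.wt_pos hg (hroot _)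
  have hvu : s.rwt (s.N - 1) ≤ s.rwt (s.N - 2) := hs _ _ (by omega) (by omega)
  have hold : ∀ z, z < s.merge.Z → z < s.Z ∨ z = s.Z := fun z hz => by
    have : z < s.Z + 1 := hz
    omega
  have hT : ∀ z < s.Z, Function.update T s.Z
      (.node (T (s.root (s.N - 2))) (T (s.root (s.N - 1)))) z = T z := fun z hz =>
    Function.update_of_ne hz.ne _ _
  have hwt : ∀ z < s.Z, s.merge.wt z = s.wt z := fun z hz => Function.update_of_ne hz.ne _ _
  have hwtZ : s.merge.wt s.Z = 2 * s.rwt (s.N - 2) := Function.update_self _ _ _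
  have hfit : ∀ z < s.Z, s.wt z ≤ s.rwt (s.N - 2) →
      (T z).Fits g (s.rwt (s.N - 2)) := fun z hz hle => by
    have hmono : ∀ (T : Tree) (w w' : ℝ), w ≤ w' → T.Fits g w → T.Fits g w' := by
      intro T
      induction T with
      | leaf i => exact fun w w' hw hT => le_trans (b := w) hT hw
      | node l r ihl ihr =>
        exact fun w w' hw hT => ⟨ihl _ _ (by linarith) hT.1, ihr _ _ (by linarith) hT.2⟩
    exact hmono _ _ _ hle (h.fits z hz)
  refine ⟨?_, ?_, ?_, ?_, ?_, ?_, ?_, ?_, ?_, ?_, ?_, ?_⟩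
  · change 2 ≤ s.N - 1; omega
  · change s.Z + 1 + (s.N - 1) = _; have := h.add_eq; omega
  · intro j
    change Function.update s.root (s.N - 2) s.Z j < s.Z + 1
    rw [Function.update_apply]; split_ifs
    · omega
    · have := hroot j; omega
  · intro i hi
    obtain ⟨j, hj, hj'⟩ := h.cover i hi
    by_cases hjN : j < s.N - 2
    · refine ⟨j, by change j < s.N - 1; omega, ?_⟩
      change (Function.update T s.Z _ (Function.update s.root (s.N - 2) s.Z j)).HasLeaf i
      rw [Function.update_of_ne hjN.ne, hT _ (hroot j)]
      exact hj'
    · refine ⟨s.N - 2, by change s.N - 2 < s.N - 1; omega, ?_⟩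
      change (Function.update T s.Z _ (Function.update s.root (s.N - 2) s.Z _)).HasLeaf i
      rw [Function.update_self, Function.update_self]
      rcases (show j = s.N - 2 ∨ j = s.N - 1 by omega) with rfl | rfl
      exacts [Or.inl hj', Or.inr hj']
  · intro z hz i hi
    rcases hold z hz with hz | rfl
    · rw [hT z hz] at hi; exact h.leaf_lt z hz i hi
    · rw [Function.update_self] at hi
      rcases hi with hi | hi
      exacts [h.leaf_lt _ (hroot _) i hi, h.leaf_lt _ (hroot _) i hi]
  · intro z hz
    rcases hold z hz with hz | rfl
    · rw [hT z hz, hwt z hz]; exact h.fits z hz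
    · rw [hwtZ, Function.update_self]
      constructor
      · rw [mul_div_cancel_left₀ _ two_ne_zero]; exact hfit _ (hroot _) le_rfl
      · rw [mul_div_cancel_left₀ _ two_ne_zero]; exact hfit _ (hroot _) hvu
  · intro z hz
    rcases hold z hz with hz | rfl
    · rw [hwt z hz]; exact h.wt_mul_le z hz
    · rw [hwtZ]; linarith
  · intro z hz
    rcases hold z hz with hz | rfl
    · rw [hwt z hz]; exact h.scaled z hz
    · obtain ⟨i, hi, e, he⟩ := h.scaled _ (hroot (s.N - 2))
      refine ⟨i, hi, e + 1, ?_⟩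
      rw [hwtZ, Forest.rwt, he, pow_succ]; ring
  · intro z hz
    have hlast : s.rwt (s.N - 2) ≤ s.merge.rwt (s.N - 2) := by rw [merge_rw_last]; linarith
    rcases hold z hz with hz | rfl
    · obtain ⟨j, hj, hle⟩ := h.top z hz
      rw [hwt z hz]
      by_cases hjN : j < s.N - 2
      · exact ⟨j, by change j < s.N - 1; omega, by rwa [merge_rw_of_lt hroot hjN]⟩
      · refine ⟨s.N - 2, by change s.N - 2 < s.N - 1; omega, hle.trans (le_trans ?_ hlast)⟩
        exact hs _ _ (by omega) hj
    · exact ⟨s.N - 2, by change s.N - 2 < s.N - 1; omega, by rw [hwtZ, merge_rw_last]⟩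
  · obtain ⟨c, hc, hc'⟩ := h.sum_le
    -- The new slack is `u`. The sum grows by `u - v`, and the old slack satisfies `c ≤ v`, so the
    -- new sum is at most `E + c + u - v ≤ E + u`; and `u` bounds all remaining root weights from
    -- below.
    refine ⟨s.rwt (s.N - 2), ?_, fun j hj => ?_⟩
    · have h1 := hc' (s.N - 1) (by omega)
      have h2 : ∑ j ∈ Finset.range (s.N - 2), s.merge.rwt j
          = ∑ j ∈ Finset.range (s.N - 2), s.rwt j :=
        Finset.sum_congr rfl fun j hj => merge_rw_of_lt hroot (Finset.mem_range.mp hj)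
      have e1 : s.N = s.N - 2 + 1 + 1 := by omega
      have e2 : s.merge.N = s.N - 2 + 1 := by change s.N - 1 = _; omega
      rw [e2, Finset.sum_range_succ, h2, merge_rw_last]
      rw [e1, Finset.sum_range_succ, Finset.sum_range_succ] at hc
      have e3 : s.N - 2 + 1 = s.N - 1 := by omega
      rw [e3] at hc
      linarith
    · have hj : j < s.N - 1 := hj
      rcases (show j < s.N - 2 ∨ j = s.N - 2 by omega) with hj2 | rfl
      · rw [merge_rw_of_lt hroot hj2]; exact hs _ _ (by omega) (by omega)
      · rw [merge_rw_last]; linarith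
  · intro z hz
    rw [hT z (by omega)]; exact h.tree_leaf z hz
  · intro z h1 h2
    change Function.update (Function.update s.child (2 * s.Z) (s.root (s.N - 2))) (2 * s.Z + 1)
      (s.root (s.N - 1)) (2 * z) < z ∧ Function.update (Function.update s.child (2 * s.Z)
      (s.root (s.N - 2))) (2 * s.Z + 1) (s.root (s.N - 1)) (2 * z + 1) < z ∧ _ =
      Tree.node (Function.update T s.Z _ (Function.update (Function.update s.child (2 * s.Z)
      (s.root (s.N - 2))) (2 * s.Z + 1) (s.root (s.N - 1)) (2 * z)))
      (Function.update T s.Z _ (Function.update (Function.update s.child (2 * s.Z)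
      (s.root (s.N - 2))) (2 * s.Z + 1) (s.root (s.N - 1)) (2 * z + 1)))
    rcases hold z h2 with hz | rfl
    · obtain ⟨h3, h4, h5⟩ := h.tree_node z h1 hz
      rw [Function.update_of_ne (a := 2 * z) (by omega),
        Function.update_of_ne (a := 2 * z) (by omega),
        Function.update_of_ne (a := 2 * z + 1) (by omega),
        Function.update_of_ne (a := 2 * z + 1) (by omega),
        hT z hz, hT _ (h3.trans hz), hT _ (h4.trans hz)]
      exact ⟨h3, h4, h5⟩
    · rw [Function.update_of_ne (a := 2 * s.Z) (by omega), Function.update_self,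
        Function.update_self, Function.update_self, hT _ (hroot _), hT _ (hroot _)]
      exact ⟨hroot _, hroot _, rfl⟩

end Forest

end BGT

namespace BGT

/-! ### Bins -/

/-- The number of weights in a bin whose first weight is in position `s`. -/
noncomputable def binCount (W : ℝ) (p : ℕ) (w : ℕ → ℝ) (s : ℕ) : ℕ := ⌊W / (p * w s)⌋₊

/-- The position of the first weight of bin `j`. -/
noncomputable def binStart (W : ℝ) (p : ℕ) (w : ℕ → ℝ) : ℕ → ℕ
  | 0 => 0
  | j + 1 => binStart W p w j + binCount W p w (binStart W p w j)

/-- The bound on the periods of the roots, as a function of `⌊W / h₁⌋`. -/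
def minPeriod (r : ℕ) : ℕ := if r < 4 then r else if r < 12 then 2 * (r / 2) else 4 * (r / 4)

/-- The number of bins, unless there is one for each root, as a function of `⌊W / h₁⌋`. -/
def numBins (r : ℕ) : ℕ := if r < 4 then r else if r < 12 then 2 else r / 4

/-- The gain from one bin: its first weight counts in full, the others by a common lower bound such
as the first weight of the next bin. -/
lemma sum_range_add_ge {x : ℕ → ℝ} {s k : ℕ} {b : ℝ} (hk : 1 ≤ k)
    (hb : ∀ i, s < i → i < s + k → b ≤ x i) :
    ∑ i ∈ Finset.range s, x i + x s + (k - 1) * b ≤ ∑ i ∈ Finset.range (s + k), x i := by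
  induction k, hk using Nat.le_induction with
  | base => rw [Finset.sum_range_succ]; simp
  | succ k hk ih =>
    have h1 := ih fun i h1 h2 => hb i h1 (by omega)
    have h2 := hb (s + k) (by omega) (by omega)
    rw [← add_assoc, Finset.sum_range_succ]
    push_cast
    linarith

/-- The loss in a bin that is followed by weights of size `v`, relative to `4 / 5`. -/
noncomputable def potential (v : ℝ) : ℝ :=
  if 1 / 5 < v then 0 else if 1 / 6 < v then -1 / 10 else if 1 / 7 < v then -6 / 35 else -7 / 30

lemma potential_nonpos (v : ℝ) : potential v ≤ 0 := by
  unfold potential; split_ifs <;> norm_num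

/-- Here `v'` and `v` are the scaled first weights of a bin and of the next one. A bin weighs less
than `4/5` only if the weights drop inside it, which can happen a bounded number of times. The
constants come from the tight cases: `-1/10 = 1/5 + 3/6 - 4/5` and `-6/35 = 1/5 + 3/7 - 4/5` for `k
= 4`, and `-7/30 = -1/10 + 1/6 + 4/8 - 4/5` for `k = 5`. -/
lemma potential_step {v v' : ℝ} {k : ℕ} (hv : 1 / 8 ≤ v) (hvv : v ≤ v')
    (hv' : v' ≤ 1 / 4) (hk : 1 < (k + 1) * v') : potential v + 4 / 5 ≤ potential v' + v' + (k - 1) * v := by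
  have hlow : ∀ c : ℕ, v' * c ≤ 1 → (c : ℝ) ≤ k := by
    intro c hc
    have : (c : ℝ) < k + 1 := by
      by_contra! hcon
      nlinarith
    exact_mod_cast Nat.lt_succ_iff.mp (by exact_mod_cast this)
  by_cases h5 : 1 / 5 < v'
  · have hk4 := hlow 4 (by push_cast; linarith)
    push_cast at hk4
    have : 3 * v ≤ (k - 1) * v := by nlinarith
    unfold potential; split_ifs <;> linarith
  · have hk5 := hlow 5 (by push_cast; linarith)
    push_cast at hk5
    by_cases h6 : 1 / 6 < v'
    · have : 4 * v ≤ (k - 1) * v := by nlinarith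
      unfold potential; split_ifs <;> linarith
    · have hk6 := hlow 6 (by push_cast; linarith)
      push_cast at hk6
      by_cases h7 : 1 / 7 < v'
      · have : 5 * v ≤ (k - 1) * v := by nlinarith
        unfold potential; split_ifs <;> linarith
      · have hk7 := hlow 7 (by push_cast; linarith)
        push_cast at hk7
        have : 6 * v ≤ (k - 1) * v := by nlinarith
        unfold potential; split_ifs <;> linarith


/-! ### The bins have room for all roots -/

section Fit

variable {x : ℕ → ℝ} {N p : ℕ} {st k : ℕ → ℕ} {u : ℝ}

lemma monotone_of_succ_eq_add (hst : ∀ j, st (j + 1) = st j + k j) : Monotone st :=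
  monotone_nat_of_le_succ fun j => by rw [hst]; omega

/-- Telescoping `potential_step` over `p` full bins gives scaled weight at least `4p/5 - 7/30`,
while `hsum` allows only `p (3/4 (1 - u) + 1/1000)`. For `p ≥ 5` this is contradictory because `5
(1/20 - 1/1000) > 7/30`; for `p = 3, 4` the bound `u > 1 / (4p + 4)` is needed too. -/
lemma le_start_of_three_le (hp : 3 ≤ p) (hx0 : ∀ i < N, 0 < x i)
    (hsort : ∀ a b, a ≤ b → b < N → x b ≤ x a) (hup : ∀ i < N, x i * (4 * p) ≤ 1)
    (hlow : ∀ i, i + 1 < N → 1 ≤ x i * (8 * p))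
    (hu : 1 < u * (4 * p + 4))
    (hsum : ∑ i ∈ Finset.range (N - 1), x i ≤ 3 / 4 * (1 - u) + 1 / 1000)
    (hst0 : st 0 = 0) (hst : ∀ j, st (j + 1) = st j + k j)
    (hk : ∀ j, st j < N → 1 < (k j + 1) * (p * x (st j))) : N ≤ st p := by
  by_contra! hlt
  have hp0 : (0 : ℝ) < p := by exact_mod_cast (by omega : 0 < p)
  have hmono := monotone_of_succ_eq_add hst
  have claim : ∀ j, st j < N → ∀ v, 1 / 8 ≤ v → (∀ i < st j, v ≤ p * x i) →
      4 / 5 * j + potential v ≤ p * ∑ i ∈ Finset.range (st j), x i := by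
    intro j
    induction j with
    | zero =>
      intro _ v _ _
      simpa [hst0] using potential_nonpos v
    | succ j ih =>
      intro hN v hv hvx
      have hjN : st j < N := (hmono (Nat.le_succ j)).trans_lt hN
      have hkj := hk j hjN
      have hupj := hup _ hjN
      have hk1 : 1 ≤ k j := by
        by_contra! hcon
        have : k j = 0 := by omega
        rw [this] at hkj
        push_cast at hkj
        linarith
      have hvv : v ≤ p * x (st j) := hvx _ (by rw [hst]; omega)
      have h1 := ih hjN (p * x (st j)) (hv.trans hvv) fun i hi =>
        mul_le_mul_of_nonneg_left (hsort i _ hi.le hjN) hp0.le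
      have h2 := potential_step hv hvv (by linarith) hkj
      have h3 := sum_range_add_ge (x := x) (s := st j) (k := k j) (b := v / p) hk1
        fun i _ hi => by
          rw [div_le_iff₀' hp0]; exact hvx i (by rw [hst]; exact hi)
      have h4 := mul_le_mul_of_nonneg_left h3 hp0.le
      have h5 : p * ((k j - 1) * (v / p)) = (k j - 1) * v := by field_simp
      rw [hst]
      push_cast
      rw [mul_add, mul_add, h5] at h4
      linarith
  -- Bins that end before position `N` omit the last root, the only one whose scaled weight may be
  -- below `1/8`.
  have h1 := claim p hlt (1 / 8) le_rfl fun i hi => by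
    have := hlow i (by omega); linarith
  have h2 : ∑ i ∈ Finset.range (st p), x i ≤ ∑ i ∈ Finset.range (N - 1), x i :=
    Finset.sum_le_sum_of_subset_of_nonneg (Finset.range_mono (by omega)) fun i hi _ =>
      (hx0 i (by have := Finset.mem_range.mp hi; omega)).le
  have h3 : potential (1 / 8) = -7 / 30 := by unfold potential; norm_num
  rw [h3] at h1
  have h4 := mul_le_mul_of_nonneg_left (h2.trans hsum) hp0.le
  rcases (show p = 3 ∨ p = 4 ∨ 5 ≤ p by omega) with rfl | rfl | h5
  · norm_num at *; linarith
  · norm_num at *; linarith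
  · have h5' : (5 : ℝ) ≤ p := by exact_mod_cast h5
    have hu0 : 0 < u := by
      by_contra! hcon
      nlinarith
    nlinarith [mul_pos hp0 hu0]

/-- The first bin holds exactly `K` weights, the second `c` with `K ≤ c ≤ 2K`. If a root were left
over, then `x 0 + K x_K + (c - 1) / (4K) + 3u/4 ≤ 3/4 + 1/1000`, where `x 0 ≥ u > 1 / (2K + 2)` and
`x_K > 1 / (2c + 2)`. For `K = c = 2` the left side is only known to exceed `3/4`, which is why
`hK2` is required. -/
lemma le_start_two {K : ℕ} (hK : 2 ≤ K ∧ K ≤ 5) (hK2 : K = 2 → 1 < 5 * x 0 ∨ 6 ≤ N)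
    (hx0 : ∀ i < N, 0 < x i)
    (hsort : ∀ a b, a ≤ b → b < N → x b ≤ x a) (hup : ∀ i < N, x i * (2 * K) ≤ 1)
    (hlow : ∀ i, i + 1 < N → 1 ≤ x i * (4 * K))
    (hu : 1 < u * (2 * K + 2)) (hux : u ≤ x 0)
    (hsum : ∑ i ∈ Finset.range (N - 1), x i ≤ 3 / 4 * (1 - u) + 1 / 1000)
    (hst0 : st 0 = 0) (hst : ∀ j, st (j + 1) = st j + k j)
    (hk : ∀ j, st j < N → 1 < (k j + 1) * (2 * x (st j)))
    (hk' : ∀ j, st j < N → k j * (2 * x (st j)) ≤ 1) : N ≤ st 2 := by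
  by_contra! hlt
  have hmono := monotone_of_succ_eq_add hst
  have hN1 : st 1 < N := (hmono (show 1 ≤ 2 by norm_num)).trans_lt hlt
  have hN0 : st 0 < N := (hmono (show 0 ≤ 1 by norm_num)).trans_lt hN1
  have hcount : ∀ j, st j < N → ∀ c : ℕ, x (st j) * (2 * c) ≤ 1 → c ≤ k j := by
    intro j hj c hc
    have h1 := hk j hj
    have h2 := hx0 _ hj
    have : (c : ℝ) < k j + 1 := by
      by_contra! hcon
      nlinarith
    exact Nat.lt_succ_iff.mp (by exact_mod_cast this)
  have hk0 : k 0 = K := by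
    refine le_antisymm ?_ (hcount 0 hN0 K (hup _ hN0))
    by_contra! hcon
    have h1 := hk' 0 hN0
    have h2 : ((K + 1 : ℕ) : ℝ) ≤ k 0 := by exact_mod_cast hcon
    have h3 := hx0 _ hN0
    rw [hst0] at h1 h3
    push_cast at h2
    nlinarith
  have hs1 : st 1 = K := by rw [hst 0, hst0, hk0, zero_add]
  have hk1 : K ≤ k 1 := hcount 1 hN1 K (hup _ hN1)
  have hs2 : st 2 = K + k 1 := by rw [hst 1, hs1]
  rw [hs1] at hN1
  have hKR : (2 : ℝ) ≤ K := by exact_mod_cast hK.1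
  have h1 := sum_range_add_ge (x := x) (s := 0) (k := K) (b := x K) (by omega)
    fun i _ hi => hsort i K (by omega) hN1
  have h2 := sum_range_add_ge (x := x) (s := K) (k := k 1) (b := 1 / (4 * K)) (by omega)
    fun i _ hi => by
      rw [div_le_iff₀ (by positivity)]; exact hlow i (by omega)
  have h3 : ∑ i ∈ Finset.range (K + k 1), x i ≤ ∑ i ∈ Finset.range (N - 1), x i :=
    Finset.sum_le_sum_of_subset_of_nonneg (Finset.range_mono (by omega)) fun i hi _ =>
      (hx0 i (by have := Finset.mem_range.mp hi; omega)).le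
  have h4 := hk 1 (by rw [hs1]; exact hN1)
  have h4' := hk' 1 (by rw [hs1]; exact hN1)
  rw [hs1] at h4 h4'
  have h5 := hlow K (by omega)
  have h6 : k 1 ≤ 2 * K := by
    by_contra! hcon
    have h2 : ((2 * K + 1 : ℕ) : ℝ) ≤ k 1 := by exact_mod_cast hcon
    push_cast at h2
    nlinarith
  -- In the exceptional case with `N ≥ 6` there is a fifth weight outside the bins that is not the
  -- last one, hence at least `1/8`.
  have h7 : K = 2 → 6 ≤ N → k 1 = 2 → ∑ i ∈ Finset.range (K + k 1), x i + 1 / 8 ≤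
      ∑ i ∈ Finset.range (N - 1), x i := by
    intro hK hN hk1
    have h := hlow 4 (by omega)
    rw [hK] at h
    calc _ ≤ ∑ i ∈ Finset.range (K + k 1), x i + x 4 := by push_cast at h; linarith
      _ = ∑ i ∈ Finset.range 5, x i := by rw [hK, hk1, Finset.sum_range_succ _ 4]
      _ ≤ _ := Finset.sum_le_sum_of_subset_of_nonneg (Finset.range_mono (by omega)) fun i hi _ =>
        (hx0 i (by have := Finset.mem_range.mp hi; omega)).le
  generalize k 1 = c at *
  obtain ⟨ha, hb⟩ := hK
  simp only [Finset.range_zero, Finset.sum_empty, zero_add] at h1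
  -- Apart from `K = c = 2`, the closest case is `K = 5`, `c = 6`: `7/48 + 5/14 + 1/4 > 0.752`,
  -- against the bound `0.751`.
  interval_cases K <;> interval_cases c <;> norm_num at * <;>
    first
    | linarith
    | (rcases hK2 with hK2 | hK2
       · linarith
       · have := h7 hK2; linarith)

end Fit

/-- After division by `W`, the choice of `r` gives `u = h / W > 1 / (r + 1)`: if `h` is large, the
bound on the sum is accordingly smaller. If `N w 0 ≤ W`, a bin for each root suffices; otherwise `r`
decides between the cases. -/
theorem le_binStart {W h : ℝ} {w : ℕ → ℝ} {N r p : ℕ} (hh : 0 < h) (hr : r = ⌊W / h⌋₊)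
    (hr2 : 2 ≤ r) (hw0 : ∀ i < N, 0 < w i)
    (hsort : ∀ a b, a ≤ b → b < N → w b ≤ w a) (hN : 2 ≤ N)
    (hup : ∀ i < N, w i * minPeriod r ≤ W)
    (hlow : W ≤ 2 * minPeriod r * w (N - 2)) (hhw : h ≤ w 0)
    (hsum : ∑ i ∈ Finset.range (N - 1), w i ≤ 3 / 4 * (W - h) + W / 1000)
    (hp : p = if W < N * w 0 then numBins r else N) : N ≤ binStart W p w p := by
  have hrW : (r : ℝ) * h ≤ W ∧ W < (r + 1) * h := by
    have hpos : 0 ≤ W / h := by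
      by_contra! hcon
      rw [Nat.floor_of_nonpos hcon.le] at hr; omega
    have h1 := Nat.floor_le hpos
    have h2 := Nat.lt_floor_add_one (W / h)
    rw [← hr] at h1 h2
    exact ⟨(le_div_iff₀ hh).mp h1, (div_lt_iff₀ hh).mp h2⟩
  obtain ⟨hr1, hr3⟩ := hrW
  have hrR : (2 : ℝ) ≤ r := by exact_mod_cast hr2
  have hW : 0 < W := by nlinarith
  have hlow' : ∀ i, i + 1 < N → W ≤ 2 * minPeriod r * w i := fun i hi =>
    hlow.trans (mul_le_mul_of_nonneg_left (hsort i _ (by omega) (by omega)) (by positivity))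
  by_cases hlt : W < N * w 0
  · rw [if_pos hlt] at hp
    have hx0 : ∀ i < N, 0 < w i / W := fun i hi => div_pos (hw0 i hi) hW
    have hxs : ∀ a b, a ≤ b → b < N → w b / W ≤ w a / W := fun a b hab hb =>
      div_le_div_of_nonneg_right (hsort a b hab hb) hW.le
    have hxup : ∀ i < N, w i / W * minPeriod r ≤ 1 := fun i hi => by
      rw [div_mul_eq_mul_div, div_le_one hW]; exact hup i hi
    have hxlow : ∀ i, i + 1 < N → 1 ≤ w i / W * (2 * minPeriod r) := fun i hi => by
      rw [div_mul_eq_mul_div, one_le_div hW]; linarith [hlow' i hi]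
    have hxsum : ∑ i ∈ Finset.range (N - 1), w i / W ≤ 3 / 4 * (1 - h / W) + 1 / 1000 := by
      rw [← Finset.sum_div, div_le_iff₀ hW]
      refine hsum.trans (le_of_eq ?_)
      field_simp
    have hxu : 1 < h / W * (r + 1) := by
      rw [div_mul_eq_mul_div, one_lt_div hW]; linarith
    have hxh : h / W ≤ w 0 / W := div_le_div_of_nonneg_right hhw hW.le
    have hk : 0 < p → ∀ j, binStart W p w j < N → 1 < ((binCount W p w (binStart W p w j) : ℕ) + 1) *
        (p * (w (binStart W p w j) / W)) := by
      intro hp0 j hj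
      have h0 := hw0 _ hj
      have hp0' : (0 : ℝ) < p := by exact_mod_cast hp0
      have h1 := Nat.lt_floor_add_one (W / (p * w (binStart W p w j)))
      rw [div_lt_iff₀ (by positivity)] at h1
      rw [← mul_div_assoc, ← mul_div_assoc, one_lt_div hW]
      exact h1
    have hk' : ∀ j, binStart W p w j < N → (binCount W p w (binStart W p w j) : ℕ) *
        (p * (w (binStart W p w j) / W)) ≤ 1 := by
      intro j hj
      have h0 := hw0 _ hj
      rcases Nat.eq_zero_or_pos p with hp0 | hp0
      · rw [hp0]; simp
      have hp0' : (0 : ℝ) < p := by exact_mod_cast hp0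
      have h1 := Nat.floor_le (a := W / (p * w (binStart W p w j))) (by positivity)
      rw [le_div_iff₀ (by positivity)] at h1
      rw [← mul_div_assoc, ← mul_div_assoc, div_le_one hW]
      exact h1
    by_cases h4 : r < 4
    · exfalso
      have hmp : minPeriod r = r := if_pos h4
      rw [hmp] at hxup hxlow hup
      have hNr : r + 1 ≤ N := by
        by_contra! hcon
        have h1 : (N : ℝ) ≤ r := by exact_mod_cast Nat.lt_succ_iff.mp hcon
        have h2 := hup 0 (by omega)
        have h3 := hw0 0 (by omega)
        nlinarith
      have h1 := sum_range_add_ge (x := fun i => w i / W) (s := 0) (k := r) (b := 1 / (2 * r))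
        (by omega) fun i _ hi => by
          rw [div_le_iff₀ (by positivity)]; exact hxlow i (by omega)
      have h2 : ∑ i ∈ Finset.range (0 + r), w i / W ≤ ∑ i ∈ Finset.range (N - 1), w i / W :=
        Finset.sum_le_sum_of_subset_of_nonneg (Finset.range_mono (by omega)) fun i hi _ =>
          (hx0 i (by have := Finset.mem_range.mp hi; omega)).le
      have h3 := (h1.trans h2).trans hxsum
      simp only [Finset.range_zero, Finset.sum_empty, zero_add] at h3
      clear h1 h2 hr
      interval_cases r <;> norm_num at h3 hxu <;> linarith
    · by_cases h12 : r < 12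
      · have hmp : minPeriod r = 2 * (r / 2) := by rw [minPeriod, if_neg h4, if_pos h12]
        have hnb : numBins r = 2 := by rw [numBins, if_neg h4, if_pos h12]
        rw [hnb] at hp
        subst hp
        rw [hmp] at hxup hxlow
        push_cast at hxup hxlow hk hk'
        refine le_start_two (x := fun i => w i / W) (K := r / 2) (u := h / W)
          ⟨by omega, by omega⟩ ?_ hx0 hxs hxup (fun i hi => (hxlow i hi).trans_eq (by ring)) ?_ hxh
          hxsum (st := binStart W 2 w) (k := fun j => binCount W 2 w (binStart W 2 w j)) rfl
          (fun _ => rfl) (fun j hj => hk (by norm_num) j hj) hk'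
        -- The alternative needed for `K = 2`: if `N ≤ 5`, then `W < N w 0 ≤ 5 w 0`.
        · intro hK
          by_contra! hcon
          obtain ⟨h5, h6⟩ := hcon
          have hN5 : (N : ℝ) ≤ 5 := by exact_mod_cast Nat.lt_succ_iff.mp h6
          rw [← mul_div_assoc, div_le_one hW] at h5
          have := hw0 0 (by omega)
          nlinarith
        · have h1 : (r : ℝ) ≤ 2 * (r / 2 : ℕ) + 1 := by exact_mod_cast (by omega)
          have h2 : 0 < h / W := div_pos hh hW
          nlinarith
      · have hmp : minPeriod r = 4 * (r / 4) := by rw [minPeriod, if_neg h4, if_neg h12]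
        have hnb : numBins r = r / 4 := by rw [numBins, if_neg h4, if_neg h12]
        rw [hnb] at hp
        rw [hmp, ← hp] at hxup hxlow
        push_cast at hxup hxlow
        refine le_start_of_three_le (x := fun i => w i / W) (u := h / W) (by omega) hx0 hxs hxup
          (fun i hi => (hxlow i hi).trans_eq (by ring)) ?_
          hxsum (st := binStart W p w) (k := fun j => binCount W p w (binStart W p w j)) rfl
          (fun _ => rfl) (fun j hj => hk (by omega) j hj)
        have h1 : (r : ℝ) ≤ 4 * p + 3 := by exact_mod_cast (by omega)
        have h2 : 0 < h / W := div_pos hh hW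
        nlinarith
  · rw [if_neg hlt] at hp
    subst hp
    rw [not_lt] at hlt
    have key : ∀ j, min j p ≤ binStart W p w j := by
      intro j
      induction j with
      | zero => simp [binStart]
      | succ j ih =>
        rw [binStart]
        by_cases hj : binStart W p w j < p
        · have h1 := hw0 _ hj
          have h2 := hsort 0 _ (Nat.zero_le _) hj
          have hp0 : (0 : ℝ) < p := by exact_mod_cast (by omega : 0 < p)
          have : 1 ≤ binCount W p w (binStart W p w j) := by
            refine Nat.le_floor ?_
            rw [Nat.cast_one, one_le_div (by positivity)]
            nlinarith
          omega
        · omega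
    simpa using key p

end BGT

namespace BGT

/-! ### The schedule -/

/-- The schedule in which the bins take turns, the roots of a bin take turns in the slots of this
bin, and the slots of a root are distributed by the binary digits of their numbers. -/
def treeSchedule (T : ℕ → Tree) (root st k : ℕ → ℕ) (p t : ℕ) : ℕ :=
  (T (root (st (t % p) + t / p % k (t % p)))).walk (t / p / k (t % p))

lemma exists_start_le {st : ℕ → ℕ} (h0 : st 0 = 0) {p x : ℕ} (hx : x < st p) :
    ∃ j < p, st j ≤ x ∧ x < st (j + 1) := by
  induction p with
  | zero => omega
  | succ p ih =>
    by_cases h : x < st p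
    · obtain ⟨j, h1, h2⟩ := ih h
      exact ⟨j, by omega, h2⟩
    · exact ⟨p, by omega, by omega, hx⟩

lemma exists_mod_eq (m : ℕ) {P r : ℕ} (hr : r < P) : ∃ t, m ≤ t ∧ t < m + P ∧ t % P = r := by
  have h1 := Nat.div_add_mod m P
  have h2 := Nat.mod_lt m (r.zero_le.trans_lt hr)
  by_cases h : m % P ≤ r
  · exact ⟨P * (m / P) + r, by omega, by omega, by
      rw [Nat.mul_add_mod, Nat.mod_eq_of_lt hr]⟩
  · refine ⟨P * (m / P + 1) + r, ?_, ?_, by rw [Nat.mul_add_mod, Nat.mod_eq_of_lt hr]⟩ <;>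
      rw [mul_add] <;> omega

/-- If the root over `i` has place `e` among the `k` of bin `j`, and the leaf has depth `d` and
residue `ρ`, then `i` is cut on all days congruent to `j + p (e + k ρ)` modulo `p k 2 ^ d`. This
period is short enough: `p k 2 ^ d x ≤ p k w ≤ W`, where `w` is the first weight of the bin. -/
theorem exists_treeSchedule_eq {n : ℕ} {g : ℕ → ℝ} {W L E : ℝ} {s : Forest} {T : ℕ → Tree}
    (hv : s.Valid n g W L E T) (hs : s.Sorted) (hg : ∀ i < n, 0 < g i) {p : ℕ}
    (hN : s.N ≤ binStart W p s.rwt p) {i : ℕ} (hi : i < n) {x : ℝ} (hx : 0 < x) (hxg : x ≤ g i)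
    (m : ℕ) :
    ∃ t, m ≤ t ∧ t < m + ⌊W / x⌋₊ ∧ treeSchedule T s.root (binStart W p s.rwt)
      (fun j => binCount W p s.rwt (binStart W p s.rwt j)) p t = i := by
  obtain ⟨y, hy, hleaf⟩ := hv.cover i hi
  obtain ⟨d, ρ, hρ, hd, hwalk⟩ := (hv.fits _ (hv.root_lt y)).exists_residue hleaf
  obtain ⟨j, hj, hj1, hj2⟩ := exists_start_le (st := binStart W p s.rwt) rfl (hy.trans_le hN)
  set k := binCount W p s.rwt (binStart W p s.rwt j) with hk
  have hjk : binStart W p s.rwt (j + 1) = binStart W p s.rwt j + k := rfl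
  obtain ⟨e, rfl⟩ := Nat.exists_eq_add_of_le hj1
  have he : e < k := by omega
  have hp : 0 < p := by omega
  have hk0 : 0 < k := by omega
  have hr : j + p * (e + k * ρ) < p * (k * 2 ^ d) := by
    have h1 : e + k * ρ + 1 ≤ k * 2 ^ d := by
      have : k * (ρ + 1) ≤ k * 2 ^ d := Nat.mul_le_mul_left _ hρ
      rw [mul_add] at this; omega
    have h2 : p * (e + k * ρ + 1) ≤ p * (k * 2 ^ d) := Nat.mul_le_mul_left _ h1
    rw [mul_add] at h2; omega
  obtain ⟨t, h1, h2, h3⟩ := exists_mod_eq m hr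
  refine ⟨t, h1, h2.trans_le ?_, ?_⟩
  · refine Nat.add_le_add_left (Nat.le_floor ?_) _
    rw [le_div_iff₀ hx]
    have hw0 : 0 < s.rwt (binStart W p s.rwt j) := hv.wt_pos hg (hv.root_lt _)
    have hW : 0 < W := by
      by_contra! hcon
      have : k = 0 := Nat.floor_of_nonpos (div_nonpos_of_nonpos_of_nonneg hcon (by positivity))
      omega
    have hpR : (0 : ℝ) < p := by exact_mod_cast hp
    have hfl := Nat.floor_le (a := W / (p * s.rwt (binStart W p s.rwt j))) (by positivity)
    rw [le_div_iff₀ (by positivity)] at hfl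
    have hle := hs _ _ hj1 hy
    push_cast
    calc (p : ℝ) * (k * 2 ^ d) * x = p * k * (2 ^ d * x) := by ring
      _ ≤ p * k * (2 ^ d * g i) := by gcongr
      _ ≤ p * k * s.rwt (binStart W p s.rwt j) := by gcongr; exact hd.trans hle
      _ ≤ W := by rw [hk]; unfold binCount; linarith
  · have h4 := Nat.div_add_mod t (p * (k * 2 ^ d))
    rw [h3] at h4
    set q := t / (p * (k * 2 ^ d))
    have e1 : t = j + p * (e + k * (ρ + 2 ^ d * q)) := by rw [← h4]; ring
    have e2 : t % p = j := by rw [e1, Nat.add_mul_mod_self_left, Nat.mod_eq_of_lt hj]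
    have e3 : t / p = e + k * (ρ + 2 ^ d * q) := by
      rw [e1, Nat.add_mul_div_left _ _ hp, Nat.div_eq_of_lt hj, zero_add]
    have e4 : t / p % k = e := by rw [e3, Nat.add_mul_mod_self_left, Nat.mod_eq_of_lt he]
    have e5 : t / p / k = ρ + 2 ^ d * q := by
      rw [e3, Nat.add_mul_div_left _ _ hk0, Nat.div_eq_of_lt he, zero_add]
    unfold treeSchedule
    simp only [e2, ← hk, e4, e5]
    exact hwalk _ (by rw [Nat.add_mul_mod_self_left, Nat.mod_eq_of_lt hρ])

/-! ### The program -/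

namespace Expr

/-- A natural number. -/
abbrev num (k : ℕ) : Expr := const k

/-- The content of cell `0` of array `a`. -/
abbrev var (a : ℕ) : Expr := get a (num 0)

end Expr

namespace Prog

/-- The assignment to cell `0` of array `a`. -/
abbrev set (a : ℕ) (e : Expr) : Prog := assign a (.num 0) e

end Prog

open BGT.Expr BGT.Prog

/-- One step down in a tree: the root is in array `18`, and the digits are in array `17`. -/
def walkStep : Prog :=
  (set 16 (floor (div (var 17) (num 2)))).seq <|
  (set 18 (get 11 (add (mul (num 2) (var 18)) (sub (var 17) (mul (num 2) (var 16)))))).seq <|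
  set 17 (var 16)

/-- The program for the next index. The number of the day is in array `15`. -/
def nextProg : Prog :=
  (set 16 (floor (div (var 15) (var 8)))).seq <|
  (set 4 (sub (var 15) (mul (var 8) (var 16)))).seq <|
  (set 17 (floor (div (var 16) (get 13 (var 4))))).seq <|
  (set 18 (get 9 (add (get 12 (var 4)) (sub (var 16) (mul (get 13 (var 4)) (var 17)))))).seq <|
  (whileLt (var 0) (add (var 18) (num 1)) walkStep).seq <|
  (set 2 (var 18)).seq <|
  set 15 (add (var 15) (num 1))

/-- A bound for the growth of bit lengths in the expressions of the programs. -/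
def bitFactor : ℕ := 100000

/-- The values in `P` can be used in the expressions of the programs. -/
def Safe (P ok : ℝ → Prop) : Prop :=
  ∀ m : Mem, (∀ a j, P (m a j)) → ∀ e : Expr, e.bits ≤ bitFactor → e.AllOk ok m

/-! ### Correctness of the program for the next index -/

section

variable {P ok : ℝ → Prop} {m : Mem}

/-- Only the stored value must be shown to satisfy `P`; the intermediate values are covered by
`Safe`. The size and cost conditions concern concrete expressions and are decidable. -/
theorem Reaches.write (hc : Safe P ok) (hm : ∀ a j, P (m a j)) {a k : ℕ} {j e : Expr}
    {Q : Mem → Prop} (i : ℕ) (x : ℝ) (hj : j.eval m = i) (he : e.eval m = x) (hx : P x)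
    (hQ : (∀ a' j', P (m.write a i x a' j')) → Q (m.write a i x))
    (hbj : j.bits ≤ bitFactor := by decide) (hbe : e.bits ≤ bitFactor := by decide)
    (hk : j.cost + e.cost + 1 ≤ k := by decide) : Reaches ok (.assign a j e) m k Q := by
  refine Reaches.assign (hc m hm j hbj) (hc m hm e hbe) hk ?_
  rw [hj, he, Nat.floor_natCast]
  exact hQ (Mem.forall_write hm hx a i)

lemma eval_num (k : ℕ) : (num k).eval m = k := by simp [Expr.eval]

lemma eval_var (a : ℕ) : (var a).eval m = m a 0 := by simp [Expr.eval]

lemma eval_get {a i : ℕ} {e : Expr} (he : e.eval m = i) : (get a e).eval m = m a i := by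
  rw [Expr.eval, he, Nat.floor_natCast]

lemma eval_add (e₁ e₂ : Expr) : (add e₁ e₂).eval m = e₁.eval m + e₂.eval m := rfl
lemma eval_sub (e₁ e₂ : Expr) : (sub e₁ e₂).eval m = e₁.eval m - e₂.eval m := rfl
lemma eval_mul (e₁ e₂ : Expr) : (mul e₁ e₂).eval m = e₁.eval m * e₂.eval m := rfl
lemma eval_div (e₁ e₂ : Expr) : (div e₁ e₂).eval m = e₁.eval m / e₂.eval m := rfl

lemma eval_floor {e : Expr} (he : 0 ≤ e.eval m) :
    (floor e).eval m = ((⌊e.eval m⌋₊ : ℕ) : ℝ) := by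
  rw [Expr.eval, natCast_floor_eq_intCast_floor he]

lemma eval_floor_div {e₁ e₂ : Expr} {a b : ℕ} (h₁ : e₁.eval m = a) (h₂ : e₂.eval m = b) :
    (floor (div e₁ e₂)).eval m = ((a / b : ℕ) : ℝ) := by
  rw [eval_floor (by rw [eval_div, h₁, h₂]; positivity), eval_div, h₁, h₂, Nat.floor_div_eq_div]

end

/-- The memory after the preprocessing and `t` runs of the program for the next index. -/
structure Ready (n : ℕ) (s : Forest) (st k : ℕ → ℕ) (p : ℕ) (P : ℝ → Prop) (t : ℕ) (m : Mem) :
    Prop where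
  mem_n : m 0 0 = n
  mem_p : m 8 0 = p
  mem_root : ∀ j, m 9 j = s.root j
  mem_child : ∀ j, m 11 j = s.child j
  mem_start : ∀ j < p, m 12 j = st j
  mem_count : ∀ j < p, m 13 j = k j
  mem_t : m 15 0 = t
  mem_ok : ∀ a j, P (m a j)

lemma sub_mul_div_eq_mod (a b : ℕ) : (a : ℝ) - b * (a / b : ℕ) = (a % b : ℕ) := by
  rw [sub_eq_iff_eq_add]
  exact_mod_cast (Nat.mod_add_div a b).symm

/-- The rule for assignments to cell `0` of an array. -/
lemma Reaches.write_var {P ok : ℝ → Prop} {m : Mem} (hc : Safe P ok) (hm : ∀ a j, P (m a j))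
    {a k : ℕ} {e : Expr} {Q : Mem → Prop} (x : ℝ) (he : e.eval m = x) (hx : P x)
    (hQ : (∀ a' j', P (m.write a 0 x a' j')) → Q (m.write a 0 x))
    (hbe : e.bits ≤ bitFactor := by decide)
    (hk : (num 0).cost + e.cost + 1 ≤ k := by decide) : Reaches ok (set a e) m k Q :=
  Reaches.write hc hm 0 x (by simp [Expr.eval]) he hx hQ (by decide) hbe hk

/-- Nodes below `n` are leaves, so the loop runs while `n < z + 1`. The height of the current
subtree bounds the remaining rounds, and the leaf that the remaining digits lead to is invariant. -/
theorem reaches_walk {n : ℕ} {g : ℕ → ℝ} {W L E : ℝ} {s : Forest} {T : ℕ → Tree}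
    (hv : s.Valid n g W L E T) {t D : ℕ} {P ok : ℝ → Prop}
    (hc : Safe P ok) (hP : ∀ x : ℕ, x ≤ max s.Z t → P x) {m : Mem}
    (hm : ∀ a j, P (m a j)) (hn : m 0 0 = n) (hch : ∀ j, m 11 j = s.child j) {z c : ℕ}
    (hz : z < s.Z) (hct : c ≤ t) (hmz : m 18 0 = z) (hmc : m 17 0 = c)
    (hD : (T z).height ≤ D) :
    Reaches ok (whileLt (var 0) (add (var 18) (num 1)) walkStep) m (80 * (D + 1)) fun m' =>
      (∀ a, a ≠ 16 → a ≠ 17 → a ≠ 18 → m' a = m a) ∧ (∀ a j, P (m' a j)) ∧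
      m' 18 0 = ((T z).walk c : ℕ) := by
  refine Reaches.whileLt (J := fun i m' => (∀ a, a ≠ 16 → a ≠ 17 → a ≠ 18 → m' a = m a) ∧
    (∀ a j, P (m' a j)) ∧ ∃ z' c', z' < s.Z ∧ c' ≤ t ∧ m' 18 0 = (z' : ℕ) ∧ m' 17 0 = (c' : ℕ) ∧
      (T z').height ≤ i ∧ (T z').walk c' = (T z).walk c) 70 D ?_ ?_ ?_
    ⟨fun _ _ _ _ => rfl, hm, z, c, hz, hct, hmz, hmc, hD, rfl⟩ ?_
  · intro i m' h
    exact ⟨hc m' h.2.1 _ (by decide), hc m' h.2.1 _ (by decide)⟩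
  · rintro i m' ⟨hf, hok, z', c', h1, h2, h3, h4, h5, h6⟩ hlt
    have e0 : m' 0 0 = n := by rw [hf 0 (by decide) (by decide) (by decide), hn]
    have e11 : ∀ j, m' 11 j = s.child j := fun j => by
      rw [hf 11 (by decide) (by decide) (by decide), hch]
    rw [eval_add, eval_num, eval_var, eval_var, e0, h3] at hlt
    have hnz : n ≤ z' := by
      have : n < z' + 1 := by exact_mod_cast hlt
      omega
    obtain ⟨h7, h8, h9⟩ := hv.tree_node z' hnz h1
    rw [h9, Tree.height] at h5
    rw [h9, Tree.walk] at h6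
    have hmax := max_le_iff.mp (show max (T (s.child (2 * z'))).height
      (T (s.child (2 * z' + 1))).height ≤ i - 1 by omega)
    refine ⟨i - 1, by omega, ?_⟩
    have hdiv : c' / 2 ≤ t := (Nat.div_le_self _ _).trans h2
    obtain ⟨y, hy, hyZ, hyh, hyw⟩ : ∃ y, s.child (2 * z' + c' % 2) = y ∧ y < s.Z ∧
        (T y).height ≤ i - 1 ∧ (T y).walk (c' / 2) = (T z).walk c := by
      refine ⟨_, rfl, ?_⟩
      rcases Nat.mod_two_eq_zero_or_one c' with h | h
      · rw [h, if_pos rfl] at h6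
        rw [h, add_zero]
        exact ⟨h7.trans h1, hmax.1, h6⟩
      · rw [h, if_neg one_ne_zero] at h6
        rw [h]
        exact ⟨h8.trans h1, hmax.2, h6⟩
    refine Reaches.seq 20 50 (by norm_num) ?_
    refine Reaches.write_var hc hok (c' / 2 : ℕ)
      (eval_floor_div ((eval_var _).trans h4) (eval_num 2)) (hP _ (by omega)) fun ok1 => ?_
    refine Reaches.seq 30 20 (by norm_num) ?_
    refine Reaches.write_var hc ok1 (y : ℕ) ?_ (hP _ (by omega)) fun ok2 => ?_
    · rw [eval_get (i := 2 * z' + c' % 2)]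
      · rw [Mem.write_ne _ (by decide), e11, hy]
      · simp only [eval_add, eval_mul, eval_sub, eval_num, eval_var, Mem.write_same,
          Mem.write_ne _ (show 18 ≠ 16 by decide), Mem.write_ne _ (show 17 ≠ 16 by decide), h3, h4,
          if_true]
        have := sub_mul_div_eq_mod c' 2
        push_cast at this ⊢
        rw [this]
    refine Reaches.write_var hc ok2 (c' / 2 : ℕ) ?_ (hP _ (by omega)) fun ok3 => ?_
    · rw [eval_var, Mem.write_ne _ (by decide), Mem.write_same, if_pos rfl]
    refine ⟨fun a h16 h17 h18 => ?_, ok3, y, c' / 2, hyZ, hdiv, ?_, ?_, hyh, hyw⟩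
    · rw [Mem.write_ne _ h17, Mem.write_ne _ h18, Mem.write_ne _ h16, hf a h16 h17 h18]
    · rw [Mem.write_ne _ (by decide), Mem.write_same, if_pos rfl]
    · rw [Mem.write_same, if_pos rfl]
  · rintro i m' ⟨hf, hok, z', c', h1, h2, h3, h4, h5, h6⟩ hlt
    have e0 : m' 0 0 = n := by rw [hf 0 (by decide) (by decide) (by decide), hn]
    rw [eval_add, eval_num, eval_var, eval_var, e0, h3] at hlt
    have hnz : z' < n := by
      by_contra! hcon
      exact hlt (by exact_mod_cast Nat.lt_succ_of_le hcon)
    refine ⟨hf, hok, ?_⟩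
    rw [h3, ← h6, hv.tree_leaf z' hnz, Tree.walk]
  · rw [mul_comm]
    exact Nat.mul_le_mul_right _ (by decide)

/-- Apart from the walk, `treeSchedule` takes a constant number of divisions with remainder. The
tables are not touched, so the state is ready for the next day. -/
theorem reaches_nextProg {n : ℕ} {g : ℕ → ℝ} {W L E : ℝ} {s : Forest} {T : ℕ → Tree}
    (hv : s.Valid n g W L E T) {st k : ℕ → ℕ} {p t D : ℕ} (hp : 0 < p) {P ok : ℝ → Prop}
    (hZ : s.Z ≤ 2 * n) (hD : ∀ z < s.Z, (T z).height ≤ D)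
    (hc : Safe P ok) (hP : ∀ x : ℕ, x ≤ max (2 * n) (t + 1) → P x) {m : Mem}
    (hm : Ready n s st k p P t m) :
    Reaches ok nextProg m (200 * (D + 1)) fun m' =>
      Ready n s st k p P (t + 1) m' ∧ m' 2 0 = (treeSchedule T s.root st k p t : ℕ) := by
  have hj : t % p < p := Nat.mod_lt _ hp
  have hj' : t % p ≤ t := Nat.mod_le _ _
  have hq : t / p ≤ t := Nat.div_le_self _ _
  have hc1 : t / p / k (t % p) ≤ t := (Nat.div_le_self _ _).trans hq
  have hroot := hv.root_lt (st (t % p) + t / p % k (t % p))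
  unfold nextProg
  refine Reaches.seq 20 (80 * (D + 1) + 100) (by omega) ?_
  refine Reaches.write_var hc hm.mem_ok (t / p : ℕ)
    (eval_floor_div ((eval_var _).trans hm.mem_t) ((eval_var _).trans hm.mem_p))
    (hP _ (by omega)) fun ok1 => ?_
  refine Reaches.seq 20 (80 * (D + 1) + 80) (by omega) ?_
  refine Reaches.write_var hc ok1 (t % p : ℕ) ?_ (hP _ (by omega)) fun ok2 => ?_
  · simp only [eval_mul, eval_sub, eval_var, Mem.write_same, if_true,
      Mem.write_ne _ (show 15 ≠ 16 by decide), Mem.write_ne _ (show 8 ≠ 16 by decide),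
      hm.mem_t, hm.mem_p, sub_mul_div_eq_mod]
  refine Reaches.seq 20 (80 * (D + 1) + 60) (by omega) ?_
  refine Reaches.write_var hc ok2 (t / p / k (t % p) : ℕ) ?_ (hP _ (by omega)) fun ok3 => ?_
  · refine eval_floor_div ?_ ?_
    · simp [eval_var, Mem.write_ne]
    · rw [eval_get (i := t % p) (by simp [eval_var])]
      simp [Mem.write_ne, hm.mem_count _ hj]
  refine Reaches.seq 30 (80 * (D + 1) + 30) (by omega) ?_
  refine Reaches.write_var hc ok3 (s.root (st (t % p) + t / p % k (t % p)) : ℕ) ?_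
    (hP _ (by omega)) fun ok4 => ?_
  · rw [eval_get (i := st (t % p) + t / p % k (t % p)) ?_]
    · simp [Mem.write_ne, hm.mem_root]
    · rw [eval_add, eval_sub, eval_mul, eval_get (a := 12) (e := var 4) (i := t % p) (by simp [eval_var, Mem.write_ne]),
        eval_get (a := 13) (e := var 4) (i := t % p) (by simp [eval_var, Mem.write_ne]), eval_var,
        eval_var]
      simp only [Mem.write_same, if_true, Mem.write_ne _ (show 12 ≠ 17 by decide),
        Mem.write_ne _ (show 12 ≠ 4 by decide), Mem.write_ne _ (show 12 ≠ 16 by decide),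
        Mem.write_ne _ (show 13 ≠ 17 by decide),
        Mem.write_ne _ (show 13 ≠ 4 by decide), Mem.write_ne _ (show 13 ≠ 16 by decide),
        Mem.write_ne _ (show 16 ≠ 17 by decide), Mem.write_ne _ (show 16 ≠ 4 by decide),
        hm.mem_start _ hj, hm.mem_count _ hj, sub_mul_div_eq_mod]
      push_cast; rfl
  refine Reaches.seq (80 * (D + 1)) 30 (by omega) ?_
  refine (reaches_walk (t := t) hv hc (fun x hx => hP x (by omega)) ok4 ?_ ?_ hroot hc1 ?_ ?_
    (hD _ hroot)).mono le_rfl ?_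
  · simp [Mem.write_ne, hm.mem_n]
  · intro j; simp [Mem.write_ne, hm.mem_child]
  · simp
  · simp [Mem.write_ne]
  rintro m' ⟨hf, ok5, hout⟩
  have hf' : ∀ a, a ≠ 4 → a ≠ 16 → a ≠ 17 → a ≠ 18 → m' a = m a := fun a h4 h16 h17 h18 => by
    rw [hf a h16 h17 h18, Mem.write_ne _ h18, Mem.write_ne _ h17, Mem.write_ne _ h4,
      Mem.write_ne _ h16]
  have hout' : m' 18 0 = (treeSchedule T s.root st k p t : ℕ) := hout
  have hlt : treeSchedule T s.root st k p t < n := hv.leaf_lt _ hroot _ (Tree.hasLeaf_walk _ _)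
  refine Reaches.seq 10 20 (by norm_num) ?_
  refine Reaches.write_var hc ok5 _ ((eval_var _).trans hout') (hP _ (by omega)) fun ok6 => ?_
  refine Reaches.write_var hc ok6 (t + 1 : ℕ) ?_ (hP _ (by omega)) fun ok7 => ?_
  · rw [eval_add, eval_var, eval_num, Mem.write_ne _ (by decide),
      hf' 15 (by decide) (by decide) (by decide) (by decide), hm.mem_t]
    push_cast; rfl
  have hf2 : ∀ a, a ≠ 2 → a ≠ 4 → a ≠ 15 → a ≠ 16 → a ≠ 17 → a ≠ 18 →
      ((m'.write 2 0 (treeSchedule T s.root st k p t : ℕ)).write 15 0 (t + 1 : ℕ)) a = m a :=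
    fun a h2 h4 h15 h16 h17 h18 => by
      rw [Mem.write_ne _ h15, Mem.write_ne _ h2, hf' a h4 h16 h17 h18]
  refine ⟨⟨?_, ?_, fun j => ?_, fun j => ?_, fun j hj => ?_, fun j hj => ?_, ?_, ok7⟩, ?_⟩
  · rw [hf2 _ (by decide) (by decide) (by decide) (by decide) (by decide) (by decide), hm.mem_n]
  · rw [hf2 _ (by decide) (by decide) (by decide) (by decide) (by decide) (by decide), hm.mem_p]
  · rw [hf2 _ (by decide) (by decide) (by decide) (by decide) (by decide) (by decide), hm.mem_root]
  · rw [hf2 _ (by decide) (by decide) (by decide) (by decide) (by decide) (by decide), hm.mem_child]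
  · rw [hf2 _ (by decide) (by decide) (by decide) (by decide) (by decide) (by decide),
      hm.mem_start j hj]
  · rw [hf2 _ (by decide) (by decide) (by decide) (by decide) (by decide) (by decide),
      hm.mem_count j hj]
  · rw [Mem.write_same, if_pos rfl]
  · rw [Mem.write_ne _ (by decide), Mem.write_same, if_pos rfl]

end BGT

namespace BGT

open BGT.Expr BGT.Prog

/-! ### Preprocessing -/

/-- The sum of the growth rates is added to array `3`. -/
def sumLoop : Prog :=
  whileLt (var 4) (var 0) <|
    (set 3 (add (var 3) (get 1 (var 4)))).seq <|
    set 4 (add (var 4) (num 1))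

/-- The least weight of a bamboo. -/
def leastWeight : Expr := div (var 3) (mul (num 1000) (var 0))

/-- The roots and weights of the trees with one node. -/
def leafLoop : Prog :=
  whileLt (var 4) (var 0) <|
    (ifLt (get 1 (var 4)) leastWeight (assign 10 (var 4) leastWeight)
      (assign 10 (var 4) (get 1 (var 4)))).seq <|
    (assign 9 (var 4) (var 4)).seq <|
    set 4 (add (var 4) (num 1))

/-- The bound on the periods of the roots and the number of bins. -/
def paramProg : Prog :=
  (set 8 (floor (div (var 3) (get 1 (num 0))))).seq <|
  ifLt (var 8) (num 4) (set 7 (var 8)) <|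
    ifLt (var 8) (num 12)
      ((set 7 (mul (num 2) (floor (div (var 8) (num 2))))).seq (set 8 (num 2)))
      ((set 8 (floor (div (var 8) (num 4)))).seq (set 7 (mul (num 4) (var 8))))

/-- The weight of the root in position `e`. -/
def rootWeight (e : Expr) : Expr := get 10 (get 9 e)

/-- The root in the position given by array `4` is moved forward to its place. -/
def insertLoop : Prog :=
  whileLt (num 0) (var 4) <|
    (ifLt (rootWeight (sub (var 4) (num 1))) (rootWeight (var 4))
      ((set 16 (get 9 (var 4))).seq <|
        (assign 9 (var 4) (get 9 (sub (var 4) (num 1)))).seq <|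
        assign 9 (sub (var 4) (num 1)) (var 16)) skip).seq <|
    set 4 (sub (var 4) (num 1))

/-- The last two roots are merged. -/
def mergeProg : Prog :=
  (assign 11 (mul (num 2) (var 6)) (get 9 (sub (var 5) (num 2)))).seq <|
  (assign 11 (add (mul (num 2) (var 6)) (num 1)) (get 9 (sub (var 5) (num 1)))).seq <|
  (assign 10 (var 6) (mul (num 2) (rootWeight (sub (var 5) (num 2))))).seq <|
  (assign 9 (sub (var 5) (num 2)) (var 6)).seq <|
  (set 6 (add (var 6) (num 1))).seq <|
  (set 5 (sub (var 5) (num 1))).seq <|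
  set 4 (sub (var 5) (num 1))

/-- Roots are merged as long as their weights are small. -/
def mergeLoop : Prog :=
  whileLt (mul (mul (num 2) (var 7)) (rootWeight (sub (var 5) (num 2)))) (var 3)
    (mergeProg.seq insertLoop)

/-- The positions in which the bins begin, and the sizes of the bins. -/
def binLoop : Prog :=
  whileLt (var 4) (var 8) <|
    (assign 12 (var 4) (var 14)).seq <|
    (assign 13 (var 4) (floor (div (var 3) (mul (var 8) (rootWeight (var 14)))))).seq <|
    (set 14 (add (var 14) (get 13 (var 4)))).seq <|
    set 4 (add (var 4) (num 1))

/-- The preprocessing program. -/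
def preprocessProg : Prog :=
  sumLoop.seq <|
  (set 3 (add (div (mul (num 4) (var 3)) (num 3)) (get 1 (num 0)))).seq <|
  (set 4 (num 0)).seq <|
  leafLoop.seq <|
  (set 5 (var 0)).seq <|
  (set 6 (var 0)).seq <|
  paramProg.seq <|
  mergeLoop.seq <|
  (ifLt (var 3) (mul (var 5) (rootWeight (num 0))) skip (set 8 (var 5))).seq <|
  (set 4 (num 0)).seq
  binLoop

/-! ### Correctness of insertion and merging -/

variable {P ok : ℝ → Prop} {m : Mem}

/-- The forest `s` is stored in the memory, together with the number `n` of bamboos, the bound `W`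
on the heights, and the parameters `L` and `p`. -/
structure Stores (n : ℕ) (W : ℝ) (L p : ℕ) (P : ℝ → Prop) (s : Forest) (m : Mem) : Prop where
  mem_n : m 0 0 = n
  mem_W : m 3 0 = W
  mem_N : m 5 0 = s.N
  mem_Z : m 6 0 = s.Z
  mem_L : m 7 0 = L
  mem_p : m 8 0 = p
  mem_root : ∀ j, m 9 j = s.root j
  mem_wt : ∀ j, m 10 j = s.wt j
  mem_child : ∀ j, m 11 j = s.child j
  mem_s : m 14 0 = 0
  mem_t : m 15 0 = 0
  mem_ok : ∀ a j, P (m a j)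

variable {n L p : ℕ} {W E : ℝ} {g : ℕ → ℝ} {s : Forest} {T : ℕ → Tree}

lemma Stores.write (h : Stores n W L p P s m) {x : ℝ}
    (hok : ∀ a' j, P (m.write 4 0 x a' j)) : Stores n W L p P s (m.write 4 0 x) := by
  have hf : ∀ a, a ≠ 4 → m.write 4 0 x a = m a := fun a ha => Mem.write_ne _ ha _ _
  refine ⟨?_, ?_, ?_, ?_, ?_, ?_, fun j => ?_, fun j => ?_, fun j => ?_, ?_, ?_, hok⟩
  · rw [hf _ (by decide)]; exact h.mem_n
  · rw [hf _ (by decide)]; exact h.mem_W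
  · rw [hf _ (by decide)]; exact h.mem_N
  · rw [hf _ (by decide)]; exact h.mem_Z
  · rw [hf _ (by decide)]; exact h.mem_L
  · rw [hf _ (by decide)]; exact h.mem_p
  · rw [hf _ (by decide)]; exact h.mem_root j
  · rw [hf _ (by decide)]; exact h.mem_wt j
  · rw [hf _ (by decide)]; exact h.mem_child j
  · rw [hf _ (by decide)]; exact h.mem_s
  · rw [hf _ (by decide)]; exact h.mem_t

lemma eval_rootWeight (hroot : ∀ j, m 9 j = s.root j) (hwt : ∀ j, m 10 j = s.wt j)
    {e : Expr} {i : ℕ} (he : e.eval m = i) : (rootWeight e).eval m = s.rwt i := by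
  rw [rootWeight, eval_get (i := s.root i), hwt, Forest.rwt]
  rw [eval_get he, hroot]

lemma cast_pred {j : ℕ} (h : 0 < j) : (j : ℝ) - 1 = (j - 1 : ℕ) := by
  rw [Nat.cast_sub h, Nat.cast_one]

/-- Exchanges permute the roots but leave the nodes alone, so the trees `T` remain the same. The
position of the moving root counts the remaining rounds. -/
theorem reaches_insertLoop (hc : Safe P ok) (hP : ∀ x : ℕ, x ≤ 2 * n → P x)
    (hv : s.Valid n g W L E T) {j : ℕ} (hs : s.SortedExcept j) (hj : j < s.N) (hN : s.N ≤ n)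
    (hm : Stores n W L p P s m) (hmj : m 4 0 = j) :
    Reaches ok insertLoop m (100 * n) fun m' => ∃ s' : Forest, s'.N = s.N ∧
      s'.Valid n g W L E T ∧ s'.Sorted ∧ Stores n W L p P s' m' := by
  refine Reaches.whileLt (J := fun i m' => ∃ s' : Forest, s'.N = s.N ∧
    s'.Valid n g W L E T ∧ s'.SortedExcept i ∧ Stores n W L p P s' m' ∧ m' 4 0 = i ∧ i < s.N)
    80 j ?_ ?_ ?_ ⟨s, rfl, hv, hs, hm, hmj, hj⟩ ?_
  · rintro i m' ⟨s', h1, h2, h3, h4, h5, h6⟩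
    exact ⟨hc m' h4.mem_ok _ (by decide), hc m' h4.mem_ok _ (by decide)⟩
  · rintro i m' ⟨s', h1, h2, h3, h4, h5, h6⟩ hlt
    rw [eval_num, eval_var, h5] at hlt
    have hi : 0 < i := by exact_mod_cast hlt
    have hZn : s'.Z ≤ 2 * n := by have := h2.add_eq; omega
    refine ⟨i - 1, by omega, ?_⟩
    have ei : (var 4).eval m' = i := by rw [eval_var, h5]
    have ei' : (sub (var 4) (num 1)).eval m' = (i - 1 : ℕ) := by
      rw [eval_sub, ei, eval_num, Nat.cast_one, cast_pred hi]
    refine Reaches.seq 70 10 (by norm_num) ?_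
    have key : ∀ (m₁ : Mem) (s₁ : Forest), s₁.N = s.N → s₁.Valid n g W L E T →
        s₁.SortedExcept (i - 1) → Stores n W L p P s₁ m₁ → m₁ 4 0 = i →
        Reaches ok (set 4 (sub (var 4) (num 1))) m₁ 10 fun m' => ∃ s' : Forest, s'.N = s.N ∧
          s'.Valid n g W L E T ∧ s'.SortedExcept (i - 1) ∧ Stores n W L p P s' m' ∧
          m' 4 0 = (i - 1 : ℕ) ∧ i - 1 < s.N := by
      intro m₁ s₁ g1 g2 g3 g4 g5
      refine Reaches.write_var hc g4.mem_ok (i - 1 : ℕ) ?_ (hP _ (by omega)) fun ok1 => ?_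
      · rw [eval_sub, eval_var, eval_num, g5, Nat.cast_one, cast_pred hi]
      · exact ⟨s₁, g1, g2, g3, g4.write ok1, by rw [Mem.write_same, if_pos rfl], by omega⟩
    refine Reaches.ifLt 50 (hc m' h4.mem_ok _ (by decide)) (hc m' h4.mem_ok _ (by decide))
      (by decide) ?_ ?_
    · rw [eval_rootWeight h4.mem_root h4.mem_wt ei', eval_rootWeight h4.mem_root h4.mem_wt ei]
      intro hlt
      refine Reaches.seq 15 35 (by norm_num) ?_
      refine Reaches.write_var hc h4.mem_ok (s'.root i : ℕ) ?_
        (hP _ (by have := h2.root_lt i; omega)) fun ok1 => ?_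
      · rw [eval_get ei, h4.mem_root]
      refine Reaches.seq 20 15 (by norm_num) ?_
      refine Reaches.write hc ok1 i (s'.root (i - 1) : ℕ) ?_ ?_
        (hP _ (by have := h2.root_lt (i - 1); omega)) fun ok2 => ?_
      · simp [eval_var, Mem.write_ne, h5]
      · rw [eval_get (i := i - 1)]
        · simp [Mem.write_ne, h4.mem_root]
        · simp [eval_var, eval_sub, eval_num, Mem.write_ne, h5, cast_pred hi]
      refine Reaches.write hc ok2 (i - 1) (s'.root i : ℕ) ?_ ?_
        (hP _ (by have := h2.root_lt i; omega)) fun ok3 => ?_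
      · simp [eval_var, eval_sub, eval_num, Mem.write_ne, h5, cast_pred hi]
      · simp [eval_var, Mem.write_ne]
      refine key _ (s'.swap i) h1 (h2.swap (by omega)) (h3.swap hi (by omega) hlt)
        ⟨?_, ?_, ?_, ?_, ?_, ?_, fun j => ?_, fun j => ?_, fun j => ?_, ?_, ?_, ok3⟩ ?_
      · simpa [Mem.write_ne] using h4.mem_n
      · simpa [Mem.write_ne] using h4.mem_W
      · simpa [Mem.write_ne, Forest.swap] using h4.mem_N
      · simpa [Mem.write_ne, Forest.swap] using h4.mem_Z
      · simpa [Mem.write_ne] using h4.mem_L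
      · simpa [Mem.write_ne] using h4.mem_p
      · simp only [Mem.write_same, Mem.write_ne _ (show 9 ≠ 16 by decide), h4.mem_root,
          Forest.swap, Function.comp, Equiv.swap_apply_def]
        split_ifs <;> rfl
      · simpa [Mem.write_ne, Forest.swap] using h4.mem_wt j
      · simpa [Mem.write_ne, Forest.swap] using h4.mem_child j
      · simpa [Mem.write_ne] using h4.mem_s
      · simpa [Mem.write_ne] using h4.mem_t
      · simpa [Mem.write_ne] using h5
    · rw [eval_rootWeight h4.mem_root h4.mem_wt ei', eval_rootWeight h4.mem_root h4.mem_wt ei]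
      intro hlt
      exact Reaches.skip (by norm_num) (key _ s' h1 h2 (h3.pred hi (not_lt.mp hlt)) h4 h5)
  · rintro i m' ⟨s', h1, h2, h3, h4, h5, h6⟩ hlt
    rw [eval_num, eval_var, h5] at hlt
    have hi : i = 0 := by
      by_contra hcon
      exact hlt (by exact_mod_cast Nat.pos_of_ne_zero hcon)
    subst hi
    exact ⟨s', h1, h2, h3.sorted, h4⟩
  · rw [mul_comm]
    exact Nat.mul_le_mul (by decide) (by omega)

theorem reaches_mergeProg (hc : Safe P ok) (hP : ∀ x : ℕ, x ≤ 2 * n → P x)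
    (hPw : ∀ i < n, ∀ e : ℕ, 2 ^ e * g i ≤ W → P (2 ^ e * g i)) (hL : 1 ≤ L)
    (hg : ∀ i < n, 0 < g i)
    (hv : s.Valid n g W L E T) (hN3 : 3 ≤ s.N) (hN : s.N ≤ n)
    (hlt : 2 * L * s.rwt (s.N - 2) < W) (hm : Stores n W L p P s m) :
    Reaches ok mergeProg m 200 fun m' => Stores n W L p P s.merge m' ∧
      m' 4 0 = (s.N - 2 : ℕ) := by
  have hZn : s.Z + 3 ≤ 2 * n := by have := hv.add_eq; omega
  have hr := hv.root_lt
  have eN2 : (s.N : ℝ) - 2 = (s.N - 2 : ℕ) := by rw [Nat.cast_sub (by omega)]; norm_num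
  have eN1 : (s.N : ℝ) - 1 = (s.N - 1 : ℕ) := cast_pred (by omega)
  -- Every weight that arises is a power of 2 times a bamboo weight and at most `W`; this is the
  -- form in which its bit length can be bounded.
  have hPw' : P (2 * s.rwt (s.N - 2)) := by
    obtain ⟨i, hi, e, he⟩ := hv.scaled _ (hr (s.N - 2))
    have e1 : 2 * s.rwt (s.N - 2) = 2 ^ (e + 1) * g i := by
      rw [Forest.rwt, he, pow_succ]; ring
    rw [e1]
    refine hPw i hi _ ?_
    rw [← e1]
    have h1 : (1 : ℝ) ≤ L := by exact_mod_cast hL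
    have h2 : 0 < s.rwt (s.N - 2) := hv.wt_pos hg (hr _)
    nlinarith
  unfold mergeProg
  refine Reaches.seq 30 170 (by norm_num) ?_
  refine Reaches.write hc hm.mem_ok (2 * s.Z) (s.root (s.N - 2) : ℕ) ?_ ?_
    (hP _ (by have := hr (s.N - 2); omega)) fun ok1 => ?_
  · simp [eval_mul, eval_num, eval_var, hm.mem_Z]
  · rw [eval_get (i := s.N - 2), hm.mem_root]
    rw [eval_sub, eval_num, eval_var, hm.mem_N]; exact_mod_cast eN2
  refine Reaches.seq 30 140 (by norm_num) ?_
  refine Reaches.write hc ok1 (2 * s.Z + 1) (s.root (s.N - 1) : ℕ) ?_ ?_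
    (hP _ (by have := hr (s.N - 1); omega)) fun ok2 => ?_
  · simp [eval_mul, eval_add, eval_num, eval_var, Mem.write_ne, hm.mem_Z]
  · rw [eval_get (i := s.N - 1)]
    · simp [Mem.write_ne, hm.mem_root]
    · simp [eval_sub, eval_num, eval_var, Mem.write_ne, hm.mem_N, eN1]
  refine Reaches.seq 30 110 (by norm_num) ?_
  refine Reaches.write hc ok2 s.Z (2 * s.rwt (s.N - 2)) ?_ ?_ hPw' fun ok3 => ?_
  · simp [eval_var, Mem.write_ne, hm.mem_Z]
  · rw [eval_mul, eval_rootWeight (s := s) (i := s.N - 2)]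
    · simp [eval_num]
    · simp [Mem.write_ne, hm.mem_root]
    · simp [Mem.write_ne, hm.mem_wt]
    · simp [eval_sub, eval_num, eval_var, Mem.write_ne, hm.mem_N, eN2]
  refine Reaches.seq 30 80 (by norm_num) ?_
  refine Reaches.write hc ok3 (s.N - 2) (s.Z : ℕ) ?_ ?_ (hP _ (by omega)) fun ok4 => ?_
  · simp [eval_sub, eval_num, eval_var, Mem.write_ne, hm.mem_N, eN2]
  · simp [eval_var, Mem.write_ne, hm.mem_Z]
  refine Reaches.seq 20 60 (by norm_num) ?_
  refine Reaches.write_var hc ok4 (s.Z + 1 : ℕ) ?_ (hP _ (by omega)) fun ok5 => ?_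
  · simp [eval_add, eval_num, eval_var, Mem.write_ne, hm.mem_Z]
  refine Reaches.seq 20 40 (by norm_num) ?_
  refine Reaches.write_var hc ok5 (s.N - 1 : ℕ) ?_ (hP _ (by omega)) fun ok6 => ?_
  · simp [eval_sub, eval_num, eval_var, Mem.write_ne, hm.mem_N, eN1]
  refine Reaches.write_var hc ok6 (s.N - 2 : ℕ) ?_ (hP _ (by omega)) fun ok7 => ?_
  · simp only [eval_sub, eval_num, eval_var, Mem.write_same, if_true]
    rw [← eN1, ← eN2]; push_cast; ring
  refine ⟨⟨?_, ?_, ?_, ?_, ?_, ?_, fun j => ?_, fun j => ?_, fun j => ?_, ?_, ?_, ok7⟩, ?_⟩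
  · simpa [Mem.write_ne] using hm.mem_n
  · simpa [Mem.write_ne] using hm.mem_W
  · simp [Mem.write_ne, Forest.merge]
  · simp [Mem.write_ne, Forest.merge]
  · simpa [Mem.write_ne] using hm.mem_L
  · simpa [Mem.write_ne] using hm.mem_p
  · simp only [Mem.write_ne _ (show 9 ≠ 4 by decide), Mem.write_ne _ (show 9 ≠ 5 by decide),
      Mem.write_ne _ (show 9 ≠ 6 by decide), Mem.write_ne _ (show 9 ≠ 10 by decide),
      Mem.write_ne _ (show 9 ≠ 11 by decide), Mem.write_same, hm.mem_root, Forest.merge,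
      Function.update_apply]
    split_ifs <;> rfl
  · simp only [Mem.write_ne _ (show 10 ≠ 4 by decide), Mem.write_ne _ (show 10 ≠ 5 by decide),
      Mem.write_ne _ (show 10 ≠ 6 by decide), Mem.write_ne _ (show 10 ≠ 9 by decide),
      Mem.write_ne _ (show 10 ≠ 11 by decide), Mem.write_same, hm.mem_wt, Forest.merge,
      Function.update_apply]
  · simp only [Mem.write_ne _ (show 11 ≠ 4 by decide), Mem.write_ne _ (show 11 ≠ 5 by decide),
      Mem.write_ne _ (show 11 ≠ 6 by decide), Mem.write_ne _ (show 11 ≠ 9 by decide),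
      Mem.write_ne _ (show 11 ≠ 10 by decide), Mem.write_same, hm.mem_child, Forest.merge,
      Function.update_apply]
    split_ifs <;> rfl
  · simpa [Mem.write_ne] using hm.mem_s
  · simpa [Mem.write_ne] using hm.mem_t
  · simp

/-- Each round removes one root and costs a linear insertion, whence the quadratic time. -/
theorem reaches_mergeLoop (hc : Safe P ok) (hP : ∀ x : ℕ, x ≤ 2 * n → P x)
    (hPw : ∀ i < n, ∀ e : ℕ, 2 ^ e * g i ≤ W → P (2 ^ e * g i)) (hL : 1 ≤ L)
    (hg : ∀ i < n, 0 < g i) (hn : 2 ≤ n) (hg0 : W ≤ 2 * L * g 0)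
    (hv : s.Valid n g W L E T) (hs : s.Sorted) (hN : s.N ≤ n)
    (hm : Stores n W L p P s m) :
    Reaches ok mergeLoop m (1000 * n ^ 2) fun m' => ∃ (s' : Forest) (T' : ℕ → Tree), s'.N ≤ n ∧
      s'.Valid n g W L E T' ∧ s'.Sorted ∧ Stores n W L p P s' m' ∧
      W ≤ 2 * L * s'.rwt (s'.N - 2) := by
  have eguard : ∀ (s' : Forest) (T' : ℕ → Tree) (m' : Mem), Stores n W L p P s' m' →
      s'.Valid n g W L E T' →
      (mul (mul (num 2) (var 7)) (rootWeight (sub (var 5) (num 2)))).eval m' =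
        2 * L * s'.rwt (s'.N - 2) := by
    intro s' T' m' h hv'
    rw [eval_mul, eval_mul, eval_num, eval_var, h.mem_L,
      eval_rootWeight h.mem_root h.mem_wt (i := s'.N - 2)]
    · norm_num
    · rw [eval_sub, eval_num, eval_var, h.mem_N, Nat.cast_sub hv'.two_le]
  refine Reaches.whileLt (J := fun i m' => ∃ (s' : Forest) (T' : ℕ → Tree), s'.N = i ∧ i ≤ n ∧
    s'.Valid n g W L E T' ∧ s'.Sorted ∧ Stores n W L p P s' m') (200 + 100 * n) s.N ?_ ?_ ?_
    ⟨s, T, rfl, hN, hv, hs, hm⟩ ?_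
  · rintro i m' ⟨s', T', h1, h2, h3, h4, h5⟩
    exact ⟨hc m' h5.mem_ok _ (by decide), hc m' h5.mem_ok _ (by decide)⟩
  · rintro i m' ⟨s', T', h1, h2, h3, h4, h5⟩ hlt
    rw [eguard s' T' m' h5 h3, eval_var, h5.mem_W] at hlt
    have hLR : (0 : ℝ) ≤ L := Nat.cast_nonneg L
    -- Node 0 is still the leaf of the fastest bamboo, so the loop test can only succeed with three
    -- or more roots.
    have hwt0 : g 0 ≤ s'.wt 0 := by
      have hZ := h3.le_Z (by omega)
      have := h3.fits 0 (by omega)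
      rw [h3.tree_leaf 0 (by omega)] at this
      exact this
    have hN3 : 3 ≤ s'.N := h3.three_le h4 hLR (by nlinarith) (by omega) hlt
    refine ⟨i - 1, by omega, ?_⟩
    refine Reaches.seq 200 (100 * n) le_rfl ?_
    refine (reaches_mergeProg hc hP hPw hL hg h3 hN3 (by omega) hlt h5).mono le_rfl ?_
    rintro m₁ ⟨h6, h7⟩
    have hNm : s'.merge.N = s'.N - 1 := rfl
    refine (reaches_insertLoop hc hP (h3.merge h4 hg hN3 (by omega) hlt)
      (Forest.sortedExcept_merge h4 h3.root_lt) (by omega) (by omega) h6 h7).mono le_rfl ?_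
    rintro m₂ ⟨s₂, h8, h9, h10, h11⟩
    exact ⟨s₂, _, by omega, by omega, h9, h10, h11⟩
  · rintro i m' ⟨s', T', h1, h2, h3, h4, h5⟩ hlt
    rw [eguard s' T' m' h5 h3, eval_var, h5.mem_W] at hlt
    exact ⟨s', T', by omega, h3, h4, h5, not_lt.mp hlt⟩
  · have h1 : (mul (mul (num 2) (var 7)) (rootWeight (sub (var 5) (num 2)))).cost + (var 3).cost
      + 1 ≤ 30 := by decide
    calc _ ≤ (n + 1) * (30 + (200 + 100 * n)) := Nat.mul_le_mul (by omega) (by omega)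
      _ ≤ _ := by nlinarith

end BGT

namespace BGT

open BGT.Expr BGT.Prog

/-! ### Raised growth rates and the period of the fastest bamboo -/

namespace Instance

variable {n : ℕ} (I : Instance n)

/-- The growth rates, extended by zero. -/
noncomputable def rateFn (j : ℕ) : ℝ := if h : j < n then I.rate ⟨j, h⟩ else 0

/-- The growth rates, increased to at least `W / (1000 n)`. -/
noncomputable def weight (j : ℕ) : ℝ :=
  if I.rateFn j < I.W / (1000 * n) then I.W / (1000 * n) else I.rateFn j

lemma rateFn_of_lt {j : ℕ} (h : j < n) : I.rateFn j = I.rate ⟨j, h⟩ := dif_pos h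

lemma n_pos (I : Instance n) : (0 : ℝ) < n := by exact_mod_cast lt_of_lt_of_le Nat.zero_lt_two I.two_le

lemma rateFn_le_weight (j : ℕ) : I.rateFn j ≤ I.weight j := by
  unfold weight; split_ifs with h
  exacts [h.le, le_rfl]

lemma least_le_weight (j : ℕ) : I.W / (1000 * n) ≤ I.weight j := by
  unfold weight; split_ifs with h
  exacts [le_rfl, not_lt.mp h]

lemma weight_le_add (j : ℕ) (hj : j < n) : I.weight j ≤ I.rateFn j + I.W / (1000 * n) := by
  have h1 : 0 ≤ I.W / (1000 * n) := by have := I.W_pos; have := I.n_pos; positivity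
  have h2 : 0 ≤ I.rateFn j := by rw [I.rateFn_of_lt hj]; exact (I.rate_pos _).le
  unfold weight; split_ifs <;> linarith

lemma weight_pos (j : ℕ) : 0 < I.weight j :=
  lt_of_lt_of_le (by have := I.W_pos; have := I.n_pos; positivity) (I.least_le_weight j)

lemma weight_anti (a b : ℕ) (hab : a ≤ b) (hb : b < n) : I.weight b ≤ I.weight a := by
  have h : I.rateFn b ≤ I.rateFn a := by
    rw [I.rateFn_of_lt hb, I.rateFn_of_lt (hab.trans_lt hb)]
    exact I.rate_anti hab
  have := I.least_le_weight a
  conv_lhs => unfold weight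
  split_ifs with h1
  · exact this
  · exact h.trans (I.rateFn_le_weight a)

lemma rateFn_zero : I.rateFn 0 = I.h₁ := I.rateFn_of_lt _

lemma sum_rateFn : ∑ j ∈ Finset.range n, I.rateFn j = I.H := by
  rw [Finset.sum_range, Instance.H]
  exact Finset.sum_congr rfl fun j _ => I.rateFn_of_lt j.2

lemma H_eq : I.H = 3 / 4 * (I.W - I.h₁) := by unfold W; ring

lemma sum_weight_le :
    ∑ j ∈ Finset.range n, I.weight j ≤ 3 / 4 * (I.W - I.h₁) + I.W / 1000 := by
  calc _ ≤ ∑ j ∈ Finset.range n, (I.rateFn j + I.W / (1000 * n)) :=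
        Finset.sum_le_sum fun j hj => I.weight_le_add j (Finset.mem_range.mp hj)
    _ = _ := by
      have := I.n_pos.ne'
      rw [Finset.sum_add_distrib, I.sum_rateFn, Finset.sum_const, Finset.card_range, nsmul_eq_mul,
        ← I.H_eq]
      field_simp

/-- The period of the first bamboo. -/
noncomputable def period₁ : ℕ := ⌊I.W / I.h₁⌋₊

lemma two_le_period₁ : 2 ≤ I.period₁ := by
  refine Nat.le_floor ?_
  have h1 := I.h₁_le_H
  have h2 := I.h₁_pos
  rw [le_div_iff₀ h2]
  unfold W
  push_cast; linarith

lemma period₁_mul_le : I.period₁ * I.h₁ ≤ I.W := by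
  rw [← le_div_iff₀ I.h₁_pos]
  exact Nat.floor_le (div_pos I.W_pos I.h₁_pos).le

lemma W_lt : I.W < (I.period₁ + 1) * I.h₁ := by
  rw [← div_lt_iff₀ I.h₁_pos]
  exact Nat.lt_floor_add_one _

/-- Since `H ≤ n h₁`, the bound `W` is at most `(4n/3 + 1) h₁`. -/
lemma period₁_le : I.period₁ ≤ 2 * n + 1 := by
  have h1 : I.H ≤ n * I.h₁ := by
    calc I.H ≤ ∑ _i : Fin n, I.h₁ := Finset.sum_le_sum fun i _ => I.rate_le_h₁ i
      _ = _ := by simp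
  have h2 := I.period₁_mul_le
  have h3 := I.h₁_pos
  have h4 : (I.period₁ : ℝ) ≤ 2 * n + 1 := by
    by_contra! hcon
    unfold W at h2
    nlinarith [I.n_pos]
  exact_mod_cast h4

end Instance

lemma minPeriod_le (r : ℕ) : minPeriod r ≤ r := by unfold minPeriod; split_ifs <;> omega

/-- With `W < (r + 1) h₁` this shows that the fastest bamboo is too heavy to be merged: `W ≤ 2 L
h₁`. -/
lemma lt_two_mul_minPeriod {r : ℕ} (hr : 2 ≤ r) : r + 1 ≤ 2 * minPeriod r := by
  unfold minPeriod; split_ifs <;> omega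

lemma numBins_le_minPeriod (r : ℕ) : numBins r ≤ minPeriod r := by
  unfold numBins minPeriod; split_ifs <;> omega

lemma numBins_pos {r : ℕ} (hr : 2 ≤ r) : 0 < numBins r := by
  unfold numBins; split_ifs <;> omega

/-- The values which occur in the preprocessing satisfy `P`. -/
structure Values {n : ℕ} (I : Instance n) (P : ℝ → Prop) : Prop where
  input : ∀ a j, P (inputMem I a j)
  nat : ∀ x : ℕ, x ≤ 1000 * n → P x
  sum : ∀ j ≤ n, P (∑ i ∈ Finset.range j, I.rateFn i)
  W : P I.W
  weight : ∀ i < n, ∀ e : ℕ, 2 ^ e * I.weight i ≤ I.W → P (2 ^ e * I.weight i)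

variable {n : ℕ} {I : Instance n} {P ok : ℝ → Prop} {m : Mem}

lemma inputMem_one (j : ℕ) : inputMem I 1 j = I.rateFn j := by
  simp only [inputMem, Instance.rateFn]
  split_ifs with h1 h2 h3 <;> first | rfl | simp_all

lemma inputMem_of_two_le {a : ℕ} (ha : 2 ≤ a) (j : ℕ) : inputMem I a j = 0 := by
  unfold inputMem
  rw [if_neg (by omega), dif_neg (by omega)]

lemma inputMem_zero_zero : inputMem I 0 0 = n := by simp [inputMem]

/-! ### Correctness of the remaining preprocessing loops -/

theorem reaches_sumLoop (hc : Safe P ok) (hP : Values I P) :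
    Reaches ok sumLoop (inputMem I) (100 * n) fun m' =>
      (∀ a, a ≠ 3 → a ≠ 4 → m' a = inputMem I a) ∧ m' 3 0 = I.H ∧ ∀ a j, P (m' a j) := by
  have hn := I.two_le
  refine Reaches.whileLt (J := fun i m' => (∀ a, a ≠ 3 → a ≠ 4 → m' a = inputMem I a) ∧
    (∀ a j, P (m' a j)) ∧ i ≤ n ∧ m' 4 0 = (n - i : ℕ) ∧
    m' 3 0 = ∑ k ∈ Finset.range (n - i), I.rateFn k) 30 n ?_ ?_ ?_
    ⟨fun _ _ _ => rfl, hP.input, le_rfl, by simp [inputMem_of_two_le],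
      by simp [inputMem_of_two_le]⟩ ?_
  · rintro i m' ⟨h1, h2, h3, h4, h5⟩
    exact ⟨hc m' h2 _ (by decide), hc m' h2 _ (by decide)⟩
  · rintro i m' ⟨h1, h2, h3, h4, h5⟩ hlt
    rw [eval_var, eval_var, h4, h1 0 (by decide) (by decide), inputMem_zero_zero] at hlt
    have hlt : n - i < n := by exact_mod_cast hlt
    have hi : n - (i - 1) = n - i + 1 := by omega
    refine ⟨i - 1, by omega, ?_⟩
    refine Reaches.seq 20 10 (by norm_num) ?_
    refine Reaches.write_var hc h2 (∑ k ∈ Finset.range (n - i + 1), I.rateFn k) ?_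
      (hP.sum _ (by omega)) fun ok1 => ?_
    · rw [eval_add, eval_var, h5, eval_get (i := n - i) (by rw [eval_var, h4]),
        h1 1 (by decide) (by decide), inputMem_one, Finset.sum_range_succ]
    refine Reaches.write_var hc ok1 (n - i + 1 : ℕ) ?_ (hP.nat _ (by omega)) fun ok2 => ?_
    · simp [eval_add, eval_var, eval_num, Mem.write_ne, h4]
    refine ⟨fun a h3 h4 => ?_, ok2, by omega, ?_, ?_⟩
    · rw [Mem.write_ne _ h4, Mem.write_ne _ h3, h1 a h3 h4]
    · rw [hi, Mem.write_same, if_pos rfl]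
    · rw [hi, Mem.write_ne _ (by decide), Mem.write_same, if_pos rfl]
  · rintro i m' ⟨h1, h2, h3, h4, h5⟩ hlt
    rw [eval_var, eval_var, h4, h1 0 (by decide) (by decide), inputMem_zero_zero] at hlt
    have hi : n - i = n := by
      by_contra hcon
      exact hlt (by exact_mod_cast (by omega : n - i < n))
    exact ⟨h1, by rw [h5, hi, I.sum_rateFn], h2⟩
  · have : (var 4).cost + (var 0).cost + 1 = 5 := by decide
    rw [this]; omega

lemma eval_leastWeight {W : ℝ} (h0 : m 0 0 = n) (h3 : m 3 0 = W) :
    leastWeight.eval m = W / (1000 * n) := by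
  rw [leastWeight, eval_div, eval_mul, eval_var, eval_var, eval_num, h0, h3]; norm_num

lemma Values.weight_self (hP : Values I P) {j : ℕ} (hj : j < n) (h : I.weight j ≤ I.W) :
    P (I.weight j) := by
  simpa using hP.weight j hj 0 (by simpa using h)

/-- A raised rate `W / (1000 n)` obeys the bound too, as `L ≤ 2n + 1 ≤ 1000 n`. -/
lemma Instance.weight_mul_le (I : Instance n) {j : ℕ} (hj : j < n) {L : ℕ}
    (hL : L ≤ I.period₁) : I.weight j * L ≤ I.W := by
  have h1 := I.period₁_mul_le
  have h2 : (L : ℝ) ≤ I.period₁ := by exact_mod_cast hL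
  have h3 : (I.period₁ : ℝ) ≤ 2 * n + 1 := by exact_mod_cast I.period₁_le
  have h4 := I.h₁_pos
  have h5 := I.n_pos
  have h6 := I.W_pos
  have h7 : (2 : ℝ) ≤ n := by exact_mod_cast I.two_le
  have h8 : (0 : ℝ) ≤ L := Nat.cast_nonneg L
  unfold Instance.weight
  split_ifs with h
  · rw [div_mul_eq_mul_div, div_le_iff₀ (by positivity)]
    refine mul_le_mul_of_nonneg_left ?_ h6.le
    linarith
  · rw [I.rateFn_of_lt hj]
    have := I.rate_le_h₁ ⟨j, hj⟩
    nlinarith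

theorem reaches_leafLoop (hc : Safe P ok) (hP : Values I P) (h0 : m 0 0 = n) (h3 : m 3 0 = I.W)
    (h1 : ∀ j, m 1 j = I.rateFn j) (h4 : m 4 0 = 0) (h9 : ∀ j, m 9 j = 0)
    (h10 : ∀ j, m 10 j = 0) (hok : ∀ a j, P (m a j)) :
    Reaches ok leafLoop m (100 * n) fun m' =>
      (∀ a, a ≠ 4 → a ≠ 9 → a ≠ 10 → m' a = m a) ∧
      (∀ j, m' 9 j = (Forest.singletons n I.weight).root j) ∧
      (∀ j, m' 10 j = (Forest.singletons n I.weight).wt j) ∧ ∀ a j, P (m' a j) := by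
  have hn := I.two_le
  refine Reaches.whileLt (J := fun i m' => (∀ a, a ≠ 4 → a ≠ 9 → a ≠ 10 → m' a = m a) ∧
    (∀ a j, P (m' a j)) ∧ i ≤ n ∧ m' 4 0 = (n - i : ℕ) ∧
    (∀ j, m' 9 j = if j < n - i then (j : ℝ) else 0) ∧
    (∀ j, m' 10 j = if j < n - i then I.weight j else 0)) 60 n ?_ ?_ ?_
    ⟨fun _ _ _ _ => rfl, hok, le_rfl, by simp [h4], by simp [h9], by simp [h10]⟩ ?_
  · rintro i m' ⟨-, g2, -⟩
    exact ⟨hc m' g2 _ (by decide), hc m' g2 _ (by decide)⟩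
  · rintro i m' ⟨g1, g2, g3, g4, g5, g6⟩ hlt
    have e0 : m' 0 0 = n := by rw [g1 0 (by decide) (by decide) (by decide), h0]
    have e1 : ∀ j, m' 1 j = I.rateFn j := fun j => by
      rw [g1 1 (by decide) (by decide) (by decide), h1]
    have e3 : m' 3 0 = I.W := by rw [g1 3 (by decide) (by decide) (by decide), h3]
    have e4 : (var 4).eval m' = (n - i : ℕ) := by rw [eval_var, g4]
    rw [e4, eval_var, e0] at hlt
    have hlt : n - i < n := by exact_mod_cast hlt
    have hi : n - (i - 1) = n - i + 1 := by omega
    have hPw := hP.weight_self hlt (by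
      have := I.weight_mul_le hlt (L := 1) (by have := I.two_le_period₁; omega)
      simpa using this)
    refine ⟨i - 1, by omega, ?_⟩
    refine Reaches.seq 40 20 (by norm_num) ?_
    have key : ∀ m₁ : Mem, (∀ a j, P (m₁ a j)) → m₁ = m'.write 10 (n - i) (I.weight (n - i)) →
        Reaches ok ((assign 9 (var 4) (var 4)).seq (set 4 (add (var 4) (num 1)))) m₁ 20
        fun m' => (∀ a, a ≠ 4 → a ≠ 9 → a ≠ 10 → m' a = m a) ∧
          (∀ a j, P (m' a j)) ∧ i - 1 ≤ n ∧ m' 4 0 = (n - (i - 1) : ℕ) ∧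
          (∀ j, m' 9 j = if j < n - (i - 1) then (j : ℝ) else 0) ∧
          (∀ j, m' 10 j = if j < n - (i - 1) then I.weight j else 0) := by
      intro m₁ ok1 hm₁
      subst hm₁
      rw [hi]
      refine Reaches.seq 10 10 (by norm_num) ?_
      refine Reaches.write hc ok1 (n - i) (n - i : ℕ) ?_ ?_ (hP.nat _ (by omega)) fun ok2 => ?_
      · simp [eval_var, Mem.write_ne, g4]
      · simp [eval_var, Mem.write_ne, g4]
      refine Reaches.write_var hc ok2 (n - i + 1 : ℕ) ?_ (hP.nat _ (by omega)) fun ok3 => ?_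
      · simp [eval_var, eval_add, eval_num, Mem.write_ne, g4]
      refine ⟨fun a h4 h9 h10 => ?_, ok3, by omega, ?_, fun j => ?_, fun j => ?_⟩
      · rw [Mem.write_ne _ h4, Mem.write_ne _ h9, Mem.write_ne _ h10, g1 a h4 h9 h10]
      · rw [Mem.write_same, if_pos rfl]
      · rw [Mem.write_ne _ (by decide), Mem.write_same, Mem.write_ne _ (by decide), g5]
        split_ifs <;> first | omega | (subst_vars; rfl)
      · rw [Mem.write_ne _ (by decide), Mem.write_ne _ (by decide), Mem.write_same, g6]
        split_ifs <;> first | omega | (subst_vars; rfl)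
    refine Reaches.ifLt 20 (hc m' g2 _ (by decide)) (hc m' g2 _ (by decide)) (by decide) ?_ ?_
    · rw [eval_get e4, eval_leastWeight e0 e3, e1]
      intro hw
      refine Reaches.write hc g2 (n - i) (I.weight (n - i)) e4 ?_ hPw fun ok1 => key _ ok1 rfl
      rw [eval_leastWeight e0 e3, Instance.weight, if_pos hw]
    · rw [eval_get e4, eval_leastWeight e0 e3, e1]
      intro hw
      refine Reaches.write hc g2 (n - i) (I.weight (n - i)) e4 ?_ hPw fun ok1 => key _ ok1 rfl
      rw [eval_get e4, e1, Instance.weight, if_neg hw]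
  · rintro i m' ⟨g1, g2, g3, g4, g5, g6⟩ hlt
    have e0 : m' 0 0 = n := by rw [g1 0 (by decide) (by decide) (by decide), h0]
    rw [eval_var, eval_var, g4, e0] at hlt
    have hi : n - i = n := by
      by_contra hcon
      exact hlt (by exact_mod_cast (by omega : n - i < n))
    rw [hi] at g5 g6
    refine ⟨g1, fun j => ?_, fun j => ?_, g2⟩
    · rw [g5, Forest.singletons]; simp only; split_ifs <;> simp
    · rw [g6, Forest.singletons]
  · have : (var 4).cost + (var 0).cost + 1 = 5 := by decide
    rw [this]; omega

theorem reaches_paramProg (hc : Safe P ok) (hP : Values I P) (h3 : m 3 0 = I.W)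
    (h1 : ∀ j, m 1 j = I.rateFn j) (hok : ∀ a j, P (m a j)) :
    Reaches ok paramProg m 100 fun m' => (∀ a, a ≠ 7 → a ≠ 8 → m' a = m a) ∧
      m' 7 0 = minPeriod I.period₁ ∧ m' 8 0 = numBins I.period₁ ∧ ∀ a j, P (m' a j) := by
  have hr := I.period₁_le
  have hn := I.two_le
  set r := I.period₁ with hrdef
  refine Reaches.seq 20 80 (by norm_num) ?_
  refine Reaches.write_var hc hok (r : ℕ) ?_ (hP.nat _ (by omega)) fun ok1 => ?_
  · have e : (div (var 3) (get 1 (num 0))).eval m = I.W / I.h₁ := by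
      rw [eval_div, eval_var, h3, eval_get (i := 0) (eval_num 0), h1, I.rateFn_zero]
    rw [eval_floor (by rw [e]; exact (div_pos I.W_pos I.h₁_pos).le), e]; rfl
  have e8 : ∀ x, (m.write 8 0 x) 8 0 = x := fun x => by simp
  refine Reaches.ifLt 70 (hc _ ok1 _ (by decide)) (hc _ ok1 _ (by decide)) (by decide) ?_ ?_
  · rw [eval_var, eval_num, e8]
    intro hlt
    have hlt : r < 4 := by exact_mod_cast hlt
    refine Reaches.write_var hc ok1 (r : ℕ) (by rw [eval_var, e8]) (hP.nat _ (by omega))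
      fun ok2 => ?_
    refine ⟨fun a h7 h8 => ?_, ?_, ?_, ok2⟩
    · rw [Mem.write_ne _ h7, Mem.write_ne _ h8]
    · simp [minPeriod, hlt]
    · simp [numBins, hlt, Mem.write_ne]
  · rw [eval_var, eval_num, e8]
    intro hge
    have hge : ¬ r < 4 := by exact_mod_cast hge
    refine Reaches.ifLt 60 (hc _ ok1 _ (by decide)) (hc _ ok1 _ (by decide)) (by decide) ?_ ?_
    · rw [eval_var, eval_num, e8]
      intro hlt
      have hlt : r < 12 := by exact_mod_cast hlt
      refine Reaches.seq 40 20 (by norm_num) ?_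
      refine Reaches.write_var hc ok1 (2 * (r / 2) : ℕ) ?_ (hP.nat _ (by omega)) fun ok2 => ?_
      · rw [eval_mul, eval_num, eval_floor_div (a := r) (by rw [eval_var, e8]) (eval_num 2)]
        push_cast; rfl
      refine Reaches.write_var hc ok2 (2 : ℕ) (eval_num 2) (hP.nat _ (by omega)) fun ok3 => ?_
      refine ⟨fun a h7 h8 => ?_, ?_, ?_, ok3⟩
      · rw [Mem.write_ne _ h8, Mem.write_ne _ h7, Mem.write_ne _ h8]
      · simp [minPeriod, hlt, hge, Mem.write_ne]
      · simp [numBins, hlt, hge]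
    · rw [eval_var, eval_num, e8]
      intro hlt
      have hlt : ¬ r < 12 := by exact_mod_cast hlt
      refine Reaches.seq 30 30 (by norm_num) ?_
      refine Reaches.write_var hc ok1 (r / 4 : ℕ) ?_ (hP.nat _ (by omega)) fun ok2 => ?_
      · rw [eval_floor_div (a := r) (by rw [eval_var, e8]) (eval_num 4)]
      refine Reaches.write_var hc ok2 (4 * (r / 4) : ℕ) ?_ (hP.nat _ (by omega)) fun ok3 => ?_
      · rw [eval_mul, eval_num, eval_var, Mem.write_same, if_pos rfl]; push_cast; rfl
      refine ⟨fun a h7 h8 => ?_, ?_, ?_, ok3⟩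
      · rw [Mem.write_ne _ h7, Mem.write_ne _ h8, Mem.write_ne _ h8]
      · simp [minPeriod, hlt, hge]
      · simp [numBins, hlt, hge, Mem.write_ne]

theorem reaches_binLoop {s : Forest} {p : ℕ} (hc : Safe P ok) (hP : Values I P) (hp : 0 < p)
    (hpn : p ≤ 1000 * n)
    (hw : ∀ j, I.W / (1000 * n) ≤ s.rwt j) {L : ℕ} (hm : Stores n I.W L p P s m)
    (h4 : m 4 0 = 0) :
    Reaches ok binLoop m (200 * p + 200) fun m' =>
      Ready n s (binStart I.W p s.rwt) (fun j => binCount I.W p s.rwt (binStart I.W p s.rwt j)) p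
        P 0 m' := by
  have hn := I.n_pos
  have hW := I.W_pos
  have hpR : (0 : ℝ) < p := by exact_mod_cast hp
  -- The least weight bounds the bin sizes, so even bins that reach beyond position `N` produce
  -- positions of at most `1000 n`, whose bit length is under control.
  have hcount : ∀ y, binCount I.W p s.rwt y ≤ 1000 * n / p := by
    intro y
    have h0 : 0 < s.rwt y := lt_of_lt_of_le (by positivity) (hw y)
    rw [Nat.le_div_iff_mul_le hp]
    have h1 := Nat.floor_le (a := I.W / (p * s.rwt y)) (by positivity)
    have h2 := hw y
    rw [le_div_iff₀ (by positivity)] at h1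
    rw [div_le_iff₀ (by positivity)] at h2
    have h3 : ((binCount I.W p s.rwt y : ℕ) : ℝ) * p ≤ 1000 * n := by
      refine le_of_mul_le_mul_right ?_ h0
      unfold binCount
      linarith
    exact_mod_cast h3
  have hstart : ∀ j, binStart I.W p s.rwt j ≤ j * (1000 * n / p) := by
    intro j
    induction j with
    | zero => simp [binStart]
    | succ j ih =>
      rw [binStart, Nat.succ_mul]
      exact Nat.add_le_add ih (hcount _)
  have hstart' : ∀ j ≤ p, binStart I.W p s.rwt j ≤ 1000 * n := fun j hj =>
    (hstart j).trans ((Nat.mul_le_mul_right _ hj).trans (Nat.mul_div_le _ _))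
  have hcount' : ∀ y, binCount I.W p s.rwt y ≤ 1000 * n := fun y =>
    (hcount y).trans (Nat.div_le_self _ _)
  refine Reaches.whileLt (J := fun i m' =>
    (∀ a, a ≠ 4 → a ≠ 12 → a ≠ 13 → a ≠ 14 → m' a = m a) ∧
    (∀ a j, P (m' a j)) ∧ i ≤ p ∧ m' 4 0 = (p - i : ℕ) ∧
    m' 14 0 = (binStart I.W p s.rwt (p - i) : ℕ) ∧
    (∀ j < p - i, m' 12 j = (binStart I.W p s.rwt j : ℕ)) ∧
    (∀ j < p - i, m' 13 j = (binCount I.W p s.rwt (binStart I.W p s.rwt j) : ℕ))) 90 p ?_ ?_ ?_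
    ⟨fun _ _ _ _ _ => rfl, hm.mem_ok, le_rfl, by simp [h4], by simp [hm.mem_s, binStart],
      by simp, by simp⟩ ?_
  · rintro i m' ⟨-, g2, -⟩
    exact ⟨hc m' g2 _ (by decide), hc m' g2 _ (by decide)⟩
  · rintro i m' ⟨g1, g2, g3, g4, g5, g6, g7⟩ hlt
    have e8 : m' 8 0 = p := by
      rw [g1 8 (by decide) (by decide) (by decide) (by decide), hm.mem_p]
    rw [eval_var, eval_var, g4, e8] at hlt
    have hlt : p - i < p := by exact_mod_cast hlt
    have hi : p - (i - 1) = p - i + 1 := by omega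
    refine ⟨i - 1, by omega, ?_⟩
    rw [hi]
    generalize p - i = j at *
    have hsucc : binStart I.W p s.rwt (j + 1) =
      binStart I.W p s.rwt j + binCount I.W p s.rwt (binStart I.W p s.rwt j) := rfl
    have hle := hstart' j (by omega)
    have hle' := hstart' (j + 1) (by omega)
    generalize hy : binStart I.W p s.rwt j = y at *
    refine Reaches.seq 20 70 (by norm_num) ?_
    refine Reaches.write hc g2 j (y : ℕ) (by rw [eval_var, g4]) (by rw [eval_var, g5])
      (hP.nat _ hle) fun ok1 => ?_
    refine Reaches.seq 30 40 (by norm_num) ?_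
    refine Reaches.write hc ok1 j (binCount I.W p s.rwt y : ℕ) ?_ ?_ (hP.nat _ (hcount' _))
      fun ok2 => ?_
    · simp [eval_var, Mem.write_ne, g4]
    · have e : (div (var 3) (mul (var 8) (rootWeight (var 14)))).eval
          (m'.write 12 j (y : ℕ)) = I.W / (p * s.rwt y) := by
        rw [eval_div, eval_mul, eval_rootWeight (s := s) (i := y)]
        · simp [eval_var, Mem.write_ne, e8, g1, hm.mem_W]
        · simp [Mem.write_ne, g1, hm.mem_root]
        · simp [Mem.write_ne, g1, hm.mem_wt]
        · simp [eval_var, Mem.write_ne, g5]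
      have h0 : 0 < s.rwt y := lt_of_lt_of_le (by positivity) (hw y)
      rw [eval_floor (by rw [e]; positivity), e]; rfl
    refine Reaches.seq 20 20 (by norm_num) ?_
    refine Reaches.write_var hc ok2 (y + binCount I.W p s.rwt y : ℕ) ?_
      (hP.nat _ (by omega)) fun ok3 => ?_
    · rw [eval_add, eval_get (a := 13) (e := var 4) (i := j) (by simp [eval_var, Mem.write_ne, g4])]
      simp [eval_var, Mem.write_ne, g5]
    refine Reaches.write_var hc ok3 (j + 1 : ℕ) ?_ (hP.nat _ (by omega)) fun ok4 => ?_
    · simp [eval_var, eval_add, eval_num, Mem.write_ne, g4]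
    refine ⟨fun a h4 h12 h13 h14 => ?_, ok4, by omega, ?_, ?_, fun x hx => ?_, fun x hx => ?_⟩
    · rw [Mem.write_ne _ h4, Mem.write_ne _ h14, Mem.write_ne _ h13, Mem.write_ne _ h12,
        g1 a h4 h12 h13 h14]
    · rw [Mem.write_same, if_pos rfl]
    · rw [hsucc, Mem.write_ne _ (by decide), Mem.write_same, if_pos rfl]
    · rw [Mem.write_ne _ (by decide), Mem.write_ne _ (by decide), Mem.write_ne _ (by decide),
        Mem.write_same]
      split_ifs with hxj
      · rw [hxj, hy]
      · exact g6 x (by omega)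
    · rw [Mem.write_ne _ (by decide), Mem.write_ne _ (by decide), Mem.write_same]
      split_ifs with hxj
      · rw [hxj, hy]
      · rw [Mem.write_ne _ (by decide)]; exact g7 x (by omega)
  · rintro i m' ⟨g1, g2, g3, g4, g5, g6, g7⟩ hlt
    have e8 : m' 8 0 = p := by
      rw [g1 8 (by decide) (by decide) (by decide) (by decide), hm.mem_p]
    rw [eval_var, eval_var, g4, e8] at hlt
    have hi : p - i = p := by
      by_contra hcon
      exact hlt (by exact_mod_cast (by omega : p - i < p))
    rw [hi] at g6 g7
    refine ⟨?_, e8, fun j => ?_, fun j => ?_, g6, g7, ?_, g2⟩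
    · rw [g1 0 (by decide) (by decide) (by decide) (by decide), hm.mem_n]
    · rw [g1 9 (by decide) (by decide) (by decide) (by decide), hm.mem_root]
    · rw [g1 11 (by decide) (by decide) (by decide) (by decide), hm.mem_child]
    · rw [g1 15 (by decide) (by decide) (by decide) (by decide), hm.mem_t, Nat.cast_zero]
  · have : (var 4).cost + (var 8).cost + 1 = 5 := by decide
    rw [this]; omega

end BGT

namespace BGT

open BGT.Expr BGT.Prog

variable {n : ℕ} {I : Instance n} {P ok : ℝ → Prop} {m : Mem}

/-- The bound on the sum of the weights of the roots. -/
noncomputable def Instance.sumBound (I : Instance n) : ℝ := 3 / 4 * (I.W - I.h₁) + I.W / 1000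

lemma Forest.Valid.least_le {s : Forest} {T : ℕ → Tree} {L E : ℝ}
    (hv : s.Valid n I.weight I.W L E T) {z : ℕ} (hz : z < s.Z) :
    I.W / (1000 * n) ≤ s.wt z := by
  obtain ⟨i, hi, e, he⟩ := hv.scaled z hz
  have h1 := I.least_le_weight i
  have h2 := I.weight_pos i
  have h3 : (1 : ℝ) ≤ 2 ^ e := one_le_pow₀ (by norm_num)
  rw [he]; nlinarith

/-- No weight is below `W / (1000 n)` or above `W`, hence `2 ^ height ≤ 1000 n`; the summand 10
comes from `1000 < 2 ^ 10`. -/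
lemma Forest.Valid.height_le {s : Forest} {T : ℕ → Tree} {L : ℕ} {E : ℝ} (hL : 1 ≤ L)
    (hv : s.Valid n I.weight I.W L E T) {z : ℕ} (hz : z < s.Z) :
    (T z).height ≤ Nat.log 2 n + 10 := by
  have hn := I.n_pos
  have hW := I.W_pos
  have hn0 : n ≠ 0 := by have := I.two_le; omega
  have h1 := (hv.fits z hz).two_pow_height_mul_le fun i _ => I.least_le_weight i
  have h2 := hv.wt_mul_le z hz
  have hw := hv.wt_pos (fun i _ => I.weight_pos i) hz
  have h3 : (1 : ℝ) ≤ L := by exact_mod_cast hL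
  have h4 : 2 ^ (T z).height * (I.W / (1000 * n)) ≤ I.W := h1.trans (by nlinarith)
  rw [← mul_div_assoc, div_le_iff₀ (by positivity), mul_comm] at h4
  have h5 : (2 : ℝ) ^ (T z).height ≤ 1000 * n := le_of_mul_le_mul_left h4 hW
  have h6 : 2 ^ (T z).height ≤ 1000 * n := by exact_mod_cast h5
  have h7 : 2 ^ (T z).height < 2 ^ (Nat.log 2 n + 1 + 10) := by
    have := Nat.lt_pow_succ_log_self (b := 2) (by norm_num) n
    rw [pow_add]
    omega
  have := (Nat.pow_lt_pow_iff_right (a := 2) (by norm_num)).mp h7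
  omega

theorem reaches_bins {s : Forest} {L p : ℕ} (hc : Safe P ok) (hP : Values I P) (hp : 0 < p)
    (hpn : p ≤ 2 * n + 1) (hw : ∀ j, I.W / (1000 * n) ≤ s.rwt j)
    (hm : Stores n I.W L p P s m) :
    Reaches ok ((set 4 (num 0)).seq binLoop) m (400 * n + 410) fun m' =>
      Ready n s (binStart I.W p s.rwt) (fun j => binCount I.W p s.rwt (binStart I.W p s.rwt j)) p
        P 0 m' := by
  have hn := I.two_le
  refine Reaches.seq 10 (400 * n + 400) (by omega) ?_
  refine Reaches.write_var hc hm.mem_ok (0 : ℕ) (eval_num 0) (hP.nat _ (by omega)) fun ok1 => ?_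
  have h1 : Stores n I.W L p P s (m.write 4 0 (0 : ℕ)) := hm.write ok1
  have h2 : (m.write 4 0 (0 : ℕ)) 4 0 = 0 := by simp
  exact (reaches_binLoop hc hP hp (by omega) hw h1 h2).mono (by omega) fun _ h => h

theorem reaches_preprocess (hc : Safe P ok) (hP : Values I P) :
    Reaches ok preprocessProg (inputMem I) (5000 * n ^ 2) fun m' =>
      ∃ (s : Forest) (T : ℕ → Tree) (p : ℕ), s.N ≤ n ∧
        s.Valid n I.weight I.W (minPeriod I.period₁ : ℕ) I.sumBound T ∧ s.Sorted ∧ 0 < p ∧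
        s.N ≤ binStart I.W p s.rwt p ∧
        Ready n s (binStart I.W p s.rwt)
          (fun j => binCount I.W p s.rwt (binStart I.W p s.rwt j)) p P 0 m' := by
  have hn := I.two_le
  have hr2 := I.two_le_period₁
  have hrn := I.period₁_le
  have hmp := minPeriod_le I.period₁
  have hmp2 := lt_two_mul_minPeriod hr2
  have hnb := numBins_le_minPeriod I.period₁
  have hnb0 := numBins_pos hr2
  have hL1 : 1 ≤ minPeriod I.period₁ := by omega
  have hP2 : ∀ x : ℕ, x ≤ 2 * n → P x := fun x hx => hP.nat x (by omega)
  have hgpos : ∀ i < n, 0 < I.weight i := fun i _ => I.weight_pos i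
  have hg0 : I.W ≤ 2 * (minPeriod I.period₁ : ℕ) * I.weight 0 := by
    have h1 := I.W_lt
    have h2 : ((I.period₁ : ℝ) + 1) ≤ 2 * (minPeriod I.period₁ : ℕ) := by exact_mod_cast hmp2
    have h3 : I.h₁ ≤ I.weight 0 := I.rateFn_zero ▸ I.rateFn_le_weight 0
    have h4 := I.h₁_pos
    calc I.W ≤ (I.period₁ + 1) * I.h₁ := h1.le
      _ ≤ _ := by gcongr
  have hcost : 100 * n + (30 + (10 + (100 * n + (10 + (10 + (100 + (1000 * n ^ 2 + (40 +
      (400 * n + 410))))))))) ≤ 5000 * n ^ 2 := by nlinarith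
  unfold preprocessProg
  refine Reaches.seq _ _ hcost ?_
  refine (reaches_sumLoop hc hP).mono le_rfl ?_
  rintro m₁ ⟨f1, h3, ok1⟩
  refine Reaches.seq _ _ le_rfl ?_
  refine Reaches.write_var hc ok1 I.W ?_ hP.W fun ok2 => ?_
  · rw [eval_add, eval_div, eval_mul, eval_num, eval_num, eval_var, h3,
      eval_get (i := 0) (eval_num 0), f1 1 (by decide) (by decide), inputMem_one, I.rateFn_zero,
      Instance.W]
    norm_num
  refine Reaches.seq _ _ le_rfl ?_
  refine Reaches.write_var hc ok2 (0 : ℕ) (eval_num 0) (hP2 _ (by omega)) fun ok3 => ?_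
  refine Reaches.seq _ _ le_rfl ?_
  have f3 : ∀ a, a ≠ 3 → a ≠ 4 → ((m₁.write 3 0 I.W).write 4 0 (0 : ℕ)) a = inputMem I a :=
    fun a h3 h4 => by rw [Mem.write_ne _ h4, Mem.write_ne _ h3, f1 a h3 h4]
  have e3 : ((m₁.write 3 0 I.W).write 4 0 (0 : ℕ)) 3 0 = I.W := by
    rw [Mem.write_ne _ (by decide), Mem.write_same, if_pos rfl]
  have e4 : ((m₁.write 3 0 I.W).write 4 0 (0 : ℕ)) 4 0 = 0 := by simp
  generalize (m₁.write 3 0 I.W).write 4 0 (0 : ℕ) = m₃ at *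
  refine (reaches_leafLoop hc hP (by rw [f3 _ (by decide) (by decide), inputMem_zero_zero]) e3
    (fun j => by rw [f3 _ (by decide) (by decide), inputMem_one]) e4
    (fun j => by rw [f3 _ (by decide) (by decide), inputMem_of_two_le (by norm_num)])
    (fun j => by rw [f3 _ (by decide) (by decide), inputMem_of_two_le (by norm_num)])
    ok3).mono le_rfl ?_
  rintro m₄ ⟨f4, e9, e10, ok4⟩
  have f4' : ∀ a, a ≠ 3 → a ≠ 4 → a ≠ 9 → a ≠ 10 → m₄ a = inputMem I a := fun a h3 h4 h9 h10 => by
    rw [f4 a h4 h9 h10, f3 a h3 h4]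
  have e0 : m₄ 0 0 = n := by
    rw [f4' _ (by decide) (by decide) (by decide) (by decide), inputMem_zero_zero]
  refine Reaches.seq _ _ le_rfl ?_
  refine Reaches.write_var hc ok4 (n : ℕ) ((eval_var _).trans e0) (hP2 _ (by omega)) fun ok5 => ?_
  refine Reaches.seq _ _ le_rfl ?_
  refine Reaches.write_var hc ok5 (n : ℕ) ?_ (hP2 _ (by omega)) fun ok6 => ?_
  · rw [eval_var, Mem.write_ne _ (by decide), e0]
  have f6 : ∀ a, a ≠ 5 → a ≠ 6 → ((m₄.write 5 0 (n : ℕ)).write 6 0 (n : ℕ)) a = m₄ a :=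
    fun a h5 h6 => by rw [Mem.write_ne _ h6, Mem.write_ne _ h5]
  have e5 : ((m₄.write 5 0 (n : ℕ)).write 6 0 (n : ℕ)) 5 0 = n := by simp [Mem.write_ne]
  have e6 : ((m₄.write 5 0 (n : ℕ)).write 6 0 (n : ℕ)) 6 0 = n := by simp
  generalize (m₄.write 5 0 (n : ℕ)).write 6 0 (n : ℕ) = m₆ at *
  refine Reaches.seq _ _ le_rfl ?_
  refine (reaches_paramProg hc hP ?_ (fun j => ?_) ok6).mono le_rfl ?_
  · rw [f6 _ (by decide) (by decide), f4 _ (by decide) (by decide) (by decide), e3]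
  · rw [f6 _ (by decide) (by decide), f4' _ (by decide) (by decide) (by decide) (by decide),
      inputMem_one]
  rintro m₇ ⟨f7, e7, e8, ok7⟩
  have hst : Stores n I.W (minPeriod I.period₁) (numBins I.period₁) P (Forest.singletons n I.weight)
      m₇ := by
    refine ⟨?_, ?_, ?_, ?_, e7, e8, fun j => ?_, fun j => ?_, fun j => ?_, ?_, ?_, ok7⟩
    · rw [f7 _ (by decide) (by decide), f6 _ (by decide) (by decide), e0]
    · rw [f7 _ (by decide) (by decide), f6 _ (by decide) (by decide),
        f4 _ (by decide) (by decide) (by decide), e3]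
    · rw [f7 _ (by decide) (by decide), e5]; rfl
    · rw [f7 _ (by decide) (by decide), e6]; rfl
    · rw [f7 _ (by decide) (by decide), f6 _ (by decide) (by decide), e9]
    · rw [f7 _ (by decide) (by decide), f6 _ (by decide) (by decide), e10]
    · rw [f7 _ (by decide) (by decide), f6 _ (by decide) (by decide),
        f4' _ (by decide) (by decide) (by decide) (by decide), inputMem_of_two_le (by norm_num),
        Forest.singletons, Nat.cast_zero]
    · rw [f7 _ (by decide) (by decide), f6 _ (by decide) (by decide),
        f4' _ (by decide) (by decide) (by decide) (by decide), inputMem_of_two_le (by norm_num)]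
    · rw [f7 _ (by decide) (by decide), f6 _ (by decide) (by decide),
        f4' _ (by decide) (by decide) (by decide) (by decide), inputMem_of_two_le (by norm_num)]
  refine Reaches.seq _ _ le_rfl ?_
  refine (reaches_mergeLoop (E := I.sumBound) hc hP2 hP.weight hL1 hgpos hn hg0
    (Forest.valid_init hn (fun i hi => I.weight_mul_le hi hmp) I.sum_weight_le hgpos)
    (Forest.sorted_init I.weight_anti) le_rfl hst).mono le_rfl ?_
  rintro m₈ ⟨s, T, hN, hv, hs, hst8, hlow⟩
  have hbin := fun p hp => le_binStart (W := I.W) (h := I.h₁) (w := s.rwt) (N := s.N)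
    (r := I.period₁) (p := p) I.h₁_pos rfl hr2 (fun i _ => hv.wt_pos hgpos (hv.root_lt _)) hs
    hv.two_le (fun i _ => hv.wt_mul_le _ (hv.root_lt _)) hlow (by
      have hZ := hv.le_Z hN
      have h1 := hv.fits 0 (by omega)
      rw [hv.tree_leaf 0 (by omega)] at h1
      have h2 : I.h₁ ≤ I.weight 0 := I.rateFn_zero ▸ I.rateFn_le_weight 0
      exact h2.trans (le_trans (b := s.wt 0) h1 (hv.rw_le_rw_zero hs (by omega))))
    hv.sum_le_last hp
  have hw : ∀ j, I.W / (1000 * n) ≤ s.rwt j := fun j => hv.least_le (hv.root_lt _)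
  have hN2 := hv.two_le
  refine Reaches.seq _ _ le_rfl ?_
  have key : ∀ (p : ℕ) (m₉ : Mem), 0 < p → p ≤ 2 * n + 1 → s.N ≤ binStart I.W p s.rwt p →
      Stores n I.W (minPeriod I.period₁) p P s m₉ →
      Reaches ok ((set 4 (num 0)).seq binLoop) m₉ (400 * n + 410) fun m' =>
      ∃ (s : Forest) (T : ℕ → Tree) (p : ℕ), s.N ≤ n ∧
        s.Valid n I.weight I.W (minPeriod I.period₁ : ℕ) I.sumBound T ∧ s.Sorted ∧ 0 < p ∧
        s.N ≤ binStart I.W p s.rwt p ∧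
        Ready n s (binStart I.W p s.rwt)
          (fun j => binCount I.W p s.rwt (binStart I.W p s.rwt j)) p P 0 m' :=
    fun p m₉ hp hpn hNp hm₉ => (reaches_bins hc hP hp hpn hw hm₉).mono le_rfl
      fun m' hm' => ⟨s, T, p, hN, hv, hs, hp, hNp, hm'⟩
  refine Reaches.ifLt 15 (hc _ hst8.mem_ok _ (by decide)) (hc _ hst8.mem_ok _ (by decide))
    (by decide) ?_ ?_
  · rw [eval_mul, eval_var, eval_var, eval_rootWeight hst8.mem_root hst8.mem_wt (eval_num 0),
      hst8.mem_W, hst8.mem_N]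
    intro hlt
    exact Reaches.skip (by norm_num)
      (key _ _ hnb0 (by omega) (hbin _ (by rw [if_pos hlt])) hst8)
  · rw [eval_mul, eval_var, eval_var, eval_rootWeight hst8.mem_root hst8.mem_wt (eval_num 0),
      hst8.mem_W, hst8.mem_N]
    intro hlt
    refine Reaches.write_var hc hst8.mem_ok (s.N : ℕ) ((eval_var _).trans hst8.mem_N)
      (hP2 _ (by omega)) fun ok9 => ?_
    refine key s.N _ (by omega) (by omega) (hbin _ (by rw [if_neg hlt]))
      ⟨?_, ?_, ?_, ?_, ?_, ?_, fun j => ?_, fun j => ?_, fun j => ?_, ?_, ?_, ok9⟩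
    · simpa [Mem.write_ne] using hst8.mem_n
    · simpa [Mem.write_ne] using hst8.mem_W
    · simpa [Mem.write_ne] using hst8.mem_N
    · simpa [Mem.write_ne] using hst8.mem_Z
    · simpa [Mem.write_ne] using hst8.mem_L
    · simp
    · simpa [Mem.write_ne] using hst8.mem_root j
    · simpa [Mem.write_ne] using hst8.mem_wt j
    · simpa [Mem.write_ne] using hst8.mem_child j
    · simpa [Mem.write_ne] using hst8.mem_s
    · simpa [Mem.write_ne] using hst8.mem_t

/-! ### Bit lengths of the values -/

/-- `x` is a rational number of bit length linear in the input size and the bit length of `t`, if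
the growth rates are rational. -/
def Short (I : Instance n) (c t : ℕ) (x : ℝ) : Prop :=
  ∀ q : Fin n → ℚ, (∀ i, (q i : ℝ) = I.rate i) → HasBits (c * (inputSize q + Nat.size t)) x

lemma safe_short (I : Instance n) (t : ℕ) :
    Safe (Short I 1000 t) (Short I (bitFactor * 1000) t) := by
  intro m hm e he
  refine Expr.AllOk.forall fun q => Expr.AllOk.forall fun hq => ?_
  rw [mul_assoc]
  exact Expr.allOk_hasBits (fun a j => hm a j q hq) he

lemma Short.mono {c t t' : ℕ} (h : t ≤ t') {x : ℝ} (hx : Short I c t x) : Short I c t' x :=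
  fun q hq => (hx q hq).mono
    (Nat.mul_le_mul_left _ (Nat.add_le_add_left (Nat.size_le_size h) _))

lemma le_inputSize (q : Fin n → ℚ) : n ≤ inputSize q := by
  calc n = ∑ _i : Fin n, 1 := by simp
    _ ≤ _ := Finset.sum_le_sum fun i _ => by
      have := Nat.size_pos.mpr (q i).den_pos; omega

lemma size_add_size_le_inputSize (q : Fin n → ℚ) (i : Fin n) :
    Nat.size (q i).num.natAbs + Nat.size (q i).den ≤ inputSize q :=
  Finset.single_le_sum (f := fun i => Nat.size (q i).num.natAbs + Nat.size (q i).den)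
    (fun _ _ => Nat.zero_le _) (Finset.mem_univ i)

lemma isFrac_rate {q : Fin n → ℚ} (hq : ∀ i, (q i : ℝ) = I.rate i) (i : Fin n) :
    IsFrac (Nat.size (q i).num.natAbs + Nat.size (q i).den) (I.rate i) := by
  have hpos : 0 < q i := by
    have := I.rate_pos i
    rw [← hq i] at this; exact_mod_cast this
  have hnum : ((q i).num.natAbs : ℤ) = (q i).num :=
    Int.natAbs_of_nonneg (Rat.num_nonneg.mpr hpos.le)
  refine ⟨(q i).num.natAbs, (q i).den, (q i).den_ne_zero, ?_, by omega, by omega⟩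
  rw [← hq i, Rat.cast_def]
  congr 1
  have := congrArg (Int.cast (R := ℝ)) hnum.symm
  rwa [Int.cast_natCast] at this

/-- Over the product of all denominators the bit lengths of the rates add up to the input size, with
one carry per summand; and `n` is at most the input size. -/
lemma isFrac_sum {q : Fin n → ℚ} (hq : ∀ i, (q i : ℝ) = I.rate i) {j : ℕ} (hj : j ≤ n) :
    IsFrac (2 * inputSize q + 1) (∑ i ∈ Finset.range j, I.rateFn i) := by
  set A : ℕ → ℕ := fun i => if h : i < n then
    Nat.size (q ⟨i, h⟩).num.natAbs + Nat.size (q ⟨i, h⟩).den else 0 with hA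
  have hsum : ∑ i ∈ Finset.range n, A i = inputSize q := by
    rw [Finset.sum_range]
    exact Finset.sum_congr rfl fun i _ => by simp [hA]
  have key : ∀ j ≤ n, IsFrac (∑ i ∈ Finset.range j, (A i + 1) + 1)
      (∑ i ∈ Finset.range j, I.rateFn i) := by
    intro j
    induction j with
    | zero =>
      intro _
      simpa using isFrac_natCast (A := 1) (k := 0) (by simp) le_rfl
    | succ j ih =>
      intro hj
      have h1 : IsFrac (A j) (I.rateFn j) := by
        have := isFrac_rate hq ⟨j, hj⟩
        rw [I.rateFn_of_lt hj]
        simpa [hA, Nat.lt_of_succ_le hj] using this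
      rw [Finset.sum_range_succ, Finset.sum_range_succ]
      exact ((ih (by omega)).add h1).mono (by omega)
  refine (key j hj).mono ?_
  have h1 : ∑ i ∈ Finset.range j, (A i + 1) ≤ ∑ i ∈ Finset.range n, (A i + 1) :=
    Finset.sum_le_sum_of_subset (Finset.range_mono hj)
  rw [Finset.sum_add_distrib (s := Finset.range n), hsum] at h1
  simp only [Finset.sum_const, Finset.card_range, smul_eq_mul, mul_one] at h1
  have := le_inputSize q
  omega

lemma isFrac_W {q : Fin n → ℚ} (hq : ∀ i, (q i : ℝ) = I.rate i) :
    IsFrac (3 * inputSize q + 7) I.W := by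
  have h1 := isFrac_sum hq le_rfl
  rw [I.sum_rateFn] at h1
  have h2 := (isFrac_rate hq ⟨0, by have := I.two_le; omega⟩).mono
    (size_add_size_le_inputSize q _)
  have h3 := (((isFrac_natCast (A := 3) (k := 4) (by decide) (by norm_num)).mul h1).div_natCast
    (k := 3) (B := 2) (by norm_num) (by decide)).add h2
  have e : I.W = ((4 : ℕ) : ℝ) * I.H / ((3 : ℕ) : ℝ) + I.rate ⟨0, by have := I.two_le; omega⟩ := by
    unfold Instance.W Instance.h₁; push_cast; rfl
  rw [e]
  exact h3.mono (by omega)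

lemma size_mul_thousand_le (k : ℕ) : Nat.size (1000 * k) ≤ 10 + Nat.size k :=
  (size_mul_le _ _).trans (Nat.add_le_add_right (by decide) _)

lemma values_short (I : Instance n) : Values I (Short I 1000 0) := by
  have hn := I.two_le
  have hnat : ∀ x : ℕ, x ≤ 1000 * n → Short I 1000 0 x := by
    intro x hx q hq
    have h1 := le_inputSize q
    have h2 := (Nat.size_le_size hx).trans (size_mul_thousand_le n)
    have h3 := size_le_self n
    exact hasBits_natCast (by omega)
  refine ⟨fun a j => ?_, hnat, fun j hj q hq => ?_, fun q hq => ?_, fun i hi e he q hq => ?_⟩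
  · unfold inputMem
    split_ifs with h1 h2
    · exact hnat _ (by omega)
    · intro q hq
      have h3 := size_add_size_le_inputSize q ⟨j, h2.2⟩
      exact HasBits.mono (by omega) ⟨_, hq _, h3⟩
    · exact_mod_cast hnat 0 (by omega)
  · have h1 := le_inputSize q
    exact (isFrac_sum hq hj).hasBits.mono (by omega)
  · have h1 := le_inputSize q
    exact (isFrac_W hq).hasBits.mono (by omega)
  · have h1 := le_inputSize q
    have h2 := size_le_self n
    have hnR := I.n_pos
    have hW := I.W_pos
    have h3 : IsFrac (4 * inputSize q + 17) (I.weight i) := by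
      unfold Instance.weight
      split_ifs
      · have := (isFrac_W hq).div_natCast (k := 1000 * n) (by omega) (size_mul_thousand_le n)
        push_cast at this
        exact this.mono (by omega)
      · rw [I.rateFn_of_lt hi]
        exact (isFrac_rate hq _).mono ((size_add_size_le_inputSize q _).trans (by omega))
    -- Because the weight is at least `W / (1000 n)`, the power of 2 contributes only
    -- logarithmically many digits.
    have h4 : (2 : ℝ) ^ e ≤ 1000 * n := by
      have h5 := I.least_le_weight i
      have h6 : 2 ^ e * (I.W / (1000 * n)) ≤ I.W :=
        (mul_le_mul_of_nonneg_left h5 (by positivity)).trans he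
      rw [← mul_div_assoc, div_le_iff₀ (by positivity), mul_comm] at h6
      exact le_of_mul_le_mul_left h6 hW
    have h5 : 2 ^ e ≤ 1000 * n := by exact_mod_cast h4
    have h6 := (Nat.size_le_size h5).trans (size_mul_thousand_le n)
    have h7 := (isFrac_natCast (A := 10 + Nat.size n) h6 (by omega)).mul h3
    push_cast at h7
    exact h7.hasBits.mono (by omega)

/-! ### The algorithm -/

/-- The algorithm for discrete BGT. -/
def trimming : Algorithm := ⟨preprocessProg, nextProg⟩

/-- As `Short` speaks of every rational form of the rates, and holds vacuously if there is none, a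
single run has all the required properties. -/
theorem exists_run (I : Instance n) : ∃ (S : Schedule n) (k : ℕ → ℕ),
    trimming.Runs I S (Short I (bitFactor * 1000)) k ∧ k 0 ≤ 5000 * n ^ 2 ∧
    (∀ t, k (t + 1) ≤ 200 * (Nat.log 2 n + 11)) ∧
    IsPinwheelSchedule (roundedFrequencies I (1 / 3 + I.h₁ / I.H)) S := by
  obtain ⟨m₀, k₀, hexec, hk₀, s, T, p, hN, hv, hs, hp, hbin, hready⟩ :=
    reaches_preprocess (safe_short I 0) (values_short I)
  have hL1 : 1 ≤ minPeriod I.period₁ := by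
    have := lt_two_mul_minPeriod I.two_le_period₁; omega
  set st := binStart I.W p s.rwt with hst
  set cnt := fun j => binCount I.W p s.rwt (st j) with hcnt
  have hZ : s.Z ≤ 2 * n := by have := hv.add_eq; omega
  have step : ∀ t (x : {m : Mem // Ready n s st cnt p (Short I 1000 t) t m}),
      ∃ (y : {m : Mem // Ready n s st cnt p (Short I 1000 (t + 1)) (t + 1) m}) (k : ℕ),
        Exec (Short I (bitFactor * 1000) (t + 1)) nextProg x.1 y.1 k ∧
        k ≤ 200 * (Nat.log 2 n + 11) ∧ y.1 2 0 = (treeSchedule T s.root st cnt p t : ℕ) := by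
    rintro t ⟨m, hm⟩
    obtain ⟨m', k, h1, h2, h3, h4⟩ := reaches_nextProg hv (D := Nat.log 2 n + 10) hp hZ
      (fun z hz => hv.height_le hL1 hz) (safe_short I (t + 1)) (fun x hx q hq => by
        have h1 := le_inputSize q
        have h2 := I.two_le
        have h3 : Nat.size x ≤ 2 * n + Nat.size (t + 1) := by
          rcases le_max_iff.mp hx with hx | hx
          · have := size_le_self x; omega
          · have := Nat.size_le_size hx; omega
        exact hasBits_natCast (by omega))
      { hm with mem_ok := fun a j => (hm.mem_ok a j).mono (Nat.le_succ t) }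
    exact ⟨⟨m', h3⟩, k, h1, h2, h4⟩
  choose f kf hf using step
  -- The memories are obtained by recursion together with their invariant, whose bit bound grows
  -- with the day counter.
  let ms : (t : ℕ) → {m : Mem // Ready n s st cnt p (Short I 1000 t) t m} := fun t =>
    Nat.rec ⟨m₀, hready⟩ (fun t x => f t x) t
  have hlt : ∀ t, treeSchedule T s.root st cnt p t < n := fun t =>
    hv.leaf_lt _ (hv.root_lt _) _ (Tree.hasLeaf_walk _ _)
  let ks : ℕ → ℕ := fun t => Nat.casesOn t k₀ fun t => kf t (ms t)
  refine ⟨fun t => ⟨_, hlt t⟩, ks,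
    ⟨fun t => (ms t).1, hexec, fun t => ⟨(hf t (ms t)).1, (hf t (ms t)).2.2⟩⟩, hk₀,
    fun t => (hf t (ms t)).2.1, ?_⟩
  intro i m
  rw [I.roundedFrequencies_eq]
  obtain ⟨t, h1, h2, h3⟩ := exists_treeSchedule_eq hv hs (fun i _ => I.weight_pos i) hbin i.2
    (I.rate_pos i) (by rw [← I.rateFn_of_lt i.2]; exact I.rateFn_le_weight i) m
  exact ⟨t, h1, h2, Fin.ext h3⟩

theorem Algorithm.Runs.mono {A : Algorithm} {S : Schedule n} {ok ok' : ℕ → ℝ → Prop} {k : ℕ → ℕ}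
    (h : ∀ t x, ok t x → ok' t x) (hr : A.Runs I S ok k) : A.Runs I S ok' k := by
  obtain ⟨m, h1, h2⟩ := hr
  exact ⟨m, h1.mono (h 0), fun t => ⟨(h2 t).1.mono (h _), (h2 t).2⟩⟩

theorem Algorithm.Runs.unique {A : Algorithm} {S S' : Schedule n} {ok ok' : ℕ → ℝ → Prop}
    {k k' : ℕ → ℕ} (h : A.Runs I S ok k) (h' : A.Runs I S' ok' k') : S = S' := by
  obtain ⟨m, h1, h2⟩ := h
  obtain ⟨m', h1', h2'⟩ := h'
  have key : ∀ t, m t = m' t := by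
    intro t
    induction t with
    | zero => exact (h1.unique h1').1
    | succ t ih =>
      have h3 := (h2 t).1
      rw [ih] at h3
      exact (h3.unique (h2' t).1).1
  funext t
  have h3 := (h2 t).2
  rw [key, (h2' t).2] at h3
  exact Fin.ext (by exact_mod_cast h3.symm)

theorem isPolynomialTime_trimming : trimming.IsPolynomialTime := by
  -- One constant serves as factor and exponent; the logarithmic and bit-length bounds are in fact
  -- linear and are weakened by `x ≤ x ^ c`.
  obtain ⟨c, hc⟩ : ∃ c, c = bitFactor * 1000 := ⟨_, rfl⟩
  have hc0 : 5000 ≤ c := by rw [hc]; decide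
  refine ⟨c, fun n I => ?_⟩
  obtain ⟨S, k, h1, h2, h3, -⟩ := exists_run I
  refine ⟨S, k, h1.mono fun _ _ _ => trivial, h2.trans ?_, fun t => (h3 t).trans ?_,
    fun q hq => h1.mono fun t x hx => (hx q hq).mono ?_⟩
  · exact Nat.mul_le_mul hc0 (Nat.pow_le_pow_right (by have := I.two_le; omega) (by omega))
  · have h4 : Nat.log 2 n + 1 ≤ (Nat.log 2 n + 1) ^ c := Nat.le_self_pow (by omega) _
    calc 200 * (Nat.log 2 n + 11) ≤ 5000 * (Nat.log 2 n + 1) := by omega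
      _ ≤ _ := Nat.mul_le_mul hc0 h4
  · rw [← hc]
    exact Nat.mul_le_mul_left _ (Nat.le_self_pow (by omega) _)

end BGT

theorem mainTheorem6 :
    ∃ A : BGT.Algorithm, A.IsPolynomialTime ∧
      ∀ (n : ℕ) (I : BGT.Instance n) (S : BGT.Schedule n), A.Outputs I S →
        BGT.IsPinwheelInstance (BGT.roundedFrequencies I (1 / 3 + I.h₁ / I.H)) ∧
        BGT.density (BGT.roundedFrequencies I (1 / 3 + I.h₁ / I.H)) < 3 / 4 ∧
        BGT.IsPinwheelSchedule (BGT.roundedFrequencies I (1 / 3 + I.h₁ / I.H)) S ∧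
        BGT.MH I S ≤ ENNReal.ofReal (4 / 3 + I.h₁ / I.H) * BGT.OPT I := by
  refine ⟨BGT.trimming, BGT.isPolynomialTime_trimming, fun n I S hS => ?_⟩
  obtain ⟨S', k', h1, -, -, h4⟩ := BGT.exists_run I
  obtain ⟨k, hk⟩ := hS
  obtain rfl := hk.unique h1
  exact ⟨BGT.isPinwheelInstance_roundedFrequencies I, BGT.density_roundedFrequencies_lt I, h4,
    BGT.MH_le_mul_OPT I h4⟩
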